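/- Let $c,T,a_0>0$. Let $a:\mathbb R\to\mathbb R$ be $1$-periodic and of class $C^2$ with $a(x)\ge a_0$ for all $x$, and let $\alpha:\mathbb R\to\mathbb C$ be $1$-periodic and of class $C^2$. Let $r:\mathbb C\to\mathbb C$ be twice differentiable in the real sense (that is, as a map of $\mathbb R^2$) with bounded first and second derivatives. For $2\pi$-periodic continuous $g$ put $\Pi g=\frac1{2\pi}\int_0^{2\pi}g(\sigma)\,d\sigma$ and, if $\Pi g=0$, $(\mathcal L^{-1}g)(\tau)=(I-\Pi)\int_0^\tau g(\sigma)\,d\sigma$; for $z\in\mathbb C$ let $G(\cdot,z)=\mathcal L^{-1}(I-\Pi)\big[e^{-i\tau}r(e^{i\tau}z)\big]$. For $\varepsilon\in(0,1]$ consider, on $[0,T]\times\mathbb R\times\mathbb R$, the problem $$\partial_tV+c\,\partial_xV+e^{-i\tau}r(e^{i\tau}V)=-\frac{a(x)}{\varepsilon}\,\partial_\tau V,\qquad V(0,x,\tau)=\alpha(x)+\frac{\varepsilon}{a(x)}\big[G(0,\alpha(x))-G(\tau,\alpha(x))\big],$$ for $V=V(t,x,\tau)\in\mathbb C$ that is $1$-periodic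 in $x$ and $2\pi$-periodic in $\tau$. Then there is a constant $C>0$, independent of $\varepsilon$, such that for every $\varepsilon\in(0,1]$ this problem has a unique solution $V$ of class $C^1$ on $[0,T]\times\mathbb R\times\mathbb R$, the derivatives $\partial_t^pV$, $\partial_x^pV$ ($p=1,2$), $\partial^2_{xt}V$ (in either order) and $\partial_\tau V$ exist everywhere (time derivatives being one-sided at $t=0$ and $t=T$), and for all $t\in[0,T]$ $$\|\partial_t^pV(t)\|_{L^\infty_{\tau,x}}\le C,\quad \|\partial_x^pV(t)\|_{L^\infty_{\tau,x}}\le C\quad(p=0,1,2),\qquad \|\partial^2_{xt}V(t)\|_{L^\infty_{\tau,x}}\le C,\quad \|\partial_\tau V(t)\|_{L^\infty_{\tau,x}}\le C.$$ -/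

import Mathlib

open Set

noncomputable section

namespace NGO

/-- The phase average `Π g = (1/2π) ∫₀^{2π} g(σ) dσ`. -/
def phaseMean (g : ℝ → ℂ) : ℂ :=
  (1 / (2 * Real.pi) : ℝ) * ∫ σ in (0 : ℝ)..(2 * Real.pi), g σ

/-- The inverse of `∂_τ` on functions of zero phase average:
`(L⁻¹ g)(τ) = (I - Π) ∫₀^τ g(σ) dσ`. -/
def phaseInv (g : ℝ → ℂ) (τ : ℝ) : ℂ :=
  (∫ σ in (0 : ℝ)..τ, g σ) - phaseMean (fun τ' => ∫ σ in (0 : ℝ)..τ', g σ)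

/-- The filtered source term `e^{-iτ} r(e^{iτ} z)`. -/
def filteredSource (r : ℂ → ℂ) (τ : ℝ) (z : ℂ) : ℂ :=
  Complex.exp (-(Complex.I * τ)) * r (Complex.exp (Complex.I * τ) * z)

/-- `G(τ, z) = L⁻¹ (I - Π) [e^{-iτ} r(e^{iτ} z)]`. -/
def corrector (r : ℂ → ℂ) (τ : ℝ) (z : ℂ) : ℂ :=
  phaseInv (fun σ => filteredSource r σ z - phaseMean (fun σ' => filteredSource r σ' z)) τ

/-- The well-prepared data `α(x) + (ε / a(x)) [G(0, α(x)) - G(τ, α(x))]`. -/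
def wellPrepared (ε : ℝ) (a : ℝ → ℝ) (r : ℂ → ℂ) (α : ℝ → ℂ) (x τ : ℝ) : ℂ :=
  α x + ((ε / a x : ℝ) : ℂ) * (corrector r 0 (α x) - corrector r τ (α x))

/-- `V(t, x, τ)` is a classical solution on `[0, T]` (of class `C¹` up to `t = 0` and `t = T`),
`1`-periodic in `x` and `2π`-periodic in `τ`, of
`∂_t V + c ∂_x V + e^{-iτ} r(e^{iτ} V) = -(a(x)/ε) ∂_τ V` with the well-prepared data at `t = 0`.
The time derivative is one-sided at the end points of `[0, T]`. -/
structure IsSolution (c T ε : ℝ) (a : ℝ → ℝ) (r : ℂ → ℂ) (α : ℝ → ℂ)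
    (V : ℝ → ℝ → ℝ → ℂ) : Prop where
  contDiffOn : ContDiffOn ℝ 1 (fun p : ℝ × ℝ × ℝ => V p.1 p.2.1 p.2.2) (Icc 0 T ×ˢ univ)
  periodic_x : ∀ t ∈ Icc 0 T, ∀ x τ : ℝ, V t (x + 1) τ = V t x τ
  periodic_phase : ∀ t ∈ Icc 0 T, ∀ x τ : ℝ, V t x (τ + 2 * Real.pi) = V t x τ
  init : ∀ x τ : ℝ, V 0 x τ = wellPrepared ε a r α x τ
  eqn : ∀ t ∈ Icc 0 T, ∀ x τ : ℝ,
    derivWithin (fun s => V s x τ) (Icc 0 T) t + (c : ℂ) * deriv (fun y => V t y τ) x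
        + filteredSource r τ (V t x τ)
      = -((a x / ε : ℝ) : ℂ) * deriv (fun σ => V t x σ) τ

/-- On `[0, T]` the derivatives `∂_t V, ∂_t² V, ∂_x V, ∂_x² V, ∂²_{xt} V` (in both orders) and
`∂_τ V` exist at every point `(t, x, τ)`, and they and `V` are bounded by `C` in modulus. -/
def DerivativesBoundedBy (T C : ℝ) (V : ℝ → ℝ → ℝ → ℂ) : Prop :=
  ∃ Vt Vx Vτ Vtt Vxx Vxt : ℝ → ℝ → ℝ → ℂ, ∀ t ∈ Icc 0 T, ∀ x τ : ℝ,
    HasDerivWithinAt (fun s => V s x τ) (Vt t x τ) (Icc 0 T) t ∧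
    HasDerivWithinAt (fun s => Vt s x τ) (Vtt t x τ) (Icc 0 T) t ∧
    HasDerivAt (fun y => V t y τ) (Vx t x τ) x ∧
    HasDerivAt (fun y => Vx t y τ) (Vxx t x τ) x ∧
    HasDerivAt (fun y => Vt t y τ) (Vxt t x τ) x ∧
    HasDerivWithinAt (fun s => Vx s x τ) (Vxt t x τ) (Icc 0 T) t ∧
    HasDerivAt (fun σ => V t x σ) (Vτ t x τ) τ ∧
    ‖V t x τ‖ ≤ C ∧ ‖Vt t x τ‖ ≤ C ∧ ‖Vtt t x τ‖ ≤ C ∧ ‖Vx t x τ‖ ≤ C ∧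
    ‖Vxx t x τ‖ ≤ C ∧ ‖Vxt t x τ‖ ≤ C ∧ ‖Vτ t x τ‖ ≤ C

end NGO

end

/-! The left side and the stiff term together form the transport operator with direction `(1, c,
a(x)/ε)`. Along its characteristics the problem is an ordinary differential equation with globally
Lipschitz right-hand side, which gives existence and uniqueness (`exists_global_solution`,
`IsSolution.eqOn`). The work lies in the regularity of that solution and in bounds uniform in `ε`.

Regularity: `r` is twice differentiable but not `C²`, so second derivatives of `V` exist everywhere
without being continuous. The class that fits is `TwiceLip`: twice differentiable with locally
Lipschitz first derivative. It is stable under composition, and `IsFlow.twiceLip` shows that it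
passes from the data of an ODE to its time-one map. The variational equation is differentiated once
more at a single parameter value, where the new coefficient is only bounded and measurable in time;
dominated convergence replaces uniform continuity (`exists_hasFDerivAt_of_ode`).

Uniform bounds: `∂_t` commutes with the transport operator, while `∂_x` produces the singular
commutator `(a'/ε) ∂_τ V`. The equation itself gives `(a/ε) ∂_τ V = -f - ∂_t V - c ∂_x V`, where `f`
is the filtered source, so this commutator is bounded by non-singular quantities
(`norm_phase_deriv_le`, `norm_commutator_le`). Hence the derivatives are estimated in the order
`∂_t`, `∂_x`, `∂_t²`, `∂²_{xt}`, `∂_x²`, each by a Gronwall argument in which the earlier ones are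
known. Since the derivative being estimated need not be differentiable, the Gronwall argument acts
on difference quotients along characteristics (`norm_fderiv_le_of_transport`) and is closed by
iteration (`le_of_halving`).

Initial values: the phase dependence of the data is `O(ε)`, so `∂_t V(0)` and `∂²_{xt} V(0)` are
bounded. For `∂_t² V(0)` one needs `∂_τ ∂_t V(0) = O(ε)`. The corrector satisfies `a ∂_τ β = Πf -
f(τ, α)` for the profile `β`, and this cancels the leading oscillation of `∂_t V(0)`
(`init_profile_phase`, `norm_init_time_phase_le`). -/

noncomputable section

namespace NGO

open MeasureTheory Filter Topology
open scoped NNReal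

/-! ### Twice differentiable maps with locally Lipschitz derivative. -/

/-- `g` is twice differentiable everywhere and its derivative is locally Lipschitz. -/
structure TwiceLip {X F : Type*} [NormedAddCommGroup X] [NormedSpace ℝ X]
    [NormedAddCommGroup F] [NormedSpace ℝ F] (g : X → F) : Prop where
  diff : Differentiable ℝ g
  diff' : Differentiable ℝ (fderiv ℝ g)
  lip : LocallyLipschitz (fderiv ℝ g)

theorem locallyLipschitz_clm_comp {X Y Z F : Type*} [NormedAddCommGroup X]
    [NormedAddCommGroup Y] [NormedSpace ℝ Y] [NormedAddCommGroup Z] [NormedSpace ℝ Z]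
    [NormedAddCommGroup F] [NormedSpace ℝ F] {A : X → Z →L[ℝ] F} {B : X → Y →L[ℝ] Z}
    (hA : LocallyLipschitz A) (hB : LocallyLipschitz B) :
    LocallyLipschitz fun x => (A x).comp (B x) := by
  intro x
  obtain ⟨K, t, ht, hK⟩ := hA x
  obtain ⟨K', t', ht', hK'⟩ := hB x
  have hA1 : ∀ᶠ y in nhds x, ‖A y‖ < ‖A x‖ + 1 :=
    (hA.continuous.norm.tendsto x).eventually_lt_const (by linarith)
  have hB1 : ∀ᶠ y in nhds x, ‖B y‖ < ‖B x‖ + 1 :=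
    (hB.continuous.norm.tendsto x).eventually_lt_const (by linarith)
  refine ⟨(‖A x‖₊ + 1) * K' + K * (‖B x‖₊ + 1), t ∩ t' ∩ {y | ‖A y‖ < ‖A x‖ + 1} ∩
    {y | ‖B y‖ < ‖B x‖ + 1}, Filter.inter_mem (Filter.inter_mem (Filter.inter_mem ht ht') hA1) hB1,
    LipschitzOnWith.of_dist_le_mul fun y hy z hz => ?_⟩
  obtain ⟨⟨⟨hy1, hy2⟩, hy3⟩, hy4⟩ := hy
  obtain ⟨⟨⟨hz1, hz2⟩, hz3⟩, hz4⟩ := hz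
  have e : (A y).comp (B y) - (A z).comp (B z)
      = (A y).comp (B y - B z) + (A y - A z).comp (B z) := by
    ext v; simp
  have h1 := hK.norm_sub_le hy1 hz1
  have h2 := hK'.norm_sub_le hy2 hz2
  rw [dist_eq_norm, e, dist_eq_norm]
  calc _ ≤ ‖A y‖ * ‖B y - B z‖ + ‖A y - A z‖ * ‖B z‖ :=
        (norm_add_le _ _).trans (add_le_add (ContinuousLinearMap.opNorm_comp_le _ _)
          (ContinuousLinearMap.opNorm_comp_le _ _))
    _ ≤ (‖A x‖ + 1) * (K' * ‖y - z‖) + (K * ‖y - z‖) * (‖B x‖ + 1) := by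
        gcongr
        · exact le_of_lt hy3
        · exact le_of_lt hz4
    _ = _ := by push_cast; ring

namespace TwiceLip

variable {X Y F : Type*} [NormedAddCommGroup X] [NormedSpace ℝ X]
  [NormedAddCommGroup Y] [NormedSpace ℝ Y] [NormedAddCommGroup F] [NormedSpace ℝ F]

theorem of_contDiff {g : X → F} (h : ContDiff ℝ 2 g) : TwiceLip g := by
  have h1 : ContDiff ℝ 1 (fderiv ℝ g) := h.fderiv_right (by norm_num)
  exact ⟨h.differentiable (by norm_num), h1.differentiable (by norm_num), h1.locallyLipschitz⟩

theorem contDiff {g : X → F} (h : TwiceLip g) : ContDiff ℝ 1 g :=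
  contDiff_one_iff_fderiv.2 ⟨h.diff, h.diff'.continuous⟩

theorem continuous {g : X → F} (h : TwiceLip g) : Continuous g := h.diff.continuous

theorem prodMk {g : X → Y} {k : X → F} (hg : TwiceLip g) (hk : TwiceLip k) :
    TwiceLip (fun x => (g x, k x)) := by
  let P : ((X →L[ℝ] Y) × (X →L[ℝ] F)) ≃ₗᵢ[ℝ] (X →L[ℝ] Y × F) := ContinuousLinearMap.prodₗᵢ ℝ
  have e : fderiv ℝ (fun x => (g x, k x)) = fun x => P (fderiv ℝ g x, fderiv ℝ k x) := by
    funext x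
    exact ((hg.diff x).hasFDerivAt.prodMk (hk.diff x).hasFDerivAt).fderiv
  refine ⟨hg.diff.prodMk hk.diff, ?_, ?_⟩
  · rw [e]
    exact P.toContinuousLinearEquiv.differentiable.comp (hg.diff'.prodMk hk.diff')
  · rw [e]
    exact P.lipschitz.locallyLipschitz.comp (hg.lip.prodMk hk.lip)

theorem comp {g : Y → F} {k : X → Y} (hg : TwiceLip g) (hk : TwiceLip k) :
    TwiceLip (fun x => g (k x)) := by
  have e : fderiv ℝ (fun x => g (k x))
      = fun x => (fderiv ℝ g (k x)).comp (fderiv ℝ k x) := by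
    funext x
    exact fderiv_comp x (hg.diff (k x)) (hk.diff x)
  refine ⟨hg.diff.comp hk.diff, ?_, ?_⟩
  · rw [e]
    have h1 : Differentiable ℝ fun x => fderiv ℝ g (k x) := hg.diff'.comp hk.diff
    exact h1.clm_comp hk.diff'
  · rw [e]
    exact locallyLipschitz_clm_comp (hg.lip.comp hk.contDiff.locallyLipschitz) hk.lip

theorem comp_contDiff {g : Y → F} {k : X → Y} (hg : TwiceLip g) (hk : ContDiff ℝ 2 k) :
    TwiceLip (fun x => g (k x)) := hg.comp (of_contDiff hk)

theorem const (c : F) : TwiceLip (fun _ : X => c) := of_contDiff contDiff_const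

theorem add {g k : X → F} (hg : TwiceLip g) (hk : TwiceLip k) : TwiceLip (fun x => g x + k x) :=
  (of_contDiff (contDiff_fst.add contDiff_snd) : TwiceLip fun p : F × F => p.1 + p.2).comp
    (hg.prodMk hk)

theorem sub {g k : X → F} (hg : TwiceLip g) (hk : TwiceLip k) : TwiceLip (fun x => g x - k x) :=
  (of_contDiff (contDiff_fst.sub contDiff_snd) : TwiceLip fun p : F × F => p.1 - p.2).comp
    (hg.prodMk hk)

theorem mul {g k : X → ℂ} (hg : TwiceLip g) (hk : TwiceLip k) : TwiceLip (fun x => g x * k x) :=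
  (of_contDiff (contDiff_fst.mul contDiff_snd) : TwiceLip fun p : ℂ × ℂ => p.1 * p.2).comp
    (hg.prodMk hk)

theorem smul {g : X → ℝ} {k : X → F} (hg : TwiceLip g) (hk : TwiceLip k) :
    TwiceLip (fun x => g x • k x) :=
  (of_contDiff (contDiff_fst.smul contDiff_snd) : TwiceLip fun p : ℝ × F => p.1 • p.2).comp
    (hg.prodMk hk)

/-- Symmetry of the second derivative needs no continuity of it: existence of the first derivative
everywhere and of the second at the point suffices. -/
theorem symm {g : X → F} (hg : TwiceLip g) (x v w : X) :
    fderiv ℝ (fderiv ℝ g) x v w = fderiv ℝ (fderiv ℝ g) x w v :=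
  second_derivative_symmetric (fun y => (hg.diff y).hasFDerivAt) (hg.diff' x).hasFDerivAt v w

theorem exists_bound [FiniteDimensional ℝ X] {g : X → F} (hg : TwiceLip g) {s : Set X}
    (hs : Bornology.IsBounded s) :
    ∃ C : ℝ, 0 ≤ C ∧ ∀ x ∈ s, ‖g x‖ ≤ C ∧ ‖fderiv ℝ g x‖ ≤ C ∧
      ‖fderiv ℝ (fderiv ℝ g) x‖ ≤ C := by
  have : ProperSpace X := FiniteDimensional.proper ℝ X
  obtain ⟨R, hR⟩ := hs.subset_closedBall 0
  -- The second derivative is not continuous, so it is bounded by a Lipschitz constant of the first.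
  -- The enlarged radius makes the ball a neighbourhood of every point of `s`.
  have hc := isCompact_closedBall (0 : X) (R + 1)
  obtain ⟨C0, h0⟩ := hc.exists_bound_of_continuousOn hg.continuous.continuousOn
  obtain ⟨C1, h1⟩ := hc.exists_bound_of_continuousOn hg.diff'.continuous.continuousOn
  obtain ⟨K, hK⟩ := (hg.lip.locallyLipschitzOn
    (s := Metric.closedBall (0 : X) (R + 1))).exists_lipschitzOnWith_of_compact hc
  refine ⟨max (max C0 C1) K, le_max_of_le_right K.2, fun x hx => ?_⟩
  have hx' : x ∈ Metric.closedBall (0 : X) (R + 1) :=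
    Metric.closedBall_subset_closedBall (by linarith) (hR hx)
  refine ⟨(h0 x hx').trans (by simp), (h1 x hx').trans (by simp), ?_⟩
  refine le_trans (norm_fderiv_le_of_lipschitzOn ℝ ?_ hK) (le_max_right _ _)
  have := hR hx
  rw [mem_closedBall_zero_iff] at this
  exact Filter.mem_of_superset (Metric.closedBall_mem_nhds x one_pos) fun y hy => by
    rw [mem_closedBall_zero_iff]
    rw [mem_closedBall_iff_norm] at hy
    calc ‖y‖ = ‖(y - x) + x‖ := by simp
      _ ≤ ‖y - x‖ + ‖x‖ := norm_add_le _ _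
      _ ≤ R + 1 := by linarith

/-- Joint Lipschitz bounds for `g` and its derivative on bounded sets. -/
theorem exists_lipschitz [FiniteDimensional ℝ X] {g : X → F} (hg : TwiceLip g) {s : Set X}
    (hs : Bornology.IsBounded s) :
    ∃ C : ℝ, 0 ≤ C ∧ ∀ x ∈ s, ∀ y ∈ s, ‖g x - g y‖ ≤ C * ‖x - y‖ ∧
      ‖fderiv ℝ g x - fderiv ℝ g y‖ ≤ C * ‖x - y‖ := by
  have : ProperSpace X := FiniteDimensional.proper ℝ X
  obtain ⟨R, hR⟩ := hs.subset_closedBall 0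
  have hc := isCompact_closedBall (0 : X) R
  obtain ⟨K, hK⟩ := (hg.contDiff.locallyLipschitz.locallyLipschitzOn
    (s := Metric.closedBall (0 : X) R)).exists_lipschitzOnWith_of_compact hc
  obtain ⟨K', hK'⟩ := (hg.lip.locallyLipschitzOn
    (s := Metric.closedBall (0 : X) R)).exists_lipschitzOnWith_of_compact hc
  refine ⟨max K K', le_max_of_le_right K'.2, fun x hx y hy => ⟨?_, ?_⟩⟩
  · exact (hK.norm_sub_le (hR hx) (hR hy)).trans (by gcongr; exact le_max_left _ _)
  · exact (hK'.norm_sub_le (hR hx) (hR hy)).trans (by gcongr; exact le_max_right _ _)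

end TwiceLip

/-! ### Gronwall bounds, solvability and differentiation in a parameter on the unit interval. -/

section ODE

variable {E : Type*} [NormedAddCommGroup E] [NormedSpace ℝ E]

theorem norm_le_of_hasDerivWithinAt {f f' : ℝ → E} {δ k ε : ℝ} (hk : 0 ≤ k) (hε : 0 ≤ ε)
    (hf : ∀ s ∈ Icc (0 : ℝ) 1, HasDerivWithinAt f (f' s) (Icc 0 1) s) (h0 : ‖f 0‖ ≤ δ)
    (hb : ∀ s ∈ Icc (0 : ℝ) 1, ‖f' s‖ ≤ k * ‖f s‖ + ε) :
    ∀ s ∈ Icc (0 : ℝ) 1, ‖f s‖ ≤ (δ + ε) * Real.exp (k + 1) := by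
  intro s hs
  have hδ : 0 ≤ δ := (norm_nonneg _).trans h0
  -- Rate `k + 1` instead of `k` keeps the rate nonzero, so that one closed formula for the Gronwall
  -- bound covers `k = 0`.
  have h := norm_le_gronwallBound_of_norm_deriv_right_le (K := k + 1) (ε := ε) (δ := δ)
    (fun t ht => (hf t ht).continuousWithinAt)
    (fun t ht => (hf t (Ico_subset_Icc_self ht)).mono_of_mem_nhdsWithin
      (Icc_mem_nhdsGE_of_mem ht)) h0
    (fun t ht => (hb t (Ico_subset_Icc_self ht)).trans
      (by nlinarith [norm_nonneg (f t)])) s hs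
  refine h.trans ?_
  have hm := gronwallBound_mono hδ hε (by linarith : 0 ≤ k + 1) (by linarith [hs.2] : s - 0 ≤ 1)
  refine hm.trans ?_
  rw [gronwallBound_of_K_ne_0 (by linarith : k + 1 ≠ 0)]
  have h1 : ε / (k + 1) ≤ ε := div_le_self hε (by linarith)
  have h2 : 0 ≤ Real.exp (k + 1) - 1 := by
    linarith [Real.add_one_le_exp (k + 1)]
  have h3 : ε / (k + 1) * (Real.exp (k + 1) - 1) ≤ ε * (Real.exp (k + 1) - 1) := by gcongr
  simp only [mul_one]
  nlinarith

theorem hasDerivWithinAt_integral {f : ℝ → E} [CompleteSpace E]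
    (hf : ContinuousOn f (Icc (0 : ℝ) 1)) {s : ℝ} (hs : s ∈ Icc (0 : ℝ) 1) :
    HasDerivWithinAt (fun t => ∫ u in (0 : ℝ)..t, f u) (f s) (Icc 0 1) s := by
  have : Fact (s ∈ Icc (0 : ℝ) 1) := ⟨hs⟩
  refine intervalIntegral.integral_hasDerivWithinAt_right ?_
    (hf.stronglyMeasurableAtFilter_nhdsWithin measurableSet_Icc s) (hf s hs)
  refine (hf.mono ?_).intervalIntegrable
  rw [uIcc_of_le hs.1]
  exact Icc_subset_Icc_right hs.2

theorem ode_unique_on_unit {F : ℝ → E → E} {K : ℝ≥0}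
    (hF : ∀ t ∈ Icc (0 : ℝ) 1, LipschitzWith K (F t)) {α γ : ℝ → E} (h0 : α 0 = γ 0)
    (hα : ∀ t ∈ Icc (0 : ℝ) 1, HasDerivWithinAt α (F t (α t)) (Icc 0 1) t)
    (hγ : ∀ t ∈ Icc (0 : ℝ) 1, HasDerivWithinAt γ (F t (γ t)) (Icc 0 1) t) :
    EqOn α γ (Icc 0 1) :=
  ODE_solution_unique_of_mem_Icc_right (s := fun _ => univ)
    (fun t ht => (hF t (Ico_subset_Icc_self ht)).lipschitzOnWith)
    (fun t ht => (hα t ht).continuousWithinAt)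
    (fun t ht => (hα t (Ico_subset_Icc_self ht)).mono_of_mem_nhdsWithin (Icc_mem_nhdsGE_of_mem ht))
    (fun _ _ => mem_univ _) (fun t ht => (hγ t ht).continuousWithinAt)
    (fun t ht => (hγ t (Ico_subset_Icc_self ht)).mono_of_mem_nhdsWithin (Icc_mem_nhdsGE_of_mem ht))
    (fun _ _ => mem_univ _) h0

variable [CompleteSpace E]

theorem exists_ode_solution_short (F : ℝ → E → E) (K : ℝ≥0) {a b : ℝ} (hab : a ≤ b)
    (hF : ∀ t ∈ Icc a b, LipschitzWith K (F t)) (hc : ∀ x, ContinuousOn (F · x) (Icc a b))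
    (hK : (1 + K) * (b - a) ≤ 1) (x₀ : E) :
    ∃ α : ℝ → E, α a = x₀ ∧ ∀ t ∈ Icc a b, HasDerivWithinAt α (F t (α t)) (Icc a b) t := by
  obtain ⟨M, hM⟩ := isCompact_Icc.exists_bound_of_continuousOn (hc x₀)
  have hM0 : 0 ≤ M := (norm_nonneg _).trans (hM a (left_mem_Icc.2 hab))
  lift M to ℝ≥0 using hM0
  -- On the ball of radius `M` about `x₀` the field is at most `M + K * M`. A time step of length at
  -- most `1 / (1 + K)` therefore cannot leave that ball, whatever `x₀` is.
  have : IsPicardLindelof F (⟨a, left_mem_Icc.2 hab⟩ : Icc a b) x₀ M 0 (M + K * M) K := by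
    refine ⟨fun t ht => (hF t ht).lipschitzOnWith, fun x _ => hc x, fun t ht x hx => ?_, ?_⟩
    · have h1 := (hF t ht).norm_sub_le x x₀
      rw [mem_closedBall_iff_norm] at hx
      calc ‖F t x‖ = ‖F t x₀ + (F t x - F t x₀)‖ := by simp
        _ ≤ ‖F t x₀‖ + ‖F t x - F t x₀‖ := norm_add_le _ _
        _ ≤ M + K * M := by
          gcongr
          · exact hM t ht
          · exact h1.trans (by gcongr)
        _ = _ := by push_cast; ring
    · push_cast
      rw [sub_self, max_eq_left (by linarith)]
      have := M.2
      calc ((M : ℝ) + K * M) * (b - a) = M * ((1 + K) * (b - a)) := by ring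
        _ ≤ M * 1 := by gcongr
        _ = _ := by ring
  exact this.exists_eq_forall_mem_Icc_hasDerivWithinAt₀

/-- The admissible step length depends only on `K`, so `N ≥ 1 + K` steps of length `1 / N` glue to a
solution on the whole interval. -/
theorem exists_ode_solution (F : ℝ → E → E) (K : ℝ≥0)
    (hF : ∀ t ∈ Icc (0 : ℝ) 1, LipschitzWith K (F t))
    (hc : ∀ x, ContinuousOn (F · x) (Icc (0 : ℝ) 1)) (x₀ : E) :
    ∃ α : ℝ → E, α 0 = x₀ ∧
      ∀ t ∈ Icc (0 : ℝ) 1, HasDerivWithinAt α (F t (α t)) (Icc 0 1) t := by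
  obtain ⟨N, hN⟩ := exists_nat_ge (1 + (K : ℝ))
  have hN0 : (0 : ℝ) < N := lt_of_lt_of_le (by positivity) hN
  have key : ∀ n : ℕ, n ≤ N → ∃ α : ℝ → E, α 0 = x₀ ∧
      ∀ t ∈ Icc (0 : ℝ) (n / N), HasDerivWithinAt α (F t (α t)) (Icc 0 (n / N)) t := by
    intro n
    induction n with
    | zero =>
      refine fun _ => ⟨fun _ => x₀, rfl, fun t ht => ?_⟩
      have : Icc (0 : ℝ) ((0 : ℕ) / N) = {0} := by simp
      rw [this] at ht ⊢
      rw [mem_singleton_iff.1 ht]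
      exact HasFDerivWithinAt.of_subsingleton subsingleton_singleton
    | succ n ih =>
      intro hn
      obtain ⟨α, h0, hα⟩ := ih (by omega)
      set a : ℝ := n / N with ha
      set b : ℝ := (n + 1 : ℕ) / N with hb
      have ha0 : 0 ≤ a := by positivity
      have hba : b - a = 1 / N := by rw [ha, hb]; push_cast; field_simp; ring
      have hab : a ≤ b := by
        have : 0 < 1 / (N : ℝ) := by positivity
        linarith
      have hb1 : b ≤ 1 := by
        rw [hb, div_le_one hN0]; exact_mod_cast hn
      have hsub : Icc a b ⊆ Icc 0 1 := Icc_subset_Icc ha0 hb1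
      obtain ⟨γ, hγ0, hγ⟩ := exists_ode_solution_short F K hab (fun t ht => hF t (hsub ht))
        (fun x => (hc x).mono hsub) (by rw [hba, mul_one_div, div_le_one hN0]; exact hN) (α a)
      let ω : ℝ → E := fun t => if t ≤ a then α t else γ t
      have e1 : EqOn ω α (Icc 0 a) := fun t ht => if_pos ht.2
      have e2 : EqOn ω γ (Icc a b) := fun t ht => by
        rcases eq_or_lt_of_le ht.1 with h | h
        · rw [← h]; simp [ω, hγ0]
        · exact if_neg (not_le.2 h)
      have hU : Icc 0 b = Icc 0 a ∪ Icc a b := (Icc_union_Icc_eq_Icc ha0 hab).symm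
      have hend : ∀ (u v t : ℝ) (y : E), t ∉ Icc u v → HasDerivWithinAt ω y (Icc u v) t := by
        intro u v t y ht
        exact HasFDerivWithinAt.of_notMem_closure (by rwa [closure_Icc])
      refine ⟨ω, (e1 ⟨le_rfl, ha0⟩).trans h0, fun t ht => ?_⟩
      rw [hU]
      refine HasDerivWithinAt.union ?_ ?_
      · by_cases hta : t ∈ Icc 0 a
        · have := (hα t hta).congr e1 (e1 hta)
          rwa [← e1 hta] at this
        · exact hend _ _ _ _ hta
      · by_cases hta : t ∈ Icc a b
        · have := (hγ t hta).congr e2 (e2 hta)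
          rwa [← e2 hta] at this
        · exact hend _ _ _ _ hta
  obtain ⟨α, h0, hα⟩ := key N le_rfl
  rw [div_self hN0.ne'] at hα
  exact ⟨α, h0, hα⟩

variable {Q : Type*} [NormedAddCommGroup Q] [NormedSpace ℝ Q]

omit [NormedSpace ℝ E] [CompleteSpace E] in
theorem intervalIntegrable_of_unit {f : ℝ → E} (hf : IntegrableOn f (Icc 0 1)) {s : ℝ}
    (hs : s ∈ Icc (0 : ℝ) 1) : IntervalIntegrable f volume 0 s := by
  refine intervalIntegrable_iff.2 (hf.mono_set ?_)
  rw [uIoc_of_le hs.1]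
  exact Ioc_subset_Icc_self.trans (Icc_subset_Icc_right hs.2)

/-- Differentiable dependence on parameters at one parameter value. The right-hand side `g s q`
is split into a linear part `B s (Y s q)` and a remainder that only has to be differentiable in
`q` at `q₀`, with a derivative that is measurable in `s`. -/
theorem exists_hasFDerivAt_of_ode {Y g : ℝ → Q → E} {B : ℝ → E →L[ℝ] E} {N' : ℝ → Q →L[ℝ] E}
    {Z₀ : Q →L[ℝ] E} {q₀ : Q} {U : Set Q} {L : ℝ} (hU : U ∈ 𝓝 q₀)
    (hY : ∀ q ∈ U, ∀ s ∈ Icc (0 : ℝ) 1, HasDerivWithinAt (Y · q) (g s q) (Icc 0 1) s)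
    (hg : ∀ q ∈ U, ContinuousOn (g · q) (Icc 0 1)) (hB : ContinuousOn B (Icc 0 1))
    (hN : ∀ s ∈ Icc (0 : ℝ) 1, HasFDerivAt (fun q => g s q - B s (Y s q)) (N' s) q₀)
    (hL : ∀ q ∈ U, ∀ s ∈ Icc (0 : ℝ) 1,
      ‖(g s q - B s (Y s q)) - (g s q₀ - B s (Y s q₀))‖ ≤ L * ‖q - q₀‖)
    (hL0 : 0 ≤ L) (hmeas : AEStronglyMeasurable N' (volume.restrict (Icc 0 1)))
    (hZ₀ : HasFDerivAt (Y 0) Z₀ q₀) :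
    ∃ Z : ℝ → Q →L[ℝ] E, Z 0 = Z₀ ∧
      (ContinuousOn N' (Icc 0 1) → ∀ s ∈ Icc (0 : ℝ) 1,
        HasDerivWithinAt Z (N' s + (B s).comp (Z s)) (Icc 0 1) s) ∧
      ∀ s ∈ Icc (0 : ℝ) 1, HasFDerivAt (Y s) (Z s) q₀ := by
  have hq₀ : q₀ ∈ U := mem_of_mem_nhds hU
  have hN'L : ∀ s ∈ Icc (0 : ℝ) 1, ‖N' s‖ ≤ L := fun s hs =>
    (hN s hs).le_of_lip' hL0 (by filter_upwards [hU] with q hq using hL q hq s hs)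
  have hN'int : IntegrableOn N' (Icc 0 1) :=
    Integrable.of_bound hmeas L ((ae_restrict_iff' measurableSet_Icc).2 (ae_of_all _ hN'L))
  have hsub : ∀ s ∈ Icc (0 : ℝ) 1, uIoc 0 s ⊆ Icc 0 1 := fun s hs => by
    rw [uIoc_of_le hs.1]; exact Ioc_subset_Icc_self.trans (Icc_subset_Icc_right hs.2)
  let m : ℝ → Q →L[ℝ] E := fun s => Z₀ + ∫ u in (0 : ℝ)..s, N' u
  have hm : ContinuousOn m (Icc 0 1) := by
    refine continuousOn_const.add ?_
    have := intervalIntegral.continuousOn_primitive_interval (μ := volume) (f := N') (a := 0)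
      (b := 1) (by rwa [uIcc_of_le zero_le_one])
    rwa [uIcc_of_le zero_le_one] at this
  obtain ⟨β, hβ⟩ := isCompact_Icc.exists_bound_of_continuousOn hB
  have hβ0 : 0 ≤ β := (norm_nonneg _).trans (hβ 0 (by simp))
  lift β to ℝ≥0 using hβ0
  -- The derivative is sought as `W + m`, where `m` already contains the integral of the merely
  -- measurable `N'`. The remaining equation for `W` has continuous coefficients.
  obtain ⟨W, hW0, hW⟩ := exists_ode_solution (fun s z => (B s).comp (z + m s)) β
    (fun s hs => LipschitzWith.of_dist_le_mul fun z w => by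
      rw [dist_eq_norm, dist_eq_norm, ← ContinuousLinearMap.comp_sub, add_sub_add_right_eq_sub]
      exact (ContinuousLinearMap.opNorm_comp_le _ _).trans (by gcongr; exact hβ s hs))
    (fun z => hB.clm_comp (continuousOn_const.add hm)) (0 : Q →L[ℝ] E)
  refine ⟨fun s => W s + m s, by simp [hW0, m], fun hc s hs => ?_, ?_⟩
  · rw [add_comm (N' s)]
    exact (hW s hs).add ((hasDerivWithinAt_integral hc hs).const_add Z₀)
  let φ : ℝ → Q → E := fun s q => (g s q - B s (Y s q)) - (g s q₀ - B s (Y s q₀))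
  have hYc : ∀ q ∈ U, ContinuousOn (Y · q) (Icc 0 1) := fun q hq s hs =>
    (hY q hq s hs).continuousWithinAt
  have hφc : ∀ q ∈ U, ContinuousOn (φ · q) (Icc 0 1) := fun q hq =>
    ((hg q hq).sub (hB.clm_apply (hYc q hq))).sub ((hg q₀ hq₀).sub (hB.clm_apply (hYc q₀ hq₀)))
  let ρ : ℝ → Q → E := fun s q => φ s q - N' s (q - q₀)
  have hρmeas : ∀ q ∈ U, AEStronglyMeasurable (ρ · q) (volume.restrict (Icc 0 1)) := fun q hq =>
    ((hφc q hq).aestronglyMeasurable measurableSet_Icc).sub (hmeas.apply_continuousLinearMap _)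
  have hρb : ∀ q ∈ U, ∀ s ∈ Icc (0 : ℝ) 1, ‖ρ s q‖ ≤ 2 * L * ‖q - q₀‖ := fun q hq s hs => by
    have h1 := (N' s).le_of_opNorm_le (hN'L s hs) (q - q₀)
    have h2 := hL q hq s hs
    calc ‖ρ s q‖ ≤ ‖φ s q‖ + ‖N' s (q - q₀)‖ := norm_sub_le _ _
      _ ≤ _ := by linarith
  have hρint : ∀ q ∈ U, IntegrableOn (ρ · q) (Icc 0 1) := fun q hq =>
    Integrable.of_bound (hρmeas q hq) (2 * L * ‖q - q₀‖)
      ((ae_restrict_iff' measurableSet_Icc).2 (ae_of_all _ (hρb q hq)))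
  let δ : Q → ℝ := fun q => ∫ s in Icc (0 : ℝ) 1, ‖ρ s q‖
  have hδ0 : ∀ q, 0 ≤ δ q := fun q => integral_nonneg fun _ => norm_nonneg _
  -- Differentiability at `q₀` makes the scaled remainder tend to `0` for each `s` separately, and
  -- the Lipschitz bound dominates it by `2 * L`. No uniformity in `s` is needed.
  have hδ : Tendsto (fun q => ‖q - q₀‖⁻¹ * δ q) (𝓝 q₀) (𝓝 0) := by
    have h : Tendsto (fun q => ∫ s in Icc (0 : ℝ) 1, ‖q - q₀‖⁻¹ * ‖ρ s q‖) (𝓝 q₀)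
        (𝓝 (∫ s in Icc (0 : ℝ) 1, (0 : ℝ))) := by
      refine tendsto_integral_filter_of_dominated_convergence (fun _ => 2 * L) ?_ ?_ ?_ ?_
      · filter_upwards [hU] with q hq using (hρmeas q hq).norm.const_mul _
      · filter_upwards [hU] with q hq
        refine (ae_restrict_iff' measurableSet_Icc).2 (ae_of_all _ fun s hs => ?_)
        rw [norm_mul, norm_inv, norm_norm, norm_norm]
        rcases eq_or_ne q q₀ with rfl | hne
        · simpa using hL0
        · have : 0 < ‖q - q₀‖ := norm_pos_iff.2 (sub_ne_zero.2 hne)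
          rw [inv_mul_le_iff₀ this]
          linarith [hρb q hq s hs]
      · exact integrableOn_const (by simp)
      · refine (ae_restrict_iff' measurableSet_Icc).2 (ae_of_all _ fun s hs => ?_)
        exact hasFDerivAt_iff_tendsto.1 (hN s hs)
    simpa only [integral_const_mul, integral_zero] using h
  let η : Q → ℝ := fun q => ‖Y 0 q - Y 0 q₀ - Z₀ (q - q₀)‖
  have main : ∀ q ∈ U, ∀ s ∈ Icc (0 : ℝ) 1, ‖Y s q - Y s q₀ - (W s + m s) (q - q₀)‖ ≤
      (η q + β * δ q) * Real.exp (β + 1) + δ q := by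
    intro q hq s hs
    let P : ℝ → E := fun s => ∫ u in (0 : ℝ)..s, ρ u q
    have hP : ∀ s ∈ Icc (0 : ℝ) 1, ‖P s‖ ≤ δ q := fun s hs => by
      refine (intervalIntegral.norm_integral_le_integral_norm_uIoc).trans ?_
      exact setIntegral_mono_set (hρint q hq).norm (ae_of_all _ fun _ => norm_nonneg _)
        (hsub s hs).eventuallyLE
    have hPe : ∀ s ∈ Icc (0 : ℝ) 1,
        P s = (∫ u in (0 : ℝ)..s, φ u q) - (∫ u in (0 : ℝ)..s, N' u) (q - q₀) := fun s hs => by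
      rw [ContinuousLinearMap.intervalIntegral_apply (intervalIntegrable_of_unit hN'int hs)]
      exact intervalIntegral.integral_sub
        (intervalIntegrable_of_unit ((hφc q hq).integrableOn_Icc) hs) (intervalIntegrable_of_unit
          ((ContinuousLinearMap.apply ℝ E (q - q₀)).integrable_comp hN'int) hs)
    -- The error splits as `Ee + P`. The part `P` collects the measurable remainder and is at most
    -- `δ q`; `Ee` is differentiable at every time and solves a linear equation forced by `P`, so
    -- Gronwall applies to it.
    let Ee : ℝ → E := fun s =>
      Y s q - Y s q₀ - W s (q - q₀) - Z₀ (q - q₀) - ∫ u in (0 : ℝ)..s, φ u q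
    have hrel : ∀ s ∈ Icc (0 : ℝ) 1, Y s q - Y s q₀ - (W s + m s) (q - q₀) = Ee s + P s :=
      fun s hs => by
        rw [hPe s hs]
        simp only [m, Ee, add_apply]
        abel
    have hEd : ∀ s ∈ Icc (0 : ℝ) 1, HasDerivWithinAt Ee (B s (Ee s + P s)) (Icc 0 1) s :=
      fun s hs => by
        have h := ((((hY q hq s hs).sub (hY q₀ hq₀ s hs)).sub
          ((hW s hs).clm_apply (hasDerivWithinAt_const s _ (q - q₀)))).sub_const
            (Z₀ (q - q₀))).sub (hasDerivWithinAt_integral (hφc q hq) hs)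
        refine HasDerivWithinAt.congr_deriv h ?_
        rw [← hrel s hs]
        simp only [φ, map_sub, map_zero, add_zero, ContinuousLinearMap.comp_apply,
          add_apply, map_add]
        abel
    have hb := norm_le_of_hasDerivWithinAt β.2 (mul_nonneg β.2 (hδ0 q)) hEd (δ := η q)
      (by simp [Ee, hW0, η]) (fun s hs => by
        refine ((B s).le_of_opNorm_le (hβ s hs) _).trans ?_
        rw [← mul_add]
        exact mul_le_mul_of_nonneg_left ((norm_add_le _ _).trans
          (add_le_add le_rfl (hP s hs))) β.2) s hs
    rw [hrel s hs]
    exact (norm_add_le _ _).trans (add_le_add hb (hP s hs))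
  intro s hs
  rw [hasFDerivAt_iff_tendsto]
  have hη : Tendsto (fun q => ‖q - q₀‖⁻¹ * η q) (𝓝 q₀) (𝓝 0) := hasFDerivAt_iff_tendsto.1 hZ₀
  have hlim : Tendsto (fun q => (‖q - q₀‖⁻¹ * η q + β * (‖q - q₀‖⁻¹ * δ q)) * Real.exp (β + 1)
      + ‖q - q₀‖⁻¹ * δ q) (𝓝 q₀) (𝓝 0) := by
    have := ((hη.add (hδ.const_mul (β : ℝ))).mul_const (Real.exp (β + 1))).add hδ
    simpa using this
  refine squeeze_zero' (Eventually.of_forall fun q => by positivity) ?_ hlim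
  filter_upwards [hU] with q hq
  calc _ ≤ ‖q - q₀‖⁻¹ * ((η q + β * δ q) * Real.exp (β + 1) + δ q) := by
        exact mul_le_mul_of_nonneg_left (main q hq s hs) (by positivity)
    _ = _ := by ring

end ODE

/-- Subtracting the linearisation in the second variable removes the first-order effect of `y`. A
Lipschitz bound at `q₀` then makes the rest `o(q - q₀)`, so `y` itself need not be known to be
differentiable. This feeds the remainder hypothesis of `exists_hasFDerivAt_of_ode`. -/
theorem hasFDerivAt_sub_linear_of_lipschitz {Q E F : Type*} [NormedAddCommGroup Q]
    [NormedSpace ℝ Q] [NormedAddCommGroup E] [NormedSpace ℝ E] [NormedAddCommGroup F]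
    [NormedSpace ℝ F] {f : Q × E → F} {f' : Q × E →L[ℝ] F} {y : Q → E} {q₀ : Q} {C : ℝ}
    (hf : HasFDerivAt f f' (q₀, y q₀)) (hy : ∀ᶠ q in 𝓝 q₀, ‖y q - y q₀‖ ≤ C * ‖q - q₀‖) :
    HasFDerivAt (fun q => f (q, y q) - (f'.comp (ContinuousLinearMap.inr ℝ Q E)) (y q))
      (f'.comp (ContinuousLinearMap.inl ℝ Q E)) q₀ := by
  have hO : (fun q => y q - y q₀) =O[𝓝 q₀] fun q => q - q₀ := Asymptotics.IsBigO.of_bound C hy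
  have hyc : Tendsto y (𝓝 q₀) (𝓝 (y q₀)) := by
    have h0 : Tendsto (fun q => q - q₀) (𝓝 q₀) (𝓝 0) := by
      have : Continuous fun q : Q => q - q₀ := by fun_prop
      simpa using this.tendsto q₀
    have := (hO.trans_tendsto h0).add_const (y q₀)
    simpa using this
  have h1 := (hasFDerivAt_iff_isLittleO.1 hf).comp_tendsto (k := fun q => (q, y q)) (l' := 𝓝 q₀)
    (tendsto_id.prodMk_nhds hyc)
  have h2 : (fun q => (q, y q) - (q₀, y q₀)) =O[𝓝 q₀] fun q => q - q₀ :=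
    (Asymptotics.isBigO_refl _ _).prod_left hO
  rw [hasFDerivAt_iff_isLittleO]
  refine (h1.trans_isBigO h2).congr_left fun q => ?_
  have e : ((q, y q) - (q₀, y q₀) : Q × E) = (q - q₀, 0) + (0, y q) - (0, y q₀) := by
    simp
  simp only [Function.comp_apply]
  rw [e, map_sub, map_add]
  simp only [ContinuousLinearMap.comp_apply, ContinuousLinearMap.inr_apply,
    ContinuousLinearMap.inl_apply]
  abel

/-! ### Twice differentiable dependence of flows on parameters. -/

section Flow

variable {Q E : Type*} [NormedAddCommGroup Q] [NormedSpace ℝ Q] [FiniteDimensional ℝ Q]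
  [NormedAddCommGroup E] [NormedSpace ℝ E] [FiniteDimensional ℝ E]

/-- `ω` solves `∂_s ω = H (s, q, ω)`, `ω(0) = w q`, for `s ∈ [0, 1]`. -/
structure IsFlow (H : ℝ × Q × E → E) (w : Q → E) (ω : ℝ → Q → E) : Prop where
  init : ∀ q, ω 0 q = w q
  eqn : ∀ q, ∀ s ∈ Icc (0 : ℝ) 1, HasDerivWithinAt (ω · q) (H (s, q, ω s q)) (Icc 0 1) s

variable {H : ℝ × Q × E → E} {w : Q → E} {ω : ℝ → Q → E} {k : Q → ℝ≥0}

omit [NormedSpace ℝ Q] [FiniteDimensional ℝ Q] in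
theorem IsFlow.exists (hH : Continuous H)
    (hk : ∀ q, ∀ s ∈ Icc (0 : ℝ) 1, LipschitzWith (k q) fun y => H (s, q, y)) (w : Q → E) :
    ∃ ω, IsFlow H w ω := by
  have : CompleteSpace E := FiniteDimensional.complete ℝ E
  choose ω h0 h using fun q => exists_ode_solution (fun s y => H (s, q, y)) (k q) (hk q)
    (fun y => (by fun_prop : Continuous fun s => H (s, q, y)).continuousOn) (w q)
  exact ⟨fun s q => ω q s, h0, h⟩

omit [FiniteDimensional ℝ E] in
theorem IsFlow.exists_bound (hω : IsFlow H w ω) (hH : Continuous H) (hw : Continuous w)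
    (hk : ∀ q, ∀ s ∈ Icc (0 : ℝ) 1, LipschitzWith (k q) fun y => H (s, q, y))
    (hkc : Continuous k) (q₁ : Q) :
    ∃ R, ∀ q ∈ Metric.ball q₁ 1, ∀ s ∈ Icc (0 : ℝ) 1, ‖ω s q‖ ≤ R := by
  have : ProperSpace Q := FiniteDimensional.proper ℝ Q
  have hc := isCompact_closedBall q₁ (1 : ℝ)
  have hsub := Metric.ball_subset_closedBall (x := q₁) (ε := (1 : ℝ))
  obtain ⟨M, hM⟩ := (isCompact_Icc.prod hc).exists_bound_of_continuousOn
    (f := fun p : ℝ × Q => H (p.1, p.2, 0)) (s := Icc (0 : ℝ) 1 ×ˢ Metric.closedBall q₁ 1)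
    (by fun_prop : Continuous fun p : ℝ × Q => H (p.1, p.2, 0)).continuousOn
  obtain ⟨M₀, hM₀⟩ := hc.exists_bound_of_continuousOn hw.continuousOn
  obtain ⟨κ, hκ⟩ := hc.exists_bound_of_continuousOn (f := fun q => (k q : ℝ))
    (NNReal.continuous_coe.comp hkc).continuousOn
  have hq₁ : q₁ ∈ Metric.closedBall q₁ (1 : ℝ) := Metric.mem_closedBall_self zero_le_one
  have hκ0 : 0 ≤ κ := (norm_nonneg _).trans (hκ q₁ hq₁)
  have hM0 : 0 ≤ M := (norm_nonneg _).trans (hM (0, q₁) ⟨by simp, hq₁⟩)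
  refine ⟨(M₀ + M) * Real.exp (κ + 1), fun q hq => ?_⟩
  refine norm_le_of_hasDerivWithinAt hκ0 hM0 (hω.eqn q) (by rw [hω.init]; exact hM₀ q (hsub hq)) ?_
  intro s hs
  have h1 := (hk q s hs).norm_sub_le (ω s q) 0
  have h2 := hM (s, q) ⟨hs, hsub hq⟩
  have h3 : (k q : ℝ) ≤ κ := (le_abs_self _).trans (hκ q (hsub hq))
  calc ‖H (s, q, ω s q)‖ = ‖(H (s, q, ω s q) - H (s, q, 0)) + H (s, q, 0)‖ := by simp
    _ ≤ k q * ‖ω s q - 0‖ + M := (norm_add_le _ _).trans (add_le_add h1 h2)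
    _ ≤ κ * ‖ω s q‖ + M := by rw [sub_zero]; gcongr

/-- Uniform Lipschitz control of the flow near a parameter value. -/
theorem IsFlow.exists_lipschitz (hω : IsFlow H w ω) (hH : TwiceLip H) (hw : TwiceLip w)
    (hk : ∀ q, ∀ s ∈ Icc (0 : ℝ) 1, LipschitzWith (k q) fun y => H (s, q, y))
    (hkc : Continuous k) (q₁ : Q) :
    ∃ C, 0 ≤ C ∧ ∀ q ∈ Metric.ball q₁ 1, ∀ q' ∈ Metric.ball q₁ 1, ∀ s ∈ Icc (0 : ℝ) 1,
      ‖ω s q - ω s q'‖ ≤ C * ‖q - q'‖ ∧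
      ‖H (s, q, ω s q) - H (s, q', ω s q')‖ ≤ C * ‖q - q'‖ ∧
      ‖fderiv ℝ H (s, q, ω s q) - fderiv ℝ H (s, q', ω s q')‖ ≤ C * ‖q - q'‖ ∧
      ‖fderiv ℝ H (s, q, ω s q)‖ ≤ C ∧ ‖fderiv ℝ w q - fderiv ℝ w q'‖ ≤ C * ‖q - q'‖ := by
  obtain ⟨R, hR⟩ := hω.exists_bound hH.continuous hw.continuous hk hkc q₁
  have hbd : Bornology.IsBounded
      (Icc (0 : ℝ) 1 ×ˢ Metric.ball q₁ 1 ×ˢ Metric.closedBall (0 : E) R) :=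
    (Metric.isBounded_Icc 0 1).prod (Metric.isBounded_ball.prod Metric.isBounded_closedBall)
  have hmem : ∀ q ∈ Metric.ball q₁ 1, ∀ s ∈ Icc (0 : ℝ) 1, ((s, q, ω s q) : ℝ × Q × E) ∈
      Icc (0 : ℝ) 1 ×ˢ Metric.ball q₁ 1 ×ˢ Metric.closedBall (0 : E) R := fun q hq s hs =>
    ⟨hs, hq, mem_closedBall_zero_iff.2 (hR q hq s hs)⟩
  obtain ⟨L, hL0, hL⟩ := TwiceLip.exists_lipschitz hH hbd
  obtain ⟨M, hM0, hM⟩ := TwiceLip.exists_bound hH hbd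
  obtain ⟨Lw, hLw0, hLw⟩ := TwiceLip.exists_lipschitz hw (Metric.isBounded_ball (x := q₁) (r := 1))
  have hnorm : ∀ (s : ℝ) (q q' : Q), ‖((s, q, ω s q) : ℝ × Q × E) - (s, q', ω s q')‖ ≤
      ‖q - q'‖ + ‖ω s q - ω s q'‖ := fun s q q' => by
    simp only [Prod.mk_sub_mk, sub_self, Prod.norm_mk, norm_zero]
    exact max_le (by positivity) (max_le (by linarith [norm_nonneg (ω s q - ω s q')])
      (by linarith [norm_nonneg (q - q')]))
  set c₁ := (Lw + L) * Real.exp (L + 1)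
  have hc₁ : 0 ≤ c₁ := by positivity
  have key : ∀ q ∈ Metric.ball q₁ 1, ∀ q' ∈ Metric.ball q₁ 1, ∀ s ∈ Icc (0 : ℝ) 1,
      ‖ω s q - ω s q'‖ ≤ c₁ * ‖q - q'‖ := by
    intro q hq q' hq' s hs
    have := norm_le_of_hasDerivWithinAt (f := fun s => ω s q - ω s q') hL0
      (by positivity : 0 ≤ L * ‖q - q'‖)
      (fun s hs => (hω.eqn q s hs).sub (hω.eqn q' s hs)) (δ := Lw * ‖q - q'‖)
      (by simp only [hω.init]; exact (hLw q hq q' hq').1)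
      (fun s hs => by
        have h1 := (hL _ (hmem q hq s hs) _ (hmem q' hq' s hs)).1
        have h2 := mul_le_mul_of_nonneg_left (hnorm s q q') hL0
        linarith) s hs
    refine this.trans (le_of_eq ?_)
    ring
  set C := c₁ + L * (1 + c₁) + M + Lw
  have hle : ∀ q ∈ Metric.ball q₁ 1, ∀ q' ∈ Metric.ball q₁ 1, ∀ s ∈ Icc (0 : ℝ) 1,
      L * ‖((s, q, ω s q) : ℝ × Q × E) - (s, q', ω s q')‖ ≤ C * ‖q - q'‖ :=
    fun q hq q' hq' s hs => by
    calc _ ≤ L * (‖q - q'‖ + c₁ * ‖q - q'‖) := by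
          gcongr; exact (hnorm s q q').trans (add_le_add le_rfl (key q hq q' hq' s hs))
      _ = L * (1 + c₁) * ‖q - q'‖ := by ring
      _ ≤ _ := by gcongr; simp only [C]; linarith
  have hLc : 0 ≤ L * (1 + c₁) := by positivity
  refine ⟨C, by positivity, fun q hq q' hq' s hs => ⟨?_, ?_, ?_, ?_, ?_⟩⟩
  · refine (key q hq q' hq' s hs).trans ?_
    gcongr; simp only [C]; linarith
  · exact (hL _ (hmem q hq s hs) _ (hmem q' hq' s hs)).1.trans (hle q hq q' hq' s hs)
  · exact (hL _ (hmem q hq s hs) _ (hmem q' hq' s hs)).2.trans (hle q hq q' hq' s hs)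
  · refine ((hM _ (hmem q hq s hs)).2.1).trans ?_
    simp only [C]; linarith
  · refine ((hLw q hq q' hq').2).trans ?_
    gcongr; simp only [C]; linarith

/-- The derivative of `q ↦ (s, q, ω s q)` when `Z` is that of `ω s`. -/
def flowTangent (Z : Q →L[ℝ] E) : Q →L[ℝ] ℝ × Q × E :=
  (0 : Q →L[ℝ] ℝ).prod ((ContinuousLinearMap.id ℝ Q).prod Z)

omit [NormedSpace ℝ Q] [FiniteDimensional ℝ Q] [FiniteDimensional ℝ E] in
theorem IsFlow.continuousOn (hω : IsFlow H w ω) (q : Q) :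
    ContinuousOn (fun s => ((s, q, ω s q) : ℝ × Q × E)) (Icc 0 1) :=
  continuousOn_id.prodMk (continuousOn_const.prodMk fun s hs => (hω.eqn q s hs).continuousWithinAt)

/-- First derivative of the flow in the parameter, with the linearised equation. -/
theorem IsFlow.hasFDerivAt (hω : IsFlow H w ω) (hH : TwiceLip H) (hw : TwiceLip w)
    (hk : ∀ q, ∀ s ∈ Icc (0 : ℝ) 1, LipschitzWith (k q) fun y => H (s, q, y))
    (hkc : Continuous k) (q₀ : Q) :
    ∃ Z : ℝ → Q →L[ℝ] E, Z 0 = fderiv ℝ w q₀ ∧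
      (∀ s ∈ Icc (0 : ℝ) 1, HasDerivWithinAt Z
        ((fderiv ℝ H (s, q₀, ω s q₀)).comp (flowTangent (Z s))) (Icc 0 1) s) ∧
      ∀ s ∈ Icc (0 : ℝ) 1, HasFDerivAt (ω s) (Z s) q₀ := by
  have : CompleteSpace E := FiniteDimensional.complete ℝ E
  obtain ⟨C, hC0, hC⟩ := hω.exists_lipschitz hH hw hk hkc q₀
  have hq₀ : q₀ ∈ Metric.ball q₀ (1 : ℝ) := Metric.mem_ball_self one_pos
  have hU : Metric.ball q₀ (1 : ℝ) ∈ 𝓝 q₀ := Metric.ball_mem_nhds _ one_pos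
  let D : ℝ → Q × E →L[ℝ] E := fun s =>
    (fderiv ℝ H (s, q₀, ω s q₀)).comp (ContinuousLinearMap.inr ℝ ℝ (Q × E))
  have hD : ContinuousOn D (Icc 0 1) :=
    (hH.diff'.continuous.comp_continuousOn (hω.continuousOn q₀)).clm_comp continuousOn_const
  have hDle : ∀ s ∈ Icc (0 : ℝ) 1, ‖(D s).comp (ContinuousLinearMap.inr ℝ Q E)‖ ≤ C :=
    fun s hs => by
    refine ContinuousLinearMap.opNorm_le_bound _ hC0 fun v => ?_
    have := (fderiv ℝ H (s, q₀, ω s q₀)).le_of_opNorm_le (hC q₀ hq₀ q₀ hq₀ s hs).2.2.2.1 (0, 0, v)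
    simpa [D] using this
  obtain ⟨Z, hZ0, hZ, hZ'⟩ := exists_hasFDerivAt_of_ode (Y := ω) (g := fun s q => H (s, q, ω s q))
    (B := fun s => (D s).comp (ContinuousLinearMap.inr ℝ Q E))
    (N' := fun s => (D s).comp (ContinuousLinearMap.inl ℝ Q E)) (Z₀ := fderiv ℝ w q₀) (q₀ := q₀)
    (L := C + C * C) hU (fun q _ => hω.eqn q)
    (fun q _ => hH.continuous.comp_continuousOn (hω.continuousOn q))
    (hD.clm_comp continuousOn_const)
    (fun s hs => by
      have h1 : HasFDerivAt (fun p : Q × E => H (s, p)) (D s) (q₀, ω s q₀) :=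
        ((hH.diff (s, q₀, ω s q₀)).hasFDerivAt).comp (q₀, ω s q₀) (hasFDerivAt_prodMk_right s _)
      exact hasFDerivAt_sub_linear_of_lipschitz h1
        (by filter_upwards [hU] with q hq using (hC q hq q₀ hq₀ s hs).1))
    (fun q hq s hs => by
      have h1 := (hC q hq q₀ hq₀ s hs).2.1
      have h2 := ContinuousLinearMap.le_of_opNorm_le _ (hDle s hs) (ω s q - ω s q₀)
      have h3 := mul_le_mul_of_nonneg_left (hC q hq q₀ hq₀ s hs).1 hC0
      rw [sub_sub_sub_comm, ← map_sub]
      refine (norm_sub_le _ _).trans ?_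
      linarith)
    (by positivity)
    ((hD.clm_comp continuousOn_const).aestronglyMeasurable measurableSet_Icc)
    (by
      have : ω 0 = w := funext hω.init
      rw [this]; exact (hw.diff q₀).hasFDerivAt)
  refine ⟨Z, hZ0, fun s hs => ?_, hZ'⟩
  refine (hZ (hD.clm_comp continuousOn_const) s hs).congr_deriv ?_
  ext v
  simp only [D, flowTangent, add_apply, ContinuousLinearMap.comp_apply,
    ContinuousLinearMap.inr_apply, ContinuousLinearMap.inl_apply, ContinuousLinearMap.prod_apply,
    ContinuousLinearMap.id_apply, zero_apply, ← map_add]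
  simp

omit [FiniteDimensional ℝ Q] [FiniteDimensional ℝ E]

theorem flowTangent_sub_flowTangent (Z Z' : Q →L[ℝ] E) : flowTangent Z - flowTangent Z' =
    ((ContinuousLinearMap.inr ℝ ℝ (Q × E)).comp (ContinuousLinearMap.inr ℝ Q E)).comp (Z - Z') := by
  ext v <;> simp [flowTangent]

theorem norm_flowTangent_le (Z : Q →L[ℝ] E) : ‖flowTangent Z‖ ≤ 1 + ‖Z‖ := by
  refine ContinuousLinearMap.opNorm_le_bound _ (by positivity) fun v => ?_
  have h := Z.le_opNorm v
  simp only [flowTangent, ContinuousLinearMap.prod_apply, Prod.norm_def, zero_apply, norm_zero,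
    ContinuousLinearMap.id_apply]
  have := norm_nonneg v
  have : 0 ≤ ‖Z‖ * ‖v‖ := by positivity
  exact max_le (by nlinarith) (max_le (by nlinarith) (by nlinarith))

theorem norm_flowTangent_sub_le (Z Z' : Q →L[ℝ] E) :
    ‖flowTangent Z - flowTangent Z'‖ ≤ ‖Z - Z'‖ := by
  refine ContinuousLinearMap.opNorm_le_bound _ (by positivity) fun v => ?_
  rw [flowTangent_sub_flowTangent]
  simpa [Prod.norm_def] using (Z - Z').le_opNorm v

theorem continuous_flowTangent : Continuous (flowTangent : (Q →L[ℝ] E) → Q →L[ℝ] ℝ × Q × E) :=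
  (LipschitzWith.of_dist_le_mul (K := 1) fun Z Z' => by
    rw [dist_eq_norm, dist_eq_norm, NNReal.coe_one, one_mul]
    exact norm_flowTangent_sub_le Z Z').continuous

/-- `(u, v) ↦ D (J u) (J v)`. -/
def pullbackTwice {X : Type*} [NormedAddCommGroup X] [NormedSpace ℝ X] (D : X →L[ℝ] X →L[ℝ] E)
    (J : Q →L[ℝ] X) : Q →L[ℝ] Q →L[ℝ] E :=
  ((ContinuousLinearMap.compL ℝ Q X E).flip J).comp (D.comp J)

theorem _root_.MeasureTheory.AEStronglyMeasurable.clm_comp {X Y Z : Type*}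
    [NormedAddCommGroup X] [NormedSpace ℝ X] [NormedAddCommGroup Y] [NormedSpace ℝ Y]
    [NormedAddCommGroup Z] [NormedSpace ℝ Z] {μ : Measure ℝ} {D : ℝ → Y →L[ℝ] Z}
    {J : ℝ → X →L[ℝ] Y} (hD : AEStronglyMeasurable D μ) (hJ : AEStronglyMeasurable J μ) :
    AEStronglyMeasurable (fun s => (D s).comp (J s)) μ := by
  have := (ContinuousLinearMap.compL ℝ X Y Z).aestronglyMeasurable_comp₂ hD hJ
  exact this

theorem aestronglyMeasurable_pullbackTwice {X : Type*} [NormedAddCommGroup X] [NormedSpace ℝ X]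
    {μ : Measure ℝ} {D : ℝ → X →L[ℝ] X →L[ℝ] E} {J : ℝ → Q →L[ℝ] X}
    (hD : AEStronglyMeasurable D μ) (hJ : AEStronglyMeasurable J μ) :
    AEStronglyMeasurable (fun s => pullbackTwice (D s) (J s)) μ := by
  have h1 := AEStronglyMeasurable.clm_comp hD hJ
  have h2 : AEStronglyMeasurable (fun s => (ContinuousLinearMap.compL ℝ Q X E).flip (J s)) μ :=
    (ContinuousLinearMap.compL ℝ Q X E).flip.continuous.comp_aestronglyMeasurable hJ
  exact h2.clm_comp h1

variable [FiniteDimensional ℝ Q] [FiniteDimensional ℝ E]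

omit [NormedAddCommGroup Q] [NormedSpace ℝ Q] [FiniteDimensional ℝ Q] [FiniteDimensional ℝ E] in
-- A Fréchet derivative is a Borel function even where it is discontinuous. This is all the time
-- regularity available for the second derivative of `H` along a trajectory.
theorem aestronglyMeasurable_fderiv_comp {X : Type*} [NormedAddCommGroup X] [NormedSpace ℝ X]
    [FiniteDimensional ℝ X] [FiniteDimensional ℝ E] (g : X → E) {γ : ℝ → X}
    (hγ : ContinuousOn γ (Icc 0 1)) :
    AEStronglyMeasurable (fun s => fderiv ℝ g (γ s)) (volume.restrict (Icc 0 1)) := by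
  have : CompleteSpace E := FiniteDimensional.complete ℝ E
  have : ProperSpace E := FiniteDimensional.proper ℝ E
  have : ProperSpace X := FiniteDimensional.proper ℝ X
  borelize X
  have h1 : Measurable (fderiv ℝ g) := measurable_fderiv ℝ g
  have h2 : AEMeasurable γ (volume.restrict (Icc 0 1)) := hγ.aemeasurable measurableSet_Icc
  have h3 : AEMeasurable (fun s => fderiv ℝ g (γ s)) (volume.restrict (Icc 0 1)) :=
    h1.comp_aemeasurable h2
  exact h3.aestronglyMeasurable

/-- The time-one map of a parametrised flow with twice differentiable right-hand side. -/
theorem IsFlow.twiceLip (hω : IsFlow H w ω) (hH : TwiceLip H) (hw : TwiceLip w)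
    (hk : ∀ q, ∀ s ∈ Icc (0 : ℝ) 1, LipschitzWith (k q) fun y => H (s, q, y))
    (hkc : Continuous k) : TwiceLip (ω 1) := by
  have : CompleteSpace E := FiniteDimensional.complete ℝ E
  have hone : (1 : ℝ) ∈ Icc (0 : ℝ) 1 := by simp
  choose Z hZ0 hZ hZd using hω.hasFDerivAt hH hw hk hkc
  have hfd : fderiv ℝ (ω 1) = fun q => Z q 1 := funext fun q => (hZd q 1 hone).fderiv
  have hlocal : ∀ q₁ : Q, ∃ C, 0 ≤ C ∧ ∀ q ∈ Metric.ball q₁ 1, ∀ q' ∈ Metric.ball q₁ 1,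
      ∀ s ∈ Icc (0 : ℝ) 1, ‖Z q s - Z q' s‖ ≤ C * ‖q - q'‖ ∧ ‖Z q s‖ ≤ C ∧
      ‖fderiv ℝ H (s, q, ω s q) - fderiv ℝ H (s, q', ω s q')‖ ≤ C * ‖q - q'‖ ∧
      ‖fderiv ℝ H (s, q, ω s q)‖ ≤ C := by
    intro q₁
    obtain ⟨C, hC0, hC⟩ := hω.exists_lipschitz hH hw hk hkc q₁
    -- The Lipschitz constant of the flow bounds its derivative, and no separate estimate of the
    -- variational equation is needed for that.
    have hZC : ∀ q ∈ Metric.ball q₁ 1, ∀ s ∈ Icc (0 : ℝ) 1, ‖Z q s‖ ≤ C := fun q hq s hs =>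
      (hZd q s hs).le_of_lip' hC0 (by
        filter_upwards [Metric.isOpen_ball.mem_nhds hq] with q' hq' using (hC q' hq' q hq s hs).1)
    set C₁ := (C + C * (1 + C)) * Real.exp (C + 1)
    have hC₁ : 0 ≤ C₁ := by positivity
    refine ⟨C + C₁, by positivity, fun q hq q' hq' s hs => ⟨?_, ?_, ?_, ?_⟩⟩
    · have := norm_le_of_hasDerivWithinAt (f := fun s => Z q s - Z q' s) hC0
        (by positivity : 0 ≤ C * (1 + C) * ‖q - q'‖)
        (fun s hs => (hZ q s hs).sub (hZ q' s hs)) (δ := C * ‖q - q'‖)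
        (by simp only [hZ0]; exact (hC q hq q' hq' 0 (by simp)).2.2.2.2)
        (fun s hs => by
          set A := fderiv ℝ H (s, q, ω s q)
          set A' := fderiv ℝ H (s, q', ω s q')
          have h1 : ‖A - A'‖ ≤ C * ‖q - q'‖ := (hC q hq q' hq' s hs).2.2.1
          have h2 : ‖A'‖ ≤ C := (hC q' hq' q hq s hs).2.2.2.1
          have e : A.comp (flowTangent (Z q s)) - A'.comp (flowTangent (Z q' s))
              = (A - A').comp (flowTangent (Z q s))
                + A'.comp (flowTangent (Z q s) - flowTangent (Z q' s)) := by
            ext v; simp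
          rw [e]
          have h3 := (A - A').opNorm_comp_le (flowTangent (Z q s))
          have h4 := A'.opNorm_comp_le (flowTangent (Z q s) - flowTangent (Z q' s))
          have h5 := norm_flowTangent_sub_le (Z q s) (Z q' s)
          have h6 : ‖flowTangent (Z q s)‖ ≤ 1 + C :=
            (norm_flowTangent_le _).trans (by linarith [hZC q hq s hs])
          have h7 := mul_le_mul h1 h6 (norm_nonneg _) (by positivity)
          have h8 := mul_le_mul h2 h5 (norm_nonneg _) hC0
          refine (norm_add_le _ _).trans ?_
          linarith) s hs
      calc _ ≤ _ := this
        _ = C₁ * ‖q - q'‖ := by simp only [C₁]; ring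
        _ ≤ _ := by gcongr; linarith
    · linarith [hZC q hq s hs]
    · refine (hC q hq q' hq' s hs).2.2.1.trans ?_
      gcongr; linarith
    · linarith [(hC q hq q' hq' s hs).2.2.2.1]
  refine ⟨fun q => (hZd q 1 hone).differentiableAt, ?_, ?_⟩
  · rw [hfd]
    intro q₀
    obtain ⟨C, hC0, hC⟩ := hlocal q₀
    have hq₀ : q₀ ∈ Metric.ball q₀ (1 : ℝ) := Metric.mem_ball_self one_pos
    have hU : Metric.ball q₀ (1 : ℝ) ∈ 𝓝 q₀ := Metric.ball_mem_nhds _ one_pos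
    let A : ℝ → Q → ℝ × Q × E →L[ℝ] E := fun s q => fderiv ℝ H (s, q, ω s q)
    let J : ℝ → Q → Q →L[ℝ] ℝ × Q × E := fun s q => flowTangent (Z q s)
    have hAc : ∀ q, ContinuousOn (A · q) (Icc 0 1) := fun q =>
      hH.diff'.continuous.comp_continuousOn (hω.continuousOn q)
    have hJc : ∀ q, ContinuousOn (J · q) (Icc 0 1) := fun q =>
      continuous_flowTangent.comp_continuousOn fun s hs => (hZ q s hs).continuousWithinAt
    let ι : E →L[ℝ] ℝ × Q × E :=
      (ContinuousLinearMap.inr ℝ ℝ (Q × E)).comp (ContinuousLinearMap.inr ℝ Q E)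
    let B : ℝ → (Q →L[ℝ] E) →L[ℝ] (Q →L[ℝ] E) := fun s =>
      ContinuousLinearMap.compL ℝ Q E E ((A s q₀).comp ι)
    let N' : ℝ → Q →L[ℝ] Q →L[ℝ] E := fun s =>
      pullbackTwice (fderiv ℝ (fderiv ℝ H) (s, q₀, ω s q₀)) (J s q₀)
    -- With `B` the composition by `∂_y H` frozen at `q₀`, the variational equation minus its linear
    -- part is, up to a constant in `q`, the product of the increment of `A` with `J s q`. In it `Z`
    -- only enters multiplied by a small factor.
    have hrem : ∀ s q,
        ((A s q).comp (J s q) - B s (Z q s)) - ((A s q₀).comp (J s q₀) - B s (Z q₀ s))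
        = (A s q - A s q₀).comp (J s q) := fun s q => by
      have h : J s q - J s q₀ = ι.comp (Z q s - Z q₀ s) := flowTangent_sub_flowTangent _ _
      have h' : B s (Z q s) - B s (Z q₀ s) = (A s q₀).comp (J s q - J s q₀) := by
        rw [h, ← map_sub]; rfl
      rw [sub_sub_sub_comm, h', ContinuousLinearMap.comp_sub, ContinuousLinearMap.sub_comp]
      abel
    obtain ⟨Z₂, -, -, hZ₂⟩ := exists_hasFDerivAt_of_ode (Y := fun s q => Z q s)
      (g := fun s q => (A s q).comp (J s q)) (B := B) (N' := N')
      (Z₀ := fderiv ℝ (fderiv ℝ w) q₀) (q₀ := q₀) (L := C * (1 + C)) hU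
      (fun q _ => hZ q) (fun q _ => (hAc q).clm_comp (hJc q))
      ((ContinuousLinearMap.compL ℝ Q E E).continuous.comp_continuousOn
        ((hAc q₀).clm_comp continuousOn_const))
      (fun s hs => by
        have h1 : HasFDerivAt (fun q => ((s, q, ω s q) : ℝ × Q × E)) (J s q₀) q₀ :=
          (hasFDerivAt_const s q₀).prodMk ((hasFDerivAt_id q₀).prodMk (hZd q₀ s hs))
        have h2 : HasFDerivAt (A s) ((fderiv ℝ (fderiv ℝ H) (s, q₀, ω s q₀)).comp (J s q₀)) q₀ :=
          ((hH.diff' (s, q₀, ω s q₀)).hasFDerivAt).comp q₀ h1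
        have h3 : HasFDerivAt (fun q => (A s q).comp (J s q₀)) (N' s) q₀ :=
          (((ContinuousLinearMap.compL ℝ Q (ℝ × Q × E) E).flip (J s q₀)).hasFDerivAt).comp q₀ h2
        -- Both factors are Lipschitz in `q` and vanish at `q₀`, so the product is quadratic and has
        -- zero derivative.
        have h4 : HasFDerivAt (fun q => (A s q - A s q₀).comp (J s q - J s q₀))
            (0 : Q →L[ℝ] Q →L[ℝ] E) q₀ := by
          refine Asymptotics.IsBigO.hasFDerivAt (n := 2) ?_ (by norm_num)
          refine Asymptotics.IsBigO.of_bound (C * C) ?_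
          filter_upwards [hU] with q hq
          have h5 := (hC q hq q₀ hq₀ s hs).2.2.1
          have h6 := (norm_flowTangent_sub_le (Z q s) (Z q₀ s)).trans (hC q hq q₀ hq₀ s hs).1
          refine (ContinuousLinearMap.opNorm_comp_le _ _).trans
            ((mul_le_mul h5 h6 (norm_nonneg _) (by positivity)).trans (le_of_eq ?_))
          rw [norm_pow, norm_norm]; ring
        have h5 : (fun q => (A s q).comp (J s q) - B s (Z q s)) = fun q =>
            ((A s q).comp (J s q₀) + (A s q - A s q₀).comp (J s q - J s q₀)) - B s (Z q₀ s) := by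
          funext q
          rw [eq_add_of_sub_eq (hrem s q)]
          simp only [ContinuousLinearMap.comp_sub, ContinuousLinearMap.sub_comp]
          abel
        rw [h5]
        simpa using (h3.add h4).sub_const (B s (Z q₀ s)))
      (fun q hq s hs => by
        rw [hrem]
        have h5 := (hC q hq q₀ hq₀ s hs).2.2.1
        have h6 : ‖J s q‖ ≤ 1 + C :=
          (norm_flowTangent_le _).trans (by linarith [(hC q hq q₀ hq₀ s hs).2.1])
        refine (ContinuousLinearMap.opNorm_comp_le _ _).trans
          ((mul_le_mul h5 h6 (norm_nonneg _) (by positivity)).trans (le_of_eq ?_))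
        ring)
      (by positivity)
      (aestronglyMeasurable_pullbackTwice
        (aestronglyMeasurable_fderiv_comp (fderiv ℝ H) (hω.continuousOn q₀))
        ((hJc q₀).aestronglyMeasurable measurableSet_Icc))
      (by simp only [hZ0]; exact (hw.diff' q₀).hasFDerivAt)
    exact (hZ₂ 1 hone).differentiableAt
  · rw [hfd]
    intro q₁
    obtain ⟨C, hC0, hC⟩ := hlocal q₁
    refine ⟨⟨C, hC0⟩, Metric.ball q₁ 1, Metric.ball_mem_nhds _ one_pos,
      LipschitzOnWith.of_dist_le_mul fun q hq q' hq' => ?_⟩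
    rw [dist_eq_norm, dist_eq_norm]
    exact (hC q hq q' hq' 1 hone).1

end Flow

/-! ### Integrals depending on parameters. -/

section Integral

variable {P E : Type*} [NormedAddCommGroup P] [NormedSpace ℝ P] [FiniteDimensional ℝ P]
  [NormedAddCommGroup E] [NormedSpace ℝ E] [FiniteDimensional ℝ E]

/-- The integral up to `s * p.1` is a flow in `s` whose right-hand side does not involve the
unknown, so its value at `s = 1` inherits the regularity from `IsFlow.twiceLip`. -/
theorem TwiceLip.intervalIntegral {F : ℝ × P → E} (hF : TwiceLip F) :
    TwiceLip fun p : ℝ × P => ∫ σ in (0 : ℝ)..p.1, F (σ, p.2) := by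
  have : CompleteSpace E := FiniteDimensional.complete ℝ E
  let H : ℝ × (ℝ × P) × E → E := fun x => x.2.1.1 • F (x.1 * x.2.1.1, x.2.1.2)
  have hH : TwiceLip H :=
    (TwiceLip.of_contDiff (by fun_prop : ContDiff ℝ 2 fun x : ℝ × (ℝ × P) × E => x.2.1.1)).smul
      (hF.comp_contDiff (by fun_prop))
  let ω : ℝ → ℝ × P → E := fun s q => ∫ σ in (0 : ℝ)..(s * q.1), F (σ, q.2)
  have hω : IsFlow H (fun _ => 0) ω := by
    refine ⟨fun q => by simp [ω], fun q s _ => HasDerivAt.hasDerivWithinAt ?_⟩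
    have hc : Continuous fun σ => F (σ, q.2) := by have := hF.continuous; fun_prop
    exact (hc.integral_hasStrictDerivAt 0 (s * q.1)).hasDerivAt.scomp s
      (by simpa using (hasDerivAt_id s).mul_const q.1)
  have := hω.twiceLip (k := fun _ => 0) hH (TwiceLip.const 0)
    (fun q s _ => LipschitzWith.const (q.1 • F (s * q.1, q.2))) continuous_const
  simpa [ω] using this

theorem TwiceLip.phaseMean {F : ℝ × P → ℂ} (hF : TwiceLip F) :
    TwiceLip fun p : P => phaseMean fun σ => F (σ, p) :=
  (TwiceLip.const _).mul (hF.intervalIntegral.comp_contDiff (k := fun p : P => (2 * Real.pi, p))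
    (by fun_prop))

theorem TwiceLip.phaseInv {F : ℝ × P → ℂ} (hF : TwiceLip F) :
    TwiceLip fun p : ℝ × P => phaseInv (fun σ => F (σ, p.2)) p.1 :=
  hF.intervalIntegral.sub (hF.intervalIntegral.phaseMean.comp_contDiff (k := Prod.snd)
    contDiff_snd)

end Integral

/-! ### The filtered source and the corrector. -/

section Source

variable {r : ℂ → ℂ}

theorem twiceLip_of_bounded_fderiv₂ {K : ℝ} (hr : Differentiable ℝ r)
    (hr' : Differentiable ℝ (fderiv ℝ r)) (hK : ∀ z, ‖fderiv ℝ (fderiv ℝ r) z‖ ≤ K) :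
    TwiceLip r := by
  refine ⟨hr, hr', ?_⟩
  have hK0 : 0 ≤ K := (norm_nonneg (fderiv ℝ (fderiv ℝ r) 0)).trans (hK 0)
  lift K to ℝ≥0 using hK0
  exact (lipschitzWith_of_nnnorm_fderiv_le hr' hK).locallyLipschitz

theorem twiceLip_filteredSource (hr : TwiceLip r) :
    TwiceLip fun p : ℝ × ℂ => filteredSource r p.1 p.2 := by
  have hτ : ContDiff ℝ 2 fun p : ℝ × ℂ => (p.1 : ℂ) := Complex.ofRealCLM.contDiff.comp contDiff_fst
  have he : ContDiff ℝ 2 fun p : ℝ × ℂ => Complex.exp (Complex.I * p.1) :=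
    (contDiff_const.mul hτ).cexp
  exact (TwiceLip.of_contDiff (contDiff_const.mul hτ).neg.cexp).mul
    (hr.comp_contDiff (he.mul contDiff_snd))

theorem norm_exp_I_mul (τ : ℝ) : ‖Complex.exp (Complex.I * τ)‖ = 1 := by
  rw [mul_comm]; exact Complex.norm_exp_ofReal_mul_I τ

theorem norm_exp_neg_I_mul (τ : ℝ) : ‖Complex.exp (-(Complex.I * τ))‖ = 1 := by
  rw [Complex.exp_neg, norm_inv, norm_exp_I_mul, inv_one]

theorem filteredSource_lipschitz {K : ℝ≥0} (hr : LipschitzWith K r) (τ : ℝ) :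
    LipschitzWith K (filteredSource r τ) :=
  LipschitzWith.of_dist_le_mul fun z w => by
    have h := hr.norm_sub_le (Complex.exp (Complex.I * τ) * z) (Complex.exp (Complex.I * τ) * w)
    rw [← mul_sub, norm_mul, norm_exp_I_mul, one_mul] at h
    rw [dist_eq_norm, dist_eq_norm, filteredSource, filteredSource, ← mul_sub, norm_mul,
      norm_exp_neg_I_mul, one_mul]
    exact h

theorem filteredSource_periodic (τ : ℝ) (z : ℂ) :
    filteredSource r (τ + 2 * Real.pi) z = filteredSource r τ z := by
  have h : Complex.exp (Complex.I * (τ + 2 * Real.pi : ℝ)) = Complex.exp (Complex.I * τ) := by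
    rw [← Complex.exp_periodic (Complex.I * τ)]
    congr 1; push_cast; ring
  rw [filteredSource, filteredSource, Complex.exp_neg, Complex.exp_neg, h]

variable (hr : TwiceLip r)
include hr

theorem twiceLip_phaseMean_filteredSource :
    TwiceLip fun z : ℂ => phaseMean fun σ => filteredSource r σ z :=
  (twiceLip_filteredSource hr).phaseMean

theorem twiceLip_corrector : TwiceLip fun p : ℝ × ℂ => corrector r p.1 p.2 :=
  ((twiceLip_filteredSource hr).sub
    ((twiceLip_phaseMean_filteredSource hr).comp_contDiff contDiff_snd)).phaseInv

theorem continuous_filteredSource_left (z : ℂ) : Continuous fun σ => filteredSource r σ z := by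
  have := (twiceLip_filteredSource hr).continuous
  exact this.comp (continuous_id.prodMk continuous_const)

theorem hasDerivAt_corrector (τ : ℝ) (z : ℂ) :
    HasDerivAt (fun σ => corrector r σ z)
      (filteredSource r τ z - phaseMean fun σ => filteredSource r σ z) τ := by
  have hc := (continuous_filteredSource_left hr z).sub
    (continuous_const (y := phaseMean fun σ => filteredSource r σ z))
  exact (hc.integral_hasStrictDerivAt 0 τ).hasDerivAt.sub_const _

/-- A primitive of a periodic function is periodic exactly when its mean vanishes, which is what
subtracting the phase average achieves. -/
theorem corrector_periodic (τ : ℝ) (z : ℂ) :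
    corrector r (τ + 2 * Real.pi) z = corrector r τ z := by
  set f : ℝ → ℂ := fun σ => filteredSource r σ z - phaseMean fun σ => filteredSource r σ z with hf
  have hc : Continuous f := (continuous_filteredSource_left hr z).sub continuous_const
  have hp : Function.Periodic f (2 * Real.pi) := fun σ => by
    simp only [hf, filteredSource_periodic]
  have h0 : ∫ σ in (0 : ℝ)..(2 * Real.pi), f σ = 0 := by
    rw [hf, intervalIntegral.integral_sub
      ((continuous_filteredSource_left hr z).intervalIntegrable _ _)
      (continuous_const.intervalIntegrable _ _), intervalIntegral.integral_const]
    have hpi : (2 * Real.pi : ℝ) ≠ 0 := by positivity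
    rw [phaseMean, sub_zero, Complex.real_smul, ← mul_assoc, ← Complex.ofReal_mul,
      mul_one_div_cancel hpi, Complex.ofReal_one, one_mul, sub_self]
  have h1 : ∫ σ in (0 : ℝ)..(τ + 2 * Real.pi), f σ = ∫ σ in (0 : ℝ)..τ, f σ := by
    rw [← intervalIntegral.integral_add_adjacent_intervals (hc.intervalIntegrable 0 τ)
      (hc.intervalIntegrable τ _), hp.intervalIntegral_add_eq τ 0, zero_add, h0, add_zero]
  simp only [corrector, phaseInv]
  rw [h1]

end Source

/-! ### The profile of the well-prepared data. -/

section InitialLayer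

/-- The profile `(G(0, α) - G(τ, α)) / a` of the well-prepared correction. -/
def initialProfile (a : ℝ → ℝ) (r : ℂ → ℂ) (α : ℝ → ℂ) (p : ℝ × ℝ) : ℂ :=
  ((1 / a p.1 : ℝ) : ℂ) * (corrector r 0 (α p.1) - corrector r p.2 (α p.1))

variable {a : ℝ → ℝ} {r : ℂ → ℂ} {α : ℝ → ℂ}

theorem wellPrepared_eq (ε x τ : ℝ) :
    wellPrepared ε a r α x τ = α x + (ε : ℂ) * initialProfile a r α (x, τ) := by
  simp only [wellPrepared, initialProfile]
  push_cast
  ring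

theorem initialProfile_periodic_fst (ha : Function.Periodic a 1) (hα : Function.Periodic α 1)
    (x τ : ℝ) : initialProfile a r α (x + 1, τ) = initialProfile a r α (x, τ) := by
  simp only [initialProfile, ha x, hα x]

theorem initialProfile_periodic_snd (hr : TwiceLip r) (x τ : ℝ) :
    initialProfile a r α (x, τ + 2 * Real.pi) = initialProfile a r α (x, τ) := by
  simp only [initialProfile, corrector_periodic hr]

theorem twiceLip_initialProfile (ha : ContDiff ℝ 2 a) (ha0 : ∀ x, a x ≠ 0) (hr : TwiceLip r)
    (hα : ContDiff ℝ 2 α) : TwiceLip (initialProfile a r α) := by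
  have h1 : ContDiff ℝ 2 fun p : ℝ × ℝ => ((1 / a p.1 : ℝ) : ℂ) :=
    Complex.ofRealCLM.contDiff.comp
      (contDiff_const.div (ha.comp contDiff_fst) fun p => ha0 p.1)
  have hα1 : ContDiff ℝ 2 fun p : ℝ × ℝ => α p.1 := hα.comp contDiff_fst
  have hG := twiceLip_corrector hr
  exact (TwiceLip.of_contDiff h1).mul
    ((hG.comp_contDiff (k := fun p : ℝ × ℝ => ((0 : ℝ), α p.1)) (contDiff_const.prodMk hα1)).sub
      (hG.comp_contDiff (k := fun p : ℝ × ℝ => (p.2, α p.1)) (contDiff_snd.prodMk hα1)))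

theorem hasDerivAt_initialProfile_snd (hr : TwiceLip r) (x τ : ℝ) :
    HasDerivAt (fun σ => initialProfile a r α (x, σ))
      (((1 / a x : ℝ) : ℂ) * ((phaseMean fun σ => filteredSource r σ (α x))
        - filteredSource r τ (α x))) τ := by
  have := ((hasDerivAt_corrector hr τ (α x)).const_sub (corrector r 0 (α x))).const_mul
    ((1 / a x : ℝ) : ℂ)
  simpa [initialProfile] using this

end InitialLayer

/-! ### Characteristics and construction of a solution. -/

/-- The phase accumulated along characteristics, `θ' = a / (c ε)`. -/
def phasePrimitive (c ε : ℝ) (a : ℝ → ℝ) (x : ℝ) : ℝ := (∫ y in (0 : ℝ)..x, a y) / (c * ε)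

/-- The phase at rescaled time `s ∈ [0, 1]` of the characteristic that reaches `(x, τ)` at time
`t`, for `q = (t, x, τ)`. -/
def charPhase (c ε : ℝ) (a : ℝ → ℝ) (s : ℝ) (q : ℝ × ℝ × ℝ) : ℝ :=
  q.2.2 - phasePrimitive c ε a q.2.1 + phasePrimitive c ε a (q.2.1 - c * q.1 * (1 - s))

section

variable {c ε : ℝ} {a : ℝ → ℝ}

theorem hasDerivAt_phasePrimitive (ha : Continuous a) (x : ℝ) :
    HasDerivAt (phasePrimitive c ε a) (a x / (c * ε)) x :=
  ((ha.integral_hasStrictDerivAt 0 x).hasDerivAt).div_const _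

theorem contDiff_phasePrimitive (ha : ContDiff ℝ 2 a) : ContDiff ℝ 2 (phasePrimitive c ε a) := by
  have h : deriv (phasePrimitive c ε a) = fun x => a x / (c * ε) :=
    funext fun x => (hasDerivAt_phasePrimitive ha.continuous x).deriv
  have : ContDiff ℝ (1 + 1) (phasePrimitive c ε a) := by
    rw [contDiff_succ_iff_deriv]
    refine ⟨fun x => (hasDerivAt_phasePrimitive ha.continuous x).differentiableAt, by simp, ?_⟩
    rw [h]
    exact (ha.of_le (by norm_num)).div_const _
  exact this

theorem phasePrimitive_add_one (ha : Continuous a) (hp : Function.Periodic a 1) (x : ℝ) :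
    phasePrimitive c ε a (x + 1) = phasePrimitive c ε a x + phasePrimitive c ε a 1 := by
  have h := hp.intervalIntegral_add_eq x 0
  rw [zero_add] at h
  rw [phasePrimitive, phasePrimitive, phasePrimitive, ← add_div, ← h,
    intervalIntegral.integral_add_adjacent_intervals (ha.intervalIntegrable _ _)
      (ha.intervalIntegrable _ _)]

theorem contDiff_charPhase (ha : ContDiff ℝ 2 a) :
    ContDiff ℝ 2 fun p : ℝ × (ℝ × ℝ × ℝ) => charPhase c ε a p.1 p.2 := by
  have h := contDiff_phasePrimitive (c := c) (ε := ε) ha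
  unfold charPhase
  refine ContDiff.add (ContDiff.sub (by fun_prop) (h.comp (by fun_prop))) (h.comp (by fun_prop))

theorem charPhase_one (q : ℝ × ℝ × ℝ) : charPhase c ε a 1 q = q.2.2 := by simp [charPhase]

/-- Time on the characteristic ending at `q = (t, x, τ)` is rescaled to `[0, 1]`, which turns `V`
into the time-one map of a flow with parameter `q`. The factor `t` enters the right-hand side, hence
a Lipschitz constant depending on `q`; negative `t` is allowed, so `V` lives on the full space. -/
theorem exists_global_solution {r : ℂ → ℂ} {α : ℝ → ℂ} {K : ℝ≥0} (hc : 0 < c) (hε : 0 < ε)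
    (ha : ContDiff ℝ 2 a) (hap : Function.Periodic a 1) (ha0 : ∀ x, a x ≠ 0)
    (hr : TwiceLip r) (hrK : LipschitzWith K r) (hα : ContDiff ℝ 2 α)
    (hαp : Function.Periodic α 1) :
    ∃ V : ℝ × ℝ × ℝ → ℂ, TwiceLip V ∧
      (∀ q, fderiv ℝ V q (1, c, a q.2.1 / ε) = -filteredSource r q.2.2 (V q)) ∧
      (∀ x τ, V (0, x, τ) = wellPrepared ε a r α x τ) ∧
      (∀ t x τ, V (t, x + 1, τ) = V (t, x, τ)) ∧
      (∀ t x τ, V (t, x, τ + 2 * Real.pi) = V (t, x, τ)) := by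
  let H : ℝ × (ℝ × ℝ × ℝ) × ℂ → ℂ := fun p =>
    (-p.2.1.1) • filteredSource r (charPhase c ε a p.1 p.2.1) p.2.2
  let w : ℝ × ℝ × ℝ → ℂ := fun q => wellPrepared ε a r α (q.2.1 - c * q.1) (charPhase c ε a 0 q)
  let k : ℝ × ℝ × ℝ → ℝ≥0 := fun q => ‖q.1‖₊ * K
  have hφ := contDiff_charPhase (c := c) (ε := ε) ha
  have hH : TwiceLip H := by
    refine (TwiceLip.of_contDiff (by fun_prop)).smul
      ((twiceLip_filteredSource hr).comp_contDiff
        (k := fun p : ℝ × (ℝ × ℝ × ℝ) × ℂ => (charPhase c ε a p.1 p.2.1, p.2.2)) ?_)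
    exact (hφ.comp (contDiff_fst.prodMk (contDiff_fst.comp contDiff_snd))).prodMk
      (contDiff_snd.comp contDiff_snd)
  have hw : TwiceLip w := by
    have h1 : TwiceLip fun p : ℝ × ℝ => wellPrepared ε a r α p.1 p.2 := by
      simp only [wellPrepared_eq]
      exact (TwiceLip.of_contDiff (hα.comp contDiff_fst)).add
        ((TwiceLip.const _).mul (twiceLip_initialProfile ha ha0 hr hα))
    exact h1.comp_contDiff (k := fun q : ℝ × ℝ × ℝ => (q.2.1 - c * q.1, charPhase c ε a 0 q))
      (ContDiff.prodMk (by fun_prop) (hφ.comp (contDiff_const.prodMk contDiff_id)))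
  have hk : ∀ q, ∀ s ∈ Icc (0 : ℝ) 1, LipschitzWith (k q) fun y => H (s, q, y) := fun q s _ => by
    refine LipschitzWith.of_dist_le_mul fun y z => ?_
    have := (filteredSource_lipschitz hrK (charPhase c ε a s q)).norm_sub_le y z
    simp only [H, k]
    rw [dist_eq_norm, dist_eq_norm, ← smul_sub, norm_smul, norm_neg]
    push_cast
    rw [mul_assoc]
    gcongr
  have hkc : Continuous k := by fun_prop
  obtain ⟨ω, hω⟩ := IsFlow.exists hH.continuous hk w
  have hV : TwiceLip (ω 1) := hω.twiceLip hH hw hk hkc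
  -- Both periodicities come from uniqueness for the ODE: a translation that preserves its data
  -- preserves its solution.
  have hshift : ∀ v : ℝ × ℝ × ℝ, (∀ q, w (q + v) = w q) →
      (∀ s q y, H (s, q + v, y) = H (s, q, y)) → ∀ q, ω 1 (q + v) = ω 1 q := by
    intro v hwv hHv q
    refine ode_unique_on_unit (F := fun s y => H (s, q, y)) (α := fun s => ω s (q + v))
      (γ := fun s => ω s q) (hk q)
      (by rw [hω.init, hω.init, hwv]) (fun s hs => ?_) (hω.eqn q) (right_mem_Icc.2 zero_le_one)
    rw [← hHv]
    exact hω.eqn (q + v) s hs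
  let γ : ℝ → ℝ × ℝ × ℝ → ℝ × ℝ × ℝ := fun σ q =>
    (σ * q.1, q.2.1 - c * q.1 * (1 - σ), charPhase c ε a σ q)
  have hγφ : ∀ s σ q, charPhase c ε a s (γ σ q) = charPhase c ε a (s * σ) q := fun s σ q => by
    simp only [γ, charPhase]
    ring_nf
  -- The point `γ σ q` lies on the characteristic of `q`, at the fraction `σ` of its time.
  -- Uniqueness identifies the solution ending there with the one for `q` stopped at `σ`;
  -- differentiating at `σ = 1` gives the equation.
  have hγ : ∀ q, ∀ σ ∈ Icc (0 : ℝ) 1, ω 1 (γ σ q) = ω σ q := by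
    intro q σ hσ
    have hmaps : MapsTo (fun s => s * σ) (Icc (0 : ℝ) 1) (Icc 0 1) := fun s hs =>
      ⟨mul_nonneg hs.1 hσ.1, mul_le_one₀ hs.2 hσ.1 hσ.2⟩
    have := ode_unique_on_unit (F := fun s y => H (s, γ σ q, y)) (hk (γ σ q))
      (α := fun s => ω s (γ σ q)) (γ := fun s => ω (s * σ) q)
      (by
        simp only [zero_mul, hω.init, w, hγφ]
        simp only [γ]
        ring_nf)
      (hω.eqn (γ σ q)) (fun s hs => by
        have h1 : HasDerivWithinAt (fun s : ℝ => s * σ) σ (Icc 0 1) s := by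
          simpa using (hasDerivAt_id s).hasDerivWithinAt.mul_const σ
        have h2 := (hω.eqn q (s * σ) (hmaps hs)).scomp s h1 hmaps
        refine h2.congr_deriv ?_
        simp only [H, hγφ, smul_smul]
        simp only [γ]
        ring_nf) (right_mem_Icc.2 zero_le_one)
    simpa using this
  have hγ1 : ∀ q, γ 1 q = q := fun q => by simp [γ, charPhase_one]
  have hγd : ∀ q : ℝ × ℝ × ℝ, HasDerivAt (fun σ => γ σ q) (q.1 • (1, c, a q.2.1 / ε)) 1 := by
    intro q
    have hx : HasDerivAt (fun σ : ℝ => q.2.1 - c * q.1 * (1 - σ)) (c * q.1) 1 := by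
      have := (((hasDerivAt_id (1 : ℝ)).const_sub 1).const_mul (c * q.1)).const_sub q.2.1
      simpa using this
    have hθ := (hasDerivAt_phasePrimitive (c := c) (ε := ε) ha.continuous
      (q.2.1 - c * q.1 * (1 - 1))).comp (1 : ℝ) hx
    have h1 : HasDerivAt (fun σ => γ σ q) (1 * q.1, c * q.1,
        a (q.2.1 - c * q.1 * (1 - 1)) / (c * ε) * (c * q.1)) 1 :=
      ((hasDerivAt_id (1 : ℝ)).mul_const q.1).prodMk (hx.prodMk (hθ.const_add _))
    convert h1 using 1
    have : c ≠ 0 := hc.ne'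
    ext
    · simp
    · simp [mul_comm]
    · simp only [sub_self, mul_zero, sub_zero, Prod.smul_snd, smul_eq_mul]
      field_simp
  have hpde : ∀ q : ℝ × ℝ × ℝ, q.1 • (fderiv ℝ (ω 1) q (1, c, a q.2.1 / ε)
      + filteredSource r q.2.2 (ω 1 q)) = 0 := by
    intro q
    have h1 : HasDerivWithinAt (fun σ => ω 1 (γ σ q))
        (fderiv ℝ (ω 1) q (q.1 • (1, c, a q.2.1 / ε))) (Icc 0 1) 1 := by
      have h0 := (hV.diff (γ 1 q)).hasFDerivAt
      have h2 := h0.comp_hasDerivAt (1 : ℝ) (hγd q)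
      rw [hγ1] at h2
      exact h2.hasDerivWithinAt
    have h2 : HasDerivWithinAt (fun σ => ω 1 (γ σ q)) (H (1, q, ω 1 q)) (Icc 0 1) 1 :=
      (hω.eqn q 1 (right_mem_Icc.2 zero_le_one)).congr (hγ q)
        (hγ q 1 (right_mem_Icc.2 zero_le_one))
    have h3 := (uniqueDiffOn_Icc zero_lt_one 1 (right_mem_Icc.2 zero_le_one)).eq_deriv _ h1 h2
    rw [map_smul] at h3
    rw [smul_add, h3]
    simp [H, charPhase_one]
  refine ⟨ω 1, hV, ?_, ?_, ?_, ?_⟩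
  · rintro ⟨t, x, τ⟩
    rw [eq_neg_iff_add_eq_zero]
    have hfs := (twiceLip_filteredSource hr).continuous
    have hVc := hV.continuous
    have hVd := hV.diff'.continuous
    have hcont : Continuous fun t : ℝ => fderiv ℝ (ω 1) (t, x, τ) (1, c, a x / ε)
        + filteredSource r τ (ω 1 (t, x, τ)) :=
      (Continuous.clm_apply (hVd.comp (by fun_prop)) continuous_const).add
        (hfs.comp (continuous_const.prodMk (hVc.comp (by fun_prop))))
    -- The rescaling yields only `t` times the equation, which says nothing at `t = 0`; continuity
    -- in `t` fills that gap.
    have := Continuous.ext_on (dense_compl_singleton (0 : ℝ)) hcont continuous_const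
      (g := fun _ => 0) fun t ht => (smul_eq_zero.1 (hpde (t, x, τ))).resolve_left ht
    exact congrFun this t
  · intro x τ
    have := hγ (0, x, τ) 0 (left_mem_Icc.2 zero_le_one)
    have e : γ 0 (0, x, τ) = (0, x, τ) := by simp [γ, charPhase]
    rw [e, hω.init] at this
    rw [this]
    simp [w, charPhase]
  · intro t x τ
    have hφv : ∀ s (q : ℝ × ℝ × ℝ), charPhase c ε a s (q + (0, 1, 0)) = charPhase c ε a s q := by
      intro s q
      simp only [charPhase, Prod.fst_add, Prod.snd_add, add_zero]
      rw [add_sub_right_comm, phasePrimitive_add_one ha.continuous hap,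
        phasePrimitive_add_one ha.continuous hap]
      ring
    have := hshift (0, 1, 0) (fun q => by
      simp only [w, hφv, wellPrepared_eq, Prod.fst_add, Prod.snd_add, add_zero]
      rw [add_sub_right_comm, hαp, initialProfile_periodic_fst hap hαp])
      (fun s q y => by simp only [H, hφv, Prod.fst_add, add_zero]) (t, x, τ)
    simpa using this
  · intro t x τ
    have hφv : ∀ s (q : ℝ × ℝ × ℝ), charPhase c ε a s (q + (0, 0, 2 * Real.pi))
        = charPhase c ε a s q + 2 * Real.pi := by
      intro s q
      simp only [charPhase, Prod.snd_add, Prod.fst_add, add_zero]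
      ring
    have := hshift (0, 0, 2 * Real.pi) (fun q => by
      simp only [w, hφv, wellPrepared_eq, Prod.fst_add, Prod.snd_add, add_zero]
      rw [initialProfile_periodic_snd hr])
      (fun s q y => by simp only [H, hφv, Prod.fst_add, add_zero, filteredSource_periodic])
      (t, x, τ)
    simpa using this

end

/-! ### Periodic bounds and partial derivatives. -/

section Generic

variable {X F : Type*} [NormedAddCommGroup X] [NormedSpace ℝ X] [NormedAddCommGroup F]
  [NormedSpace ℝ F]

theorem TwiceLip.exists_bound_of_periodic [FiniteDimensional ℝ X] {g : X → F} (hg : TwiceLip g)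
    {s S : Set X} (hs : Bornology.IsBounded s)
    (hS : ∀ x ∈ S, ∃ v, x + v ∈ s ∧ ∀ y, g (y + v) = g y) :
    ∃ C : ℝ, 0 ≤ C ∧ ∀ x ∈ S, ‖g x‖ ≤ C ∧ ‖fderiv ℝ g x‖ ≤ C ∧
      ‖fderiv ℝ (fderiv ℝ g) x‖ ≤ C := by
  obtain ⟨C, hC0, hC⟩ := hg.exists_bound hs
  refine ⟨C, hC0, fun x hx => ?_⟩
  obtain ⟨v, hv, hper⟩ := hS x hx
  have h1 : ∀ y, fderiv ℝ g (y + v) = fderiv ℝ g y := fun y => by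
    rw [← fderiv_comp_add_right]; simp only [hper]
  have h2 : fderiv ℝ (fderiv ℝ g) (x + v) = fderiv ℝ (fderiv ℝ g) x := by
    rw [← fderiv_comp_add_right]; simp only [h1]
  have := hC _ hv
  rwa [hper, h1, h2] at this

theorem exists_periodic_shift {p : ℝ} (hp : 0 < p) (x : ℝ) :
    ∃ n : ℤ, x + n * p ∈ Icc 0 p := by
  refine ⟨-⌊x / p⌋, ?_⟩
  have h1 := Int.floor_le (x / p)
  have h2 := Int.lt_floor_add_one (x / p)
  rw [le_div_iff₀ hp] at h1
  rw [div_lt_iff₀ hp] at h2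
  push_cast
  constructor <;> nlinarith

theorem TwiceLip.hasFDerivAt_fderiv_apply {g : X → F} (hg : TwiceLip g) (x v : X) :
    HasFDerivAt (fun y => fderiv ℝ g y v) ((fderiv ℝ (fderiv ℝ g) x).flip v) x := by
  have := (hg.diff' x).hasFDerivAt.clm_apply (hasFDerivAt_const v x)
  refine this.congr_fderiv ?_
  ext w; simp

theorem TwiceLip.fderiv_fderiv_apply {g : X → F} (hg : TwiceLip g) (x v w : X) :
    fderiv ℝ (fun y => fderiv ℝ g y v) x w = fderiv ℝ (fderiv ℝ g) x w v := by
  rw [(hg.hasFDerivAt_fderiv_apply x v).fderiv]; rfl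

theorem hasDerivAt_line_fst {g : ℝ × ℝ × ℝ → F} (hg : Differentiable ℝ g) (t x τ : ℝ) :
    HasDerivAt (fun s => g (s, x, τ)) (fderiv ℝ g (t, x, τ) (1, 0, 0)) t :=
  (hg (t, x, τ)).hasFDerivAt.comp_hasDerivAt t
    ((hasDerivAt_id t).prodMk ((hasDerivAt_const t x).prodMk (hasDerivAt_const t τ)))

theorem hasDerivAt_line_snd {g : ℝ × ℝ × ℝ → F} (hg : Differentiable ℝ g) (t x τ : ℝ) :
    HasDerivAt (fun y => g (t, y, τ)) (fderiv ℝ g (t, x, τ) (0, 1, 0)) x :=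
  (hg (t, x, τ)).hasFDerivAt.comp_hasDerivAt x
    ((hasDerivAt_const x t).prodMk ((hasDerivAt_id x).prodMk (hasDerivAt_const x τ)))

theorem hasDerivAt_line_thd {g : ℝ × ℝ × ℝ → F} (hg : Differentiable ℝ g) (t x τ : ℝ) :
    HasDerivAt (fun σ => g (t, x, σ)) (fderiv ℝ g (t, x, τ) (0, 0, 1)) τ :=
  (hg (t, x, τ)).hasFDerivAt.comp_hasDerivAt τ
    ((hasDerivAt_const τ t).prodMk ((hasDerivAt_const τ x).prodMk (hasDerivAt_id τ)))

theorem hasDerivAt_line_pair_fst {g : ℝ × ℝ → F} (hg : Differentiable ℝ g) (x τ : ℝ) :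
    HasDerivAt (fun y => g (y, τ)) (fderiv ℝ g (x, τ) (1, 0)) x :=
  (hg (x, τ)).hasFDerivAt.comp_hasDerivAt x ((hasDerivAt_id x).prodMk (hasDerivAt_const x τ))

theorem hasDerivAt_line_pair_snd {g : ℝ × ℝ → F} (hg : Differentiable ℝ g) (x τ : ℝ) :
    HasDerivAt (fun σ => g (x, σ)) (fderiv ℝ g (x, τ) (0, 1)) τ :=
  (hg (x, τ)).hasFDerivAt.comp_hasDerivAt τ ((hasDerivAt_const τ x).prodMk (hasDerivAt_id τ))

end Generic

/-! ### A priori estimate for derivatives of transported functions. -/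

section Transport

variable {c ε T : ℝ} {a : ℝ → ℝ}

/-- The direction `(1, c, a(x)/ε)` of the transport operator `∂_t + c ∂_x + (a/ε) ∂_τ`. -/
def transportDir (c ε : ℝ) (a : ℝ → ℝ) (q : ℝ × ℝ × ℝ) : ℝ × ℝ × ℝ := (1, c, a q.2.1 / ε)

/-- The characteristic of the transport operator through `q`. -/
theorem exists_characteristic (hc : 0 < c) (ha : Continuous a) (q : ℝ × ℝ × ℝ) :
    ∃ γ : ℝ → ℝ × ℝ × ℝ, γ q.1 = q ∧ (∀ s, (γ s).1 = s) ∧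
      ∀ s, HasDerivAt γ (transportDir c ε a (γ s)) s := by
  refine ⟨fun s => (s, q.2.1 - c * (q.1 - s), q.2.2 - phasePrimitive c ε a q.2.1
    + phasePrimitive c ε a (q.2.1 - c * (q.1 - s))), by simp, fun _ => rfl, fun s => ?_⟩
  have hx : HasDerivAt (fun s : ℝ => q.2.1 - c * (q.1 - s)) c s := by
    simpa using (((hasDerivAt_id s).const_sub q.1).const_mul c).const_sub q.2.1
  have hθ := ((hasDerivAt_phasePrimitive (c := c) (ε := ε) ha (q.2.1 - c * (q.1 - s))).comp s
    hx).const_add (q.2.2 - phasePrimitive c ε a q.2.1)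
  have : c ≠ 0 := hc.ne'
  refine HasDerivAt.congr_deriv ((hasDerivAt_id s).prodMk (hx.prodMk hθ)) ?_
  simp only [transportDir, Prod.mk.injEq, true_and]
  field_simp

/-- If `u` is transported with source `S`, a bound on the `(i, j, 0)`-derivative of `S`
controls that of `u`; the commutator with the `x`-dependent phase speed is bounded by `hcomm`. -/
theorem norm_fderiv_le_of_transport {u S : ℝ × ℝ × ℝ → ℂ} {i j A₁ A B k N l : ℝ} (hc : 0 < c)
    (hε : 0 < ε) (ha : Continuous a) (hA₁ : ∀ x y, |a x - a y| ≤ A₁ * |x - y|) (hi : 0 ≤ i)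
    (hi1 : i ≤ 1) (hj : 0 ≤ j) (hkN : 0 ≤ k * N) (hl : 0 < l)
    (hu : Differentiable ℝ u) (hS : Differentiable ℝ S)
    (heq : ∀ q, fderiv ℝ u q (transportDir c ε a q) = S q)
    (h0 : ∀ x τ, ‖fderiv ℝ u (0, x, τ) (i, j, 0)‖ ≤ B)
    (hSb : ∀ q, q.1 ∈ Ico 0 T → ‖fderiv ℝ S q (i, j, 0)‖ ≤ A + k * N * Real.exp (l * q.1))
    (hcomm : ∀ q, q.1 ∈ Ico 0 T →
      j * A₁ / ε * ‖fderiv ℝ u q (0, 0, 1)‖ ≤ A + k * N * Real.exp (l * q.1)) :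
    ∀ q, q.1 ∈ Ico 0 T → ‖fderiv ℝ u q (i, j, 0)‖ ≤
      B + 2 * A * q.1 + 2 * (k * N) / l * Real.exp (l * q.1) := by
  intro q hq
  set e : ℝ × ℝ × ℝ := (i, j, 0) with he
  obtain ⟨γ, hγq, hγ1, hγ⟩ := exists_characteristic (ε := ε) hc ha q
  set t := q.1
  -- The equation cannot be differentiated, since `u` may lack a second derivative. Instead the
  -- increment of `u` under the shift `h • e` is followed along a characteristic. Shifts go forward
  -- in time, which is why the bounds live on the half-open `Ico 0 T`.
  have hstep : ∀ h ∈ Ioo 0 (T - t), ‖h⁻¹ • (u (q + h • e) - u q)‖ ≤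
      ‖h⁻¹ • (u (γ 0 + h • e) - u (γ 0))‖
        + (2 * A * t + 2 * (k * N) * Real.exp (l * h) / l * (Real.exp (l * t) - 1)) := by
    intro h hh
    have hh0 : 0 < h := hh.1
    let M : ℝ → ℝ := fun s => A + k * N * Real.exp (l * s)
    have hMmono : Monotone M := fun s s' hss' => by
      simp only [M]; gcongr
    have hshift1 : ∀ (y : ℝ × ℝ × ℝ) (σ : ℝ), (y + σ • e).1 = y.1 + σ * i := fun y σ => by simp [he]
    have hrange : ∀ s ∈ Ico 0 t, ∀ σ ∈ Icc 0 h, (γ s + σ • e).1 ∈ Ico 0 T ∧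
        (γ s + σ • e).1 ≤ s + h := fun s hs σ hσ => by
      rw [hshift1, hγ1]
      have h1 : 0 ≤ σ * i := mul_nonneg hσ.1 hi
      have h2 : σ * i ≤ h := (mul_le_mul hσ.2 hi1 hi hh0.le).trans (by simp)
      exact ⟨⟨by linarith [hs.1], by linarith [hs.2, hh.2]⟩, by linarith⟩
    have hSdiff : ∀ s ∈ Ico 0 t, ‖S (γ s + h • e) - S (γ s)‖ ≤ h * M (s + h) := fun s hs => by
      have hd : ∀ σ ∈ Icc 0 h, HasDerivWithinAt (fun σ : ℝ => S (γ s + σ • e))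
          (fderiv ℝ S (γ s + σ • e) e) (Icc 0 h) σ := fun σ _ => by
        have h1 : HasDerivAt (fun σ : ℝ => γ s + σ • e) e σ := by
          simpa using ((hasDerivAt_id σ).smul_const e).const_add (γ s)
        exact ((hS _).hasFDerivAt.comp_hasDerivAt σ h1).hasDerivWithinAt
      have := norm_image_sub_le_of_norm_deriv_le_segment' hd (C := M (s + h)) (fun σ hσ => by
        obtain ⟨h1, h2⟩ := hrange s hs σ (Ico_subset_Icc_self hσ)
        exact (hSb _ h1).trans (hMmono h2)) h (right_mem_Icc.2 hh0.le)
      simpa [mul_comm] using this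
    have hpd : ∀ s, HasDerivAt (fun s => u (γ s + h • e) - u (γ s))
        (fderiv ℝ u (γ s + h • e) (transportDir c ε a (γ s)) - S (γ s)) s := fun s => by
      have h1 := (hu (γ s + h • e)).hasFDerivAt.comp_hasDerivAt s ((hγ s).add_const (h • e))
      have h2 := (hu (γ s)).hasFDerivAt.comp_hasDerivAt s (hγ s)
      rw [heq] at h2
      exact h1.sub h2
    have hpb : ∀ s ∈ Ico 0 t, ‖fderiv ℝ u (γ s + h • e) (transportDir c ε a (γ s)) - S (γ s)‖ ≤
        2 * h * M (s + h) := fun s hs => by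
      obtain ⟨h1, h2⟩ := hrange s hs h (right_mem_Icc.2 hh0.le)
      have h3 := (hcomm _ h1).trans (hMmono h2)
      -- The shifted curve is not a characteristic: its phase speed is off by an increment of `a /
      -- ε`. This is the commutator in finite-difference form, and it costs a second copy of the
      -- bound for `S`, hence the factor `2`.
      have e1 : transportDir c ε a (γ s) = transportDir c ε a (γ s + h • e)
          + ((a (γ s).2.1 - a ((γ s).2.1 + h * j)) / ε) • ((0 : ℝ), (0 : ℝ), (1 : ℝ)) := by
        simp only [transportDir, he]
        ext <;> simp
        ring
      have h4 : |(a (γ s).2.1 - a ((γ s).2.1 + h * j)) / ε| ≤ h * (j * A₁ / ε) := by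
        have := hA₁ (γ s).2.1 ((γ s).2.1 + h * j)
        rw [sub_add_cancel_left, abs_neg, abs_of_nonneg (mul_nonneg hh0.le hj)] at this
        rw [abs_div, abs_of_pos hε, div_le_iff₀ hε]
        refine this.trans (le_of_eq ?_)
        field_simp
      rw [e1, map_add, map_smul, heq, add_sub_right_comm]
      refine (norm_add_le _ _).trans ?_
      rw [norm_smul, Real.norm_eq_abs]
      have h5 := mul_le_mul_of_nonneg_right h4
        (norm_nonneg (fderiv ℝ u (γ s + h • e) (0, 0, 1)))
      have h6 := mul_le_mul_of_nonneg_left h3 hh0.le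
      have h7 := hSdiff s hs
      rw [mul_assoc] at h5
      linarith
    let D : ℝ → ℝ := fun s => ‖u (γ 0 + h • e) - u (γ 0)‖ + (2 * h * A * s
      + 2 * h * (k * N) * Real.exp (l * h) / l * (Real.exp (l * s) - 1))
    have hD : ∀ s, HasDerivAt D (2 * h * M (s + h)) s := fun s => by
      have h1 : HasDerivAt (fun s => Real.exp (l * s)) (Real.exp (l * s) * l) s := by
        simpa using ((hasDerivAt_id s).const_mul l).exp
      have h2 := (((hasDerivAt_id s).const_mul (2 * h * A)).add ((h1.sub_const 1).const_mul
        (2 * h * (k * N) * Real.exp (l * h) / l))).const_add ‖u (γ 0 + h • e) - u (γ 0)‖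
      refine h2.congr_deriv ?_
      simp only [M]
      rw [mul_add l, Real.exp_add]
      field_simp
    have hfin := image_norm_le_of_norm_deriv_right_le_deriv_boundary (a := 0) (b := t) (B := D)
      (fun s _ => (hpd s).continuousAt.continuousWithinAt)
      (fun s _ => (hpd s).hasDerivWithinAt) (by simp [D]) hD hpb (right_mem_Icc.2 hq.1)
    rw [hγq] at hfin
    rw [norm_smul, norm_smul, norm_inv, Real.norm_of_nonneg hh0.le]
    calc _ ≤ h⁻¹ * D t := by gcongr
      _ = _ := by simp only [D]; field_simp
  have hline : ∀ y, Tendsto (fun h : ℝ => ‖h⁻¹ • (u (y + h • e) - u y)‖) (𝓝[>] 0)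
      (𝓝 ‖fderiv ℝ u y e‖) := fun y =>
    ((hu y).hasFDerivAt.hasLineDerivAt e).tendsto_slope_zero_right.norm
  have hexp : Tendsto (fun h : ℝ => 2 * A * t + 2 * (k * N) * Real.exp (l * h) / l *
      (Real.exp (l * t) - 1)) (𝓝[>] 0)
      (𝓝 (2 * A * t + 2 * (k * N) * Real.exp (l * 0) / l * (Real.exp (l * t) - 1))) :=
    (by fun_prop : Continuous fun h : ℝ => 2 * A * t + 2 * (k * N) * Real.exp (l * h) / l *
      (Real.exp (l * t) - 1)).continuousWithinAt.tendsto
  have hle := le_of_tendsto_of_tendsto (hline q) ((hline (γ 0)).add hexp) (by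
    filter_upwards [Ioo_mem_nhdsGT (by linarith [hq.2] : (0 : ℝ) < T - t)] with h hh
    exact hstep h hh)
  have hB : ‖fderiv ℝ u (γ 0) e‖ ≤ B := by
    have : γ 0 = (0, (γ 0).2.1, (γ 0).2.2) := by
      ext <;> simp [hγ1]
    rw [this]; exact h0 _ _
  rw [mul_zero, Real.exp_zero, mul_one] at hle
  have hpos : 0 ≤ 2 * (k * N) / l := by positivity
  nlinarith

/-- The map `N ↦ D + N / 2` contracts to its fixed point `2 * D`, so the limit forgets `N₀`. Only
the finiteness of `N₀` matters, and it may depend on `ε`. -/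
theorem le_of_halving {ι : Type*} {f g : ι → ℝ} {D N₀ : ℝ} (hD : 0 ≤ D) (hN₀ : 0 ≤ N₀)
    (h0 : ∀ q, f q ≤ N₀ * g q)
    (hstep : ∀ N, 0 ≤ N → (∀ q, f q ≤ N * g q) → ∀ q, f q ≤ (D + N / 2) * g q) :
    ∀ q, f q ≤ 2 * D * g q := by
  let N : ℕ → ℝ := fun n => 2 * D + (N₀ - 2 * D) * (1 / 2) ^ n
  have hind : ∀ n : ℕ, 0 ≤ N n ∧ ∀ q, f q ≤ N n * g q := by
    intro n
    induction n with
    | zero => simpa [N] using And.intro hN₀ h0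
    | succ n ih =>
      have e : N (n + 1) = D + N n / 2 := by simp only [N]; ring
      rw [e]
      exact ⟨by linarith [ih.1], hstep _ ih.1 ih.2⟩
  intro q
  have hlim : Tendsto (fun n : ℕ => N n * g q) atTop (𝓝 ((2 * D + (N₀ - 2 * D) * 0) * g q)) :=
    (((tendsto_pow_atTop_nhds_zero_of_lt_one (by norm_num) (by norm_num)).const_mul _).const_add
      _).mul_const _
  rw [mul_zero, add_zero] at hlim
  exact ge_of_tendsto' hlim fun n => (hind n).2 q

/-- This is Gronwall in the weighted norm `sup e^{-l t} ‖·‖`. It avoids treating the supremum of a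
possibly discontinuous derivative as a function of time, and the qualitative bound `N₀` does not
enter the result. -/
theorem norm_fderiv_le_of_transport_of_bounded {u S : ℝ × ℝ × ℝ → ℂ} {i j A₁ A B k : ℝ}
    (hc : 0 < c) (hε : 0 < ε) (hT : 0 ≤ T) (ha : Continuous a)
    (hA₁ : ∀ x y, |a x - a y| ≤ A₁ * |x - y|)
    (hi : 0 ≤ i) (hi1 : i ≤ 1) (hj : 0 ≤ j) (hA : 0 ≤ A) (hk : 0 ≤ k)
    (hu : Differentiable ℝ u) (hS : Differentiable ℝ S)
    (heq : ∀ q, fderiv ℝ u q (transportDir c ε a q) = S q)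
    (h0 : ∀ x τ, ‖fderiv ℝ u (0, x, τ) (i, j, 0)‖ ≤ B)
    (hSb : ∀ q, q.1 ∈ Ico 0 T → ‖fderiv ℝ S q (i, j, 0)‖ ≤ A + k * ‖fderiv ℝ u q (i, j, 0)‖)
    (hcomm : ∀ q, q.1 ∈ Ico 0 T →
      j * A₁ / ε * ‖fderiv ℝ u q (0, 0, 1)‖ ≤ A + k * ‖fderiv ℝ u q (i, j, 0)‖)
    (hbd : ∃ N₀, ∀ q, q.1 ∈ Ico 0 T → ‖fderiv ℝ u q (i, j, 0)‖ ≤ N₀) :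
    ∀ q, q.1 ∈ Ico 0 T → ‖fderiv ℝ u q (i, j, 0)‖ ≤
      2 * (B + 2 * A * T) * Real.exp ((4 * k + 1) * T) := by
  obtain ⟨N₀, hN₀⟩ := hbd
  -- Chosen so that `2 * k / l ≤ 1 / 2`, the contraction required by `le_of_halving`; the `+ 1`
  -- keeps `l` positive when `k = 0`.
  set l := 4 * k + 1
  have hl : 0 < l := by positivity
  have hB : 0 ≤ B := (norm_nonneg _).trans (h0 0 0)
  have hexp : ∀ q : ℝ × ℝ × ℝ, q.1 ∈ Ico 0 T → 1 ≤ Real.exp (l * q.1) := fun q hq =>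
    Real.one_le_exp (mul_nonneg hl.le hq.1)
  have key := le_of_halving (ι := {q : ℝ × ℝ × ℝ // q.1 ∈ Ico 0 T})
    (f := fun q => ‖fderiv ℝ u q (i, j, 0)‖) (g := fun q => Real.exp (l * q.1.1))
    (D := B + 2 * A * T) (N₀ := |N₀|) (by positivity) (abs_nonneg _)
    (fun q => (hN₀ q q.2).trans ((le_abs_self _).trans
      (le_mul_of_one_le_right (abs_nonneg _) (hexp q q.2))))
    (fun N hN hf q => by
      have h1 := norm_fderiv_le_of_transport (T := T) (A := A) (k := k) (N := N)
        (l := l) hc hε ha hA₁ hi hi1 hj (mul_nonneg hk hN) hl hu hS heq h0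
        (fun q hq => (hSb q hq).trans (by
          have := mul_le_mul_of_nonneg_left (hf ⟨q, hq⟩) hk
          simp only at this
          linarith))
        (fun q hq => (hcomm q hq).trans (by
          have := mul_le_mul_of_nonneg_left (hf ⟨q, hq⟩) hk
          simp only at this
          linarith)) q q.2
      refine h1.trans ?_
      have h2 := hexp q q.2
      have h3 : 2 * (k * N) / l ≤ N / 2 := by
        rw [div_le_div_iff₀ hl two_pos]; simp only [l]; nlinarith
      have h4 : B + 2 * A * q.1.1 ≤ (B + 2 * A * T) * Real.exp (l * q.1.1) := by
        have : A * q.1.1 ≤ A * T := mul_le_mul_of_nonneg_left q.2.2.le hA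
        have h5 : 0 ≤ B + 2 * A * T := by positivity
        nlinarith
      have h6 := mul_le_mul_of_nonneg_right h3 (Real.exp_pos (l * q.1.1)).le
      linarith)
  intro q hq
  refine (key ⟨q, hq⟩).trans ?_
  have h1 : q.1 ≤ T := hq.2.le
  gcongr

end Transport

/-! ### Standing assumptions and bounds on the coefficients. -/

/-- Standing assumptions on the coefficients of the problem. -/
structure Admissible (c a₀ : ℝ) (K : ℝ≥0) (a : ℝ → ℝ) (r : ℂ → ℂ) (α : ℝ → ℂ) : Prop where
  c_pos : 0 < c
  a₀_pos : 0 < a₀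
  contDiff_a : ContDiff ℝ 2 a
  periodic_a : Function.Periodic a 1
  le_a : ∀ x, a₀ ≤ a x
  twiceLip_r : TwiceLip r
  lipschitz_r : LipschitzWith K r
  contDiff_α : ContDiff ℝ 2 α
  periodic_α : Function.Periodic α 1

/-- A twice differentiable solution for all times, as a function of `(t, x, τ)`. -/
structure IsGlobalSolution (c ε : ℝ) (a : ℝ → ℝ) (r : ℂ → ℂ) (α : ℝ → ℂ)
    (V : ℝ × ℝ × ℝ → ℂ) : Prop where
  twiceLip : TwiceLip V
  eqn : ∀ q, fderiv ℝ V q (transportDir c ε a q) = -filteredSource r q.2.2 (V q)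
  init : ∀ x τ, V (0, x, τ) = wellPrepared ε a r α x τ
  periodic_x : ∀ t x τ, V (t, x + 1, τ) = V (t, x, τ)
  periodic_phase : ∀ t x τ, V (t, x, τ + 2 * Real.pi) = V (t, x, τ)

section Coefficients

theorem periodic_deriv_one {F : Type*} [NormedAddCommGroup F] [NormedSpace ℝ F]
    {f : ℝ → F} (hp : Function.Periodic f 1) : Function.Periodic (deriv f) 1 := fun x => by
  rw [← deriv_comp_add_const]
  congr 1
  exact funext hp

theorem exists_bound_of_periodic_one {F : Type*} [NormedAddCommGroup F] [NormedSpace ℝ F]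
    {f : ℝ → F} (hf : ContDiff ℝ 1 f) (hp : Function.Periodic f 1) :
    ∃ C, 0 ≤ C ∧ ∀ x, ‖f x‖ ≤ C ∧ ‖deriv f x‖ ≤ C := by
  have hp' := periodic_deriv_one hp
  obtain ⟨C, hC⟩ := isCompact_Icc.exists_bound_of_continuousOn (s := Icc (0 : ℝ) 1)
    (hf.continuous.prodMk (hf.continuous_deriv le_rfl)).continuousOn
  have hC' : ∀ x, ‖(f x, deriv f x)‖ ≤ C := fun x => by
    obtain ⟨n, hn⟩ := exists_periodic_shift one_pos x
    have := hC _ hn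
    rwa [hp.int_mul n x, hp'.int_mul n x] at this
  exact ⟨C, (norm_nonneg _).trans (hC' 0), fun x =>
    ⟨(norm_fst_le _).trans (hC' x), (norm_snd_le _).trans (hC' x)⟩⟩

variable {c a₀ : ℝ} {K : ℝ≥0} {a : ℝ → ℝ} {r : ℂ → ℂ} {α : ℝ → ℂ}

theorem Admissible.pos_a (h : Admissible c a₀ K a r α) (x : ℝ) : 0 < a x :=
  h.a₀_pos.trans_le (h.le_a x)

theorem Admissible.contDiff_deriv_a (h : Admissible c a₀ K a r α) : ContDiff ℝ 1 (deriv a) :=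
  (contDiff_succ_iff_deriv.1 (h.contDiff_a : ContDiff ℝ (1 + 1) a)).2.2

theorem Admissible.contDiff_deriv_α (h : Admissible c a₀ K a r α) : ContDiff ℝ 1 (deriv α) :=
  (contDiff_succ_iff_deriv.1 (h.contDiff_α : ContDiff ℝ (1 + 1) α)).2.2

theorem Admissible.hasDerivAt_a (h : Admissible c a₀ K a r α) (x : ℝ) :
    HasDerivAt a (deriv a x) x := (h.contDiff_a.differentiable (by norm_num) x).hasDerivAt

theorem Admissible.hasDerivAt_α (h : Admissible c a₀ K a r α) (x : ℝ) :
    HasDerivAt α (deriv α x) x := (h.contDiff_α.differentiable (by norm_num) x).hasDerivAt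

theorem Admissible.contDiff_logDeriv (h : Admissible c a₀ K a r α) :
    ContDiff ℝ 1 fun x => deriv a x / a x :=
  h.contDiff_deriv_a.div (h.contDiff_a.of_le (by norm_num)) fun x => (h.pos_a x).ne'

theorem Admissible.exists_coeff_bound (h : Admissible c a₀ K a r α) : ∃ M, 0 ≤ M ∧ ∀ x,
    |a x| ≤ M ∧ |deriv a x| ≤ M ∧ |deriv a x / a x| ≤ M ∧ |deriv (fun x => deriv a x / a x) x| ≤ M
      ∧ ‖α x‖ ≤ M ∧ ‖deriv α x‖ ≤ M ∧ ‖deriv (deriv α) x‖ ≤ M := by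
  obtain ⟨M₁, h1, H1⟩ :=
    exists_bound_of_periodic_one (h.contDiff_a.of_le (by norm_num)) h.periodic_a
  obtain ⟨M₂, h2, H2⟩ := exists_bound_of_periodic_one h.contDiff_logDeriv fun x => by
    rw [h.periodic_a x, periodic_deriv_one h.periodic_a x]
  obtain ⟨M₃, h3, H3⟩ :=
    exists_bound_of_periodic_one (h.contDiff_α.of_le (by norm_num)) h.periodic_α
  obtain ⟨M₄, h4, H4⟩ := exists_bound_of_periodic_one h.contDiff_deriv_α
    (periodic_deriv_one h.periodic_α)
  refine ⟨M₁ + M₂ + M₃ + M₄, by positivity, fun x => ?_⟩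
  have e1 := H1 x
  have e2 := H2 x
  have e3 := H3 x
  have e4 := H4 x
  simp only [Real.norm_eq_abs] at e1 e2
  refine ⟨?_, ?_, ?_, ?_, ?_, ?_, ?_⟩ <;> linarith

theorem Admissible.exists_lipschitz_a (h : Admissible c a₀ K a r α) :
    ∃ A₁, 0 ≤ A₁ ∧ ∀ x y, |a x - a y| ≤ A₁ * |x - y| := by
  obtain ⟨M, hM0, hM⟩ := h.exists_coeff_bound
  lift M to ℝ≥0 using hM0
  exact ⟨M, M.2, fun x y => (lipschitzWith_of_nnnorm_deriv_le
    (h.contDiff_a.differentiable (by norm_num)) fun x => (hM x).2.1).norm_sub_le x y⟩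

end Coefficients

/-! ### Bounds for the source and its linearisation. -/

section SourceBounds

/-- The filtered source as a function of the pair `(τ, z)`. -/
def sourcePair (r : ℂ → ℂ) (p : ℝ × ℂ) : ℂ := filteredSource r p.1 p.2

variable {r : ℂ → ℂ}

theorem twiceLip_sourcePair (hr : TwiceLip r) : TwiceLip (sourcePair r) :=
  twiceLip_filteredSource hr

theorem exists_bound_sourcePair (hr : TwiceLip r) (R : ℝ) : ∃ F, 0 ≤ F ∧ ∀ p : ℝ × ℂ, ‖p.2‖ ≤ R →
    ‖sourcePair r p‖ ≤ F ∧ ‖fderiv ℝ (sourcePair r) p‖ ≤ F ∧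
      ‖fderiv ℝ (fderiv ℝ (sourcePair r)) p‖ ≤ F := by
  refine (twiceLip_sourcePair hr).exists_bound_of_periodic (S := {p | ‖p.2‖ ≤ R})
    ((Metric.isBounded_Icc 0 (2 * Real.pi)).prod (Metric.isBounded_closedBall (x := (0 : ℂ))
      (r := R))) fun p hp => ?_
  obtain ⟨n, hn⟩ := exists_periodic_shift Real.two_pi_pos p.1
  refine ⟨(n * (2 * Real.pi), 0), ⟨hn, by simpa using hp⟩, fun y => ?_⟩
  have hper : Function.Periodic (fun τ => filteredSource r τ y.2) (2 * Real.pi) := fun τ =>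
    filteredSource_periodic τ y.2
  simpa [sourcePair] using hper.int_mul n y.1

theorem hasDerivAt_sourcePair_comp (hr : TwiceLip r) {W : ℝ → ℂ} {W' : ℂ} {y : ℝ} (τ : ℝ)
    (hW : HasDerivAt W W' y) :
    HasDerivAt (fun y => sourcePair r (τ, W y)) (fderiv ℝ (sourcePair r) (τ, W y) (0, W')) y := by
  have h1 : HasDerivAt (fun y => (τ, W y)) (0, W') y := (hasDerivAt_const y τ).prodMk hW
  exact ((twiceLip_sourcePair hr).diff (τ, W y)).hasFDerivAt.comp_hasDerivAt y h1

/-- In directions without phase component the constant is the global Lipschitz constant of `r`, so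
the first estimates do not need a prior bound on `V`. -/
theorem norm_fderiv_sourcePair_le (hr : TwiceLip r) {K : ℝ≥0} (hK : LipschitzWith K r) (p : ℝ × ℂ)
    (w : ℂ) : ‖fderiv ℝ (sourcePair r) p (0, w)‖ ≤ K * ‖w‖ := by
  have h1 : HasFDerivAt (fun z => sourcePair r (p.1, z))
      ((fderiv ℝ (sourcePair r) p).comp (ContinuousLinearMap.inr ℝ ℝ ℂ)) p.2 :=
    ((twiceLip_sourcePair hr).diff (p.1, p.2)).hasFDerivAt.comp p.2
      (hasFDerivAt_prodMk_right p.1 p.2)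
  have h2 := h1.le_of_lipschitz (filteredSource_lipschitz hK p.1)
  exact ContinuousLinearMap.le_of_opNorm_le _ h2 w

/-- The derivative of `q ↦ D_z f(τ, V) W` in directions without phase component. -/
theorem hasFDerivAt_linearised (hr : TwiceLip r) {V W : ℝ × ℝ × ℝ → ℂ} (hV : Differentiable ℝ V)
    (hW : Differentiable ℝ W) :
    Differentiable ℝ (fun q : ℝ × ℝ × ℝ => fderiv ℝ (sourcePair r) (q.2.2, V q) (0, W q)) ∧
    ∀ q i j, fderiv ℝ (fun q : ℝ × ℝ × ℝ => fderiv ℝ (sourcePair r) (q.2.2, V q) (0, W q)) q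
        (i, j, 0) =
      fderiv ℝ (fderiv ℝ (sourcePair r)) (q.2.2, V q) (0, fderiv ℝ V q (i, j, 0)) (0, W q)
        + fderiv ℝ (sourcePair r) (q.2.2, V q) (0, fderiv ℝ W q (i, j, 0)) := by
  have key : ∀ q : ℝ × ℝ × ℝ, HasFDerivAt
      (fun q : ℝ × ℝ × ℝ => fderiv ℝ (sourcePair r) (q.2.2, V q) (0, W q)) _ q := fun q => by
    have h1 : HasFDerivAt (fun q : ℝ × ℝ × ℝ => (q.2.2, V q))
        (((ContinuousLinearMap.snd ℝ ℝ ℝ).comp (ContinuousLinearMap.snd ℝ ℝ (ℝ × ℝ))).prod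
          (fderiv ℝ V q)) q :=
      ((hasFDerivAt_snd.comp q hasFDerivAt_snd)).prodMk (hV q).hasFDerivAt
    have h2 := (((twiceLip_sourcePair hr).diff' (q.2.2, V q)).hasFDerivAt).comp q h1
    exact h2.clm_apply ((hasFDerivAt_const (0 : ℝ) q).prodMk (hW q).hasFDerivAt)
  refine ⟨fun q => (key q).differentiableAt, fun q i j => ?_⟩
  rw [(key q).fderiv]
  simp [add_comm]

theorem norm_fderiv_linearised_le (hr : TwiceLip r) {K : ℝ≥0} (hK : LipschitzWith K r)
    {V W : ℝ × ℝ × ℝ → ℂ} (hV : Differentiable ℝ V) (hW : Differentiable ℝ W) {F : ℝ}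
    {q : ℝ × ℝ × ℝ} (hq : ‖fderiv ℝ (fderiv ℝ (sourcePair r)) (q.2.2, V q)‖ ≤ F) (i j : ℝ) :
    ‖fderiv ℝ (fun q : ℝ × ℝ × ℝ => fderiv ℝ (sourcePair r) (q.2.2, V q) (0, W q)) q (i, j, 0)‖ ≤
      F * ‖fderiv ℝ V q (i, j, 0)‖ * ‖W q‖ + K * ‖fderiv ℝ W q (i, j, 0)‖ := by
  rw [(hasFDerivAt_linearised hr hV hW).2]
  refine (norm_add_le _ _).trans (add_le_add ?_ (norm_fderiv_sourcePair_le hr hK _ _))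
  have h1 := ContinuousLinearMap.le_opNorm₂ (fderiv ℝ (fderiv ℝ (sourcePair r)) (q.2.2, V q))
    (0, fderiv ℝ V q (i, j, 0)) (0, W q)
  refine h1.trans ?_
  simp only [Prod.norm_mk, norm_zero, norm_nonneg, sup_of_le_right]
  gcongr

end SourceBounds

/-! ### Equations for the first derivatives. -/

section Equations

variable {c a₀ ε : ℝ} {K : ℝ≥0} {a : ℝ → ℝ} {r : ℂ → ℂ} {α : ℝ → ℂ} {V : ℝ × ℝ × ℝ → ℂ}

theorem apply_transportDir {F : Type*} [NormedAddCommGroup F] [NormedSpace ℝ F]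
    (L : ℝ × ℝ × ℝ →L[ℝ] F) (q : ℝ × ℝ × ℝ) : L (transportDir c ε a q) =
      L (1, 0, 0) + c • L (0, 1, 0) + (a q.2.1 / ε) • L (0, 0, 1) := by
  rw [← map_smul, ← map_smul, ← map_add, ← map_add]
  simp [transportDir]

/-- The phase derivative is recovered from the transport equation, with a gain of `ε`. -/
theorem norm_phase_deriv_le (h : Admissible c a₀ K a r α) (hε : 0 < ε) (L : ℝ × ℝ × ℝ →L[ℝ] ℂ)
    (q : ℝ × ℝ × ℝ) : ‖L (0, 0, 1)‖ / ε ≤ (‖L (transportDir c ε a q)‖ + ‖L (1, 0, 0)‖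
      + c * ‖L (0, 1, 0)‖) / a₀ := by
  have e : (a q.2.1 / ε) • L (0, 0, 1) =
      L (transportDir c ε a q) - L (1, 0, 0) - c • L (0, 1, 0) := by
    rw [apply_transportDir]; abel
  have h1 : a q.2.1 / ε * ‖L (0, 0, 1)‖ ≤ ‖L (transportDir c ε a q)‖ + ‖L (1, 0, 0)‖
      + c * ‖L (0, 1, 0)‖ := by
    rw [← Real.norm_of_nonneg (div_pos (h.pos_a q.2.1) hε).le, ← norm_smul, e]
    refine (norm_sub_le _ _).trans (add_le_add (norm_sub_le _ _) ?_)
    rw [norm_smul, Real.norm_of_nonneg h.c_pos.le]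
  rw [le_div_iff₀ h.a₀_pos]
  refine le_trans ?_ h1
  rw [div_mul_eq_mul_div, div_mul_eq_mul_div, mul_comm]
  gcongr
  exact h.le_a _

namespace IsGlobalSolution

/-- The transport direction does not depend on `t`, so differentiating the equation in time and
using symmetry of the second derivative leaves no commutator. -/
theorem eqn_time (hV : IsGlobalSolution c ε a r α V) (hr : TwiceLip r) (q : ℝ × ℝ × ℝ) :
    fderiv ℝ (fun y => fderiv ℝ V y (1, 0, 0)) q (transportDir c ε a q) =
      -fderiv ℝ (sourcePair r) (q.2.2, V q) (0, fderiv ℝ V q (1, 0, 0)) := by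
  obtain ⟨t, x, τ⟩ := q
  rw [hV.twiceLip.fderiv_fderiv_apply, hV.twiceLip.symm]
  have h1 := (hasDerivAt_line_fst hV.twiceLip.diff' t x τ).clm_apply
    (hasDerivAt_const t ((1, c, a x / ε) : ℝ × ℝ × ℝ))
  have h2 := (hasDerivAt_sourcePair_comp hr τ (hasDerivAt_line_fst hV.twiceLip.diff t x τ)).neg
  have e : (fun s => fderiv ℝ V (s, x, τ) (1, c, a x / ε)) =
      -fun s => sourcePair r (τ, V (s, x, τ)) :=
    funext fun s => hV.eqn (s, x, τ)
  rw [← e] at h2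
  show (fderiv ℝ (fderiv ℝ V) (t, x, τ)) (1, 0, 0) (1, c, a x / ε) = _
  simpa using h1.unique h2

/-- Differentiating in `x` leaves `(a'/ε) ∂_τ V`. Writing it as `(a'/a) (a/ε) ∂_τ V` and inserting
the equation removes every power of `1/ε` from the source. -/
theorem eqn_space (hV : IsGlobalSolution c ε a r α V) (h : Admissible c a₀ K a r α)
    (q : ℝ × ℝ × ℝ) :
    fderiv ℝ (fun y => fderiv ℝ V y (0, 1, 0)) q (transportDir c ε a q) =
      -fderiv ℝ (sourcePair r) (q.2.2, V q) (0, fderiv ℝ V q (0, 1, 0))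
        + (deriv a q.2.1 / a q.2.1) • (sourcePair r (q.2.2, V q) + fderiv ℝ V q (1, 0, 0)
          + c • fderiv ℝ V q (0, 1, 0)) := by
  have hq := hV.eqn q
  rw [apply_transportDir] at hq
  obtain ⟨t, x, τ⟩ := q
  rw [hV.twiceLip.fderiv_fderiv_apply, hV.twiceLip.symm]
  have hX : HasDerivAt (fun y => ((1, c, a y / ε) : ℝ × ℝ × ℝ)) (0, 0, deriv a x / ε) x :=
    (hasDerivAt_const x _).prodMk ((hasDerivAt_const x _).prodMk ((h.hasDerivAt_a x).div_const ε))
  have h1 := (hasDerivAt_line_snd hV.twiceLip.diff' t x τ).clm_apply hX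
  have h2 := (hasDerivAt_sourcePair_comp h.twiceLip_r τ
    (hasDerivAt_line_snd hV.twiceLip.diff t x τ)).neg
  have e : (fun y => fderiv ℝ V (t, y, τ) (1, c, a y / ε)) =
      -fun y => sourcePair r (τ, V (t, y, τ)) :=
    funext fun y => hV.eqn (t, y, τ)
  rw [← e] at h2
  have h3 := h1.unique h2
  have e2 : ((0, 0, deriv a x / ε) : ℝ × ℝ × ℝ) = (deriv a x / ε) • (0, 0, 1) := by simp
  rw [e2, map_smul] at h3
  have ha := (h.pos_a x).ne'
  have e3 : (deriv a x / ε) • fderiv ℝ V (t, x, τ) (0, 0, 1) = -((deriv a x / a x) •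
      (sourcePair r (τ, V (t, x, τ)) + fderiv ℝ V (t, x, τ) (1, 0, 0)
        + c • fderiv ℝ V (t, x, τ) (0, 1, 0))) := by
    have e4 : deriv a x / ε = deriv a x / a x * (a x / ε) := by field_simp
    rw [e4, mul_smul, ← smul_neg]
    congr 1
    have e5 : sourcePair r (τ, V (t, x, τ)) = filteredSource r τ (V (t, x, τ)) := rfl
    rw [e5]
    simp only at hq
    linear_combination hq
  rw [e3] at h3
  show (fderiv ℝ (fderiv ℝ V) (t, x, τ)) (0, 1, 0) (1, c, a x / ε) = _
  linear_combination h3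

theorem exists_bound (hV : IsGlobalSolution c ε a r α V) (T : ℝ) :
    ∃ C : ℝ, 0 ≤ C ∧ ∀ q : ℝ × ℝ × ℝ, q.1 ∈ Ico 0 T → ‖V q‖ ≤ C ∧ ‖fderiv ℝ V q‖ ≤ C ∧
      ‖fderiv ℝ (fderiv ℝ V) q‖ ≤ C := by
  refine hV.twiceLip.exists_bound_of_periodic (S := {q | q.1 ∈ Ico 0 T})
    (s := Ico 0 T ×ˢ Icc 0 1 ×ˢ Icc 0 (2 * Real.pi))
    ((Metric.isBounded_Ico 0 T).prod ((Metric.isBounded_Icc 0 1).prod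
      (Metric.isBounded_Icc 0 (2 * Real.pi)))) fun q hq => ?_
  obtain ⟨n, hn⟩ := exists_periodic_shift one_pos q.2.1
  obtain ⟨m, hm⟩ := exists_periodic_shift Real.two_pi_pos q.2.2
  refine ⟨(0, n * 1, m * (2 * Real.pi)), ⟨by simpa using hq, hn, hm⟩, fun y => ?_⟩
  have h1 : Function.Periodic (fun x => V (y.1, x, y.2.2 + m * (2 * Real.pi))) 1 := fun x =>
    hV.periodic_x _ _ _
  have h2 : Function.Periodic (fun σ => V (y.1, y.2.1, σ)) (2 * Real.pi) := fun σ =>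
    hV.periodic_phase _ _ _
  have h3 := h1.int_mul n y.2.1
  have h4 := h2.int_mul m y.2.2
  calc V (y + ((0 : ℝ), (n : ℝ) * 1, (m : ℝ) * (2 * Real.pi)))
      = V (y.1, y.2.1 + n * 1, y.2.2 + m * (2 * Real.pi)) := by
        congr 1; ext <;> simp
    _ = V y := by rw [h3, h4]

end IsGlobalSolution
end Equations

/-! ### Derivatives at the initial time. -/

section InitialBounds

variable {c a₀ ε : ℝ} {K : ℝ≥0} {a : ℝ → ℝ} {r : ℂ → ℂ} {α : ℝ → ℂ} {V : ℝ × ℝ × ℝ → ℂ}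

theorem Admissible.twiceLip_initialProfile (h : Admissible c a₀ K a r α) :
    TwiceLip (initialProfile a r α) :=
  NGO.twiceLip_initialProfile h.contDiff_a (fun x => (h.pos_a x).ne') h.twiceLip_r h.contDiff_α

theorem Admissible.exists_bound_initialProfile (h : Admissible c a₀ K a r α) :
    ∃ b, 0 ≤ b ∧ ∀ p, ‖initialProfile a r α p‖ ≤ b ∧ ‖fderiv ℝ (initialProfile a r α) p‖ ≤ b ∧
      ‖fderiv ℝ (fderiv ℝ (initialProfile a r α)) p‖ ≤ b := by
  obtain ⟨b, hb0, hb⟩ := h.twiceLip_initialProfile.exists_bound_of_periodic (S := univ)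
    (s := Icc 0 1 ×ˢ Icc 0 (2 * Real.pi))
    ((Metric.isBounded_Icc 0 1).prod (Metric.isBounded_Icc 0 (2 * Real.pi))) fun p _ => by
      obtain ⟨n, hn⟩ := exists_periodic_shift one_pos p.1
      obtain ⟨m, hm⟩ := exists_periodic_shift Real.two_pi_pos p.2
      refine ⟨(n * 1, m * (2 * Real.pi)), ⟨hn, hm⟩, fun y => ?_⟩
      have h1 : Function.Periodic (fun x => initialProfile a r α (x, y.2 + m * (2 * Real.pi))) 1 :=
        fun x => initialProfile_periodic_fst h.periodic_a h.periodic_α _ _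
      have h2 : Function.Periodic (fun σ => initialProfile a r α (y.1, σ)) (2 * Real.pi) :=
        fun σ => initialProfile_periodic_snd h.twiceLip_r _ _
      exact (h1.int_mul n y.1).trans (h2.int_mul m y.2)
  exact ⟨b, hb0, fun p => hb p (mem_univ p)⟩

namespace IsGlobalSolution

theorem init_eq (hV : IsGlobalSolution c ε a r α V) (x τ : ℝ) :
    V (0, x, τ) = α x + ε • (initialProfile a r α) (x, τ) := by
  rw [hV.init, wellPrepared_eq, Complex.real_smul]

theorem init_space (hV : IsGlobalSolution c ε a r α V) (h : Admissible c a₀ K a r α) (x τ : ℝ) :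
    fderiv ℝ V (0, x, τ) (0, 1, 0) =
      deriv α x + ε • fderiv ℝ (initialProfile a r α) (x, τ) (1, 0) := by
  refine (hasDerivAt_line_snd hV.twiceLip.diff 0 x τ).unique ?_
  simp only [hV.init_eq]
  exact (h.hasDerivAt_α x).add
    ((hasDerivAt_line_pair_fst h.twiceLip_initialProfile.diff x τ).const_smul ε)

theorem init_phase (hV : IsGlobalSolution c ε a r α V) (h : Admissible c a₀ K a r α) (x τ : ℝ) :
    fderiv ℝ V (0, x, τ) (0, 0, 1) = ε • fderiv ℝ (initialProfile a r α) (x, τ) (0, 1) := by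
  refine (hasDerivAt_line_thd hV.twiceLip.diff 0 x τ).unique ?_
  simp only [hV.init_eq]
  exact ((hasDerivAt_line_pair_snd h.twiceLip_initialProfile.diff x τ).const_smul ε).const_add _

theorem init_time (hV : IsGlobalSolution c ε a r α V) (h : Admissible c a₀ K a r α) (hε : 0 < ε)
    (x τ : ℝ) : fderiv ℝ V (0, x, τ) (1, 0, 0) = -sourcePair r (τ, V (0, x, τ))
      - c • (deriv α x + ε • fderiv ℝ (initialProfile a r α) (x, τ) (1, 0))
      - a x • fderiv ℝ (initialProfile a r α) (x, τ) (0, 1) := by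
  have h1 := hV.eqn (0, x, τ)
  rw [apply_transportDir, hV.init_space h, hV.init_phase h, smul_smul,
    div_mul_cancel₀ _ hε.ne'] at h1
  have e : sourcePair r (τ, V (0, x, τ)) = filteredSource r τ (V (0, x, τ)) := rfl
  rw [e]
  simp only at h1
  linear_combination h1

theorem init_space_space (hV : IsGlobalSolution c ε a r α V) (h : Admissible c a₀ K a r α)
    (x τ : ℝ) : fderiv ℝ (fun q => fderiv ℝ V q (0, 1, 0)) (0, x, τ) (0, 1, 0) =
      deriv (deriv α) x + ε • fderiv ℝ (fderiv ℝ (initialProfile a r α)) (x, τ) (1, 0) (1, 0) := by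
  have hd : Differentiable ℝ fun q => fderiv ℝ V q (0, 1, 0) := fun q =>
    (hV.twiceLip.hasFDerivAt_fderiv_apply q _).differentiableAt
  have hβ := h.twiceLip_initialProfile
  refine (hasDerivAt_line_snd hd 0 x τ).unique ?_
  simp only [hV.init_space h]
  have h1 := hasDerivAt_line_pair_fst
    (fun q => (hβ.hasFDerivAt_fderiv_apply q ((1, 0) : ℝ × ℝ)).differentiableAt) x τ
  rw [hβ.fderiv_fderiv_apply] at h1
  exact ((h.contDiff_deriv_α.differentiable (by norm_num) x).hasDerivAt).add (h1.const_smul ε)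

theorem init_time_space (hV : IsGlobalSolution c ε a r α V) (h : Admissible c a₀ K a r α)
    (hε : 0 < ε) (x τ : ℝ) : fderiv ℝ (fun q => fderiv ℝ V q (1, 0, 0)) (0, x, τ) (0, 1, 0) =
      -fderiv ℝ (sourcePair r) (τ, V (0, x, τ)) (0, fderiv ℝ V (0, x, τ) (0, 1, 0))
      - c • (deriv (deriv α) x + ε • fderiv ℝ (fderiv ℝ (initialProfile a r α)) (x, τ) (1, 0) (1, 0))
      - (a x • fderiv ℝ (fderiv ℝ (initialProfile a r α)) (x, τ) (1, 0) (0, 1)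
        + deriv a x • fderiv ℝ (initialProfile a r α) (x, τ) (0, 1)) := by
  have hd : Differentiable ℝ fun q => fderiv ℝ V q (1, 0, 0) := fun q =>
    (hV.twiceLip.hasFDerivAt_fderiv_apply q _).differentiableAt
  have hβ := h.twiceLip_initialProfile
  refine (hasDerivAt_line_snd hd 0 x τ).unique ?_
  simp only [hV.init_time h hε]
  have h1 := hasDerivAt_line_pair_fst
    (fun q => (hβ.hasFDerivAt_fderiv_apply q ((1, 0) : ℝ × ℝ)).differentiableAt) x τ
  have h2 := hasDerivAt_line_pair_fst
    (fun q => (hβ.hasFDerivAt_fderiv_apply q ((0, 1) : ℝ × ℝ)).differentiableAt) x τ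
  rw [hβ.fderiv_fderiv_apply] at h1 h2
  exact (((hasDerivAt_sourcePair_comp h.twiceLip_r τ
    (hasDerivAt_line_snd hV.twiceLip.diff 0 x τ)).neg).sub
    ((((h.contDiff_deriv_α.differentiable (by norm_num) x).hasDerivAt).add
      (h1.const_smul ε)).const_smul c)).sub ((h.hasDerivAt_a x).smul h2)

/-- This is the defining property of the corrector: its phase derivative cancels the oscillating
part of the source at `α`. -/
theorem init_profile_phase (h : Admissible c a₀ K a r α) (x τ : ℝ) :
    a x • fderiv ℝ (initialProfile a r α) (x, τ) (0, 1) =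
      (phaseMean fun σ => filteredSource r σ (α x)) - sourcePair r (τ, α x) := by
  rw [(hasDerivAt_line_pair_snd h.twiceLip_initialProfile.diff x τ).unique
    (hasDerivAt_initialProfile_snd h.twiceLip_r x τ), Complex.real_smul, ← mul_assoc,
    ← Complex.ofReal_mul, mul_one_div_cancel (h.pos_a x).ne', Complex.ofReal_one, one_mul]
  rfl

/-- By `init_profile_phase` the source enters `∂_t V(0)` only through its difference between `V(0)`
and `α`, apart from a phase average. Since `V(0) - α` is `O(ε)`, the phase derivative is `O(ε)` as
well. -/
theorem init_time_phase (hV : IsGlobalSolution c ε a r α V) (h : Admissible c a₀ K a r α)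
    (hε : 0 < ε) (x τ : ℝ) : fderiv ℝ (fun q => fderiv ℝ V q (1, 0, 0)) (0, x, τ) (0, 0, 1) =
      -(fderiv ℝ (sourcePair r) (τ, V (0, x, τ)) - fderiv ℝ (sourcePair r) (τ, α x)) (1, 0)
      - ε • (fderiv ℝ (sourcePair r) (τ, V (0, x, τ))
          (0, fderiv ℝ (initialProfile a r α) (x, τ) (0, 1))
        + c • fderiv ℝ (fderiv ℝ (initialProfile a r α)) (x, τ) (0, 1) (1, 0)) := by
  have hd : Differentiable ℝ fun q => fderiv ℝ V q (1, 0, 0) := fun q =>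
    (hV.twiceLip.hasFDerivAt_fderiv_apply q _).differentiableAt
  have hβ := h.twiceLip_initialProfile
  have hs := twiceLip_sourcePair h.twiceLip_r
  have h1 := hasDerivAt_line_pair_snd
    (fun q => (hβ.hasFDerivAt_fderiv_apply q ((1, 0) : ℝ × ℝ)).differentiableAt) x τ
  rw [hβ.fderiv_fderiv_apply] at h1
  have h2 : HasDerivAt (fun σ => (σ, V (0, x, σ))) (1, fderiv ℝ V (0, x, τ) (0, 0, 1)) τ :=
    (hasDerivAt_id τ).prodMk (hasDerivAt_line_thd hV.twiceLip.diff 0 x τ)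
  have h3 := (hs.diff (τ, V (0, x, τ))).hasFDerivAt.comp_hasDerivAt τ h2
  have h4 : HasDerivAt (fun σ => (σ, α x)) ((1 : ℝ), (0 : ℂ)) τ :=
    (hasDerivAt_id τ).prodMk (hasDerivAt_const τ (α x))
  have h5 := (hs.diff (τ, α x)).hasFDerivAt.comp_hasDerivAt τ h4
  have h6 := ((h3.neg).sub (((h1.const_smul ε).const_add (deriv α x)).const_smul c)).sub
    (h5.const_sub (phaseMean fun σ => filteredSource r σ (α x)))
  have e : (fun σ => fderiv ℝ V (0, x, σ) (1, 0, 0)) = fun σ => -sourcePair r (σ, V (0, x, σ))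
      - c • (deriv α x + ε • fderiv ℝ (initialProfile a r α) (x, σ) (1, 0))
      - ((phaseMean fun σ => filteredSource r σ (α x)) - sourcePair r (σ, α x)) := by
    funext σ
    rw [hV.init_time h hε, init_profile_phase h]
  have h7 := hasDerivAt_line_thd hd 0 x τ
  rw [e] at h7
  rw [h7.unique h6, hV.init_phase h]
  have e2 : ((1, ε • fderiv ℝ (initialProfile a r α) (x, τ) (0, 1)) : ℝ × ℂ) =
      (1, 0) + ε • (0, fderiv ℝ (initialProfile a r α) (x, τ) (0, 1)) := by simp
  rw [e2, map_add, map_smul, sub_apply]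
  module

theorem norm_init_time_phase_le (hV : IsGlobalSolution c ε a r α V) (h : Admissible c a₀ K a r α)
    (hε : 0 < ε) {b F : ℝ} {x τ : ℝ} (hF : 0 ≤ F)
    (hb : ∀ p, ‖(initialProfile a r α) p‖ ≤ b ∧ ‖fderiv ℝ (initialProfile a r α) p‖ ≤ b ∧
      ‖fderiv ℝ (fderiv ℝ (initialProfile a r α)) p‖ ≤ b)
    (hs : ∀ p : ℝ × ℂ, ‖p.2‖ ≤ ‖α x‖ + ε * b → ‖fderiv ℝ (sourcePair r) p‖ ≤ F ∧
      ‖fderiv ℝ (fderiv ℝ (sourcePair r)) p‖ ≤ F) :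
    ‖fderiv ℝ (fun q => fderiv ℝ V q (1, 0, 0)) (0, x, τ) (0, 0, 1)‖ ≤
      ε * (F * b + (F * b + c * b)) := by
  have hb0 : 0 ≤ b := (norm_nonneg _).trans (hb 0).1
  have hεb : ‖ε • (initialProfile a r α) (x, τ)‖ ≤ ε * b := by
    rw [norm_smul, Real.norm_of_nonneg hε.le]; exact mul_le_mul_of_nonneg_left (hb _).1 hε.le
  have hconv : Convex ℝ {p : ℝ × ℂ | ‖p.2‖ ≤ ‖α x‖ + ε * b} := by
    intro p hp p' hp' u v hu hv huv
    have := convex_closedBall (0 : ℂ) (‖α x‖ + ε * b) (mem_closedBall_zero_iff.2 hp)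
      (mem_closedBall_zero_iff.2 hp') hu hv huv
    exact mem_closedBall_zero_iff.1 this
  have hV0 : ‖V (0, x, τ)‖ ≤ ‖α x‖ + ε * b := by
    rw [hV.init_eq]; exact (norm_add_le _ _).trans (add_le_add le_rfl hεb)
  have hα0 : ‖α x‖ ≤ ‖α x‖ + ε * b := le_add_of_nonneg_right (mul_nonneg hε.le hb0)
  have h1 : ‖fderiv ℝ (sourcePair r) (τ, V (0, x, τ)) - fderiv ℝ (sourcePair r) (τ, α x)‖ ≤
      F * (ε * b) := by
    have := hconv.norm_image_sub_le_of_norm_fderiv_le (𝕜 := ℝ)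
      (f := fderiv ℝ (sourcePair r)) (C := F)
      (x := (τ, α x)) (y := (τ, V (0, x, τ)))
      (fun p _ => (twiceLip_sourcePair h.twiceLip_r).diff' p) (fun p hp => (hs p hp).2) hα0 hV0
    refine this.trans ?_
    gcongr
    rw [Prod.mk_sub_mk, sub_self, Prod.norm_mk, norm_zero, hV.init_eq, add_sub_cancel_left]
    exact max_le (by positivity) hεb
  have hone : ‖((1, 0) : ℝ × ℂ)‖ = 1 := by simp [Prod.norm_mk]
  have h10 : ‖((1, 0) : ℝ × ℝ)‖ = 1 := by simp [Prod.norm_mk]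
  have h01 : ‖((0, 1) : ℝ × ℝ)‖ = 1 := by simp [Prod.norm_mk]
  rw [hV.init_time_phase h hε]
  refine (norm_sub_le _ _).trans ?_
  rw [norm_neg, norm_smul, Real.norm_of_nonneg hε.le, mul_add ε]
  refine add_le_add ?_ (mul_le_mul_of_nonneg_left ((norm_add_le _ _).trans
    (add_le_add ?_ ?_)) hε.le)
  · refine (ContinuousLinearMap.le_of_opNorm_le _ h1 _).trans (le_of_eq ?_)
    rw [hone]; ring
  · refine (ContinuousLinearMap.le_of_opNorm_le _ (hs _ hV0).1 _).trans ?_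
    have h2 := ContinuousLinearMap.le_of_opNorm_le _ (hb (x, τ)).2.1 ((0, 1) : ℝ × ℝ)
    rw [h01, mul_one] at h2
    rw [Prod.norm_mk, norm_zero]
    exact mul_le_mul_of_nonneg_left (max_le hb0 h2) hF
  · rw [norm_smul, Real.norm_of_nonneg h.c_pos.le]
    have h2 := ContinuousLinearMap.le_opNorm₂
      (fderiv ℝ (fderiv ℝ (initialProfile a r α)) (x, τ)) (0, 1) (1, 0)
    rw [h10, h01, mul_one, mul_one] at h2
    exact mul_le_mul_of_nonneg_left (h2.trans (hb _).2.2) h.c_pos.le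

end IsGlobalSolution

/-- The derivatives at `t = 0` are bounded uniformly in `ε`. -/
theorem Admissible.exists_initial_bound (h : Admissible c a₀ K a r α) :
    ∃ B, 0 ≤ B ∧ ∀ ε, 0 < ε → ε ≤ 1 → ∀ V, IsGlobalSolution c ε a r α V → ∀ x τ,
      ‖V (0, x, τ)‖ ≤ B ∧ ‖fderiv ℝ V (0, x, τ) (1, 0, 0)‖ ≤ B ∧
      ‖fderiv ℝ V (0, x, τ) (0, 1, 0)‖ ≤ B ∧
      ‖fderiv ℝ (fun q => fderiv ℝ V q (1, 0, 0)) (0, x, τ) (1, 0, 0)‖ ≤ B ∧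
      ‖fderiv ℝ (fun q => fderiv ℝ V q (1, 0, 0)) (0, x, τ) (0, 1, 0)‖ ≤ B ∧
      ‖fderiv ℝ (fun q => fderiv ℝ V q (0, 1, 0)) (0, x, τ) (0, 1, 0)‖ ≤ B := by
  obtain ⟨M, hM0, hM⟩ := h.exists_coeff_bound
  obtain ⟨b, hb0, hb⟩ := h.exists_bound_initialProfile
  obtain ⟨F, hF0, hF⟩ := exists_bound_sourcePair h.twiceLip_r (M + b)
  have hc := h.c_pos.le
  have hK : 0 ≤ (K : ℝ) := K.2
  set Bt := F + c * (M + b) + M * b with hBt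
  set Btx := K * (M + b) + c * (M + b) + (M * b + M * b) with hBtx
  set Btt := K * Bt + c * Btx + M * (F * b + (F * b + c * b)) with hBtt
  have hBt0 : 0 ≤ Bt := by positivity
  have hBtx0 : 0 ≤ Btx := by positivity
  have hBtt0 : 0 ≤ Btt := by positivity
  refine ⟨(M + b) + Bt + Btx + Btt, by positivity, fun ε hε hε1 V hV x τ => ?_⟩
  have h10 : ‖((1, 0) : ℝ × ℝ)‖ = 1 := by simp [Prod.norm_mk]
  have h01 : ‖((0, 1) : ℝ × ℝ)‖ = 1 := by simp [Prod.norm_mk]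
  obtain ⟨ma, mda, -, -, mα, mdα, mddα⟩ := hM x
  have hsm : ∀ {z : ℂ}, ‖z‖ ≤ b → ‖ε • z‖ ≤ b := fun hz => by
    rw [norm_smul, Real.norm_of_nonneg hε.le]
    exact (mul_le_mul hε1 hz (norm_nonneg _) zero_le_one).trans (by simp)
  have hsa : ∀ {s m : ℝ} {z : ℂ}, |s| ≤ M → ‖z‖ ≤ b → ‖s • z‖ ≤ M * b := fun hs hz => by
    rw [norm_smul, Real.norm_eq_abs]; exact mul_le_mul hs hz (norm_nonneg _) hM0
  have hβ1 : ∀ v : ℝ × ℝ, ‖v‖ = 1 → ‖fderiv ℝ (initialProfile a r α) (x, τ) v‖ ≤ b := fun v hv => by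
    have := ContinuousLinearMap.le_of_opNorm_le _ (hb (x, τ)).2.1 v
    rwa [hv, mul_one] at this
  have hβ2 : ∀ v w : ℝ × ℝ, ‖v‖ = 1 → ‖w‖ = 1 →
      ‖fderiv ℝ (fderiv ℝ (initialProfile a r α)) (x, τ) v w‖ ≤ b := fun v w hv hw => by
    have := ContinuousLinearMap.le_opNorm₂ (fderiv ℝ (fderiv ℝ (initialProfile a r α)) (x, τ)) v w
    rw [hv, hw, mul_one, mul_one] at this
    exact this.trans (hb _).2.2
  have b0 : ‖V (0, x, τ)‖ ≤ M + b := by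
    rw [hV.init_eq]
    exact (norm_add_le _ _).trans (add_le_add mα (hsm (hb _).1))
  have bx : ‖fderiv ℝ V (0, x, τ) (0, 1, 0)‖ ≤ M + b := by
    rw [hV.init_space h]
    exact (norm_add_le _ _).trans (add_le_add mdα (hsm (hβ1 _ h10)))
  have hcs : ∀ {z : ℂ} {m : ℝ}, ‖z‖ ≤ m → ‖c • z‖ ≤ c * m := fun hz => by
    rw [norm_smul, Real.norm_of_nonneg hc]; exact mul_le_mul_of_nonneg_left hz hc
  have bt : ‖fderiv ℝ V (0, x, τ) (1, 0, 0)‖ ≤ Bt := by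
    rw [hV.init_time h hε]
    refine (norm_sub_le _ _).trans (add_le_add ((norm_sub_le _ _).trans (add_le_add ?_ ?_)) ?_)
    · rw [norm_neg]; exact (hF (τ, V (0, x, τ)) b0).1
    · exact hcs ((norm_add_le _ _).trans (add_le_add mdα (hsm (hβ1 _ h10))))
    · exact hsa (m := 0) ma (hβ1 _ h01)
  have bxx : ‖fderiv ℝ (fun q => fderiv ℝ V q (0, 1, 0)) (0, x, τ) (0, 1, 0)‖ ≤ M + b := by
    rw [hV.init_space_space h]
    exact (norm_add_le _ _).trans (add_le_add mddα (hsm (hβ2 _ _ h10 h10)))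
  have btx : ‖fderiv ℝ (fun q => fderiv ℝ V q (1, 0, 0)) (0, x, τ) (0, 1, 0)‖ ≤ Btx := by
    rw [hV.init_time_space h hε]
    refine (norm_sub_le _ _).trans (add_le_add ((norm_sub_le _ _).trans (add_le_add ?_ ?_)) ?_)
    · rw [norm_neg]
      exact (norm_fderiv_sourcePair_le h.twiceLip_r h.lipschitz_r _ _).trans
        (mul_le_mul_of_nonneg_left bx hK)
    · exact hcs ((norm_add_le _ _).trans (add_le_add mddα (hsm (hβ2 _ _ h10 h10))))
    · exact (norm_add_le _ _).trans (add_le_add (hsa (m := 0) ma (hβ2 _ _ h10 h01))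
        (hsa (m := 0) mda (hβ1 _ h01)))
  have btτ := hV.norm_init_time_phase_le h hε hF0 hb (x := x) (τ := τ) (fun p hp =>
    (hF p (hp.trans (add_le_add mα (by nlinarith)))).2)
  -- The time-differentiated equation expresses `∂_t² V(0)` through `(a/ε) ∂_τ ∂_t V(0)`; the factor
  -- `ε` in `btτ` absorbs the singular coefficient.
  have btt : ‖fderiv ℝ (fun q => fderiv ℝ V q (1, 0, 0)) (0, x, τ) (1, 0, 0)‖ ≤ Btt := by
    have e := hV.eqn_time h.twiceLip_r (0, x, τ)
    rw [apply_transportDir, ← eq_sub_iff_add_eq, ← eq_sub_iff_add_eq] at e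
    rw [e]
    have h1 : ‖(a x / ε) • fderiv ℝ (fun q => fderiv ℝ V q (1, 0, 0)) (0, x, τ) (0, 0, 1)‖ ≤
        M * (F * b + (F * b + c * b)) := by
      rw [norm_smul, Real.norm_eq_abs, abs_div, abs_of_pos hε, div_mul_eq_mul_div,
        div_le_iff₀ hε]
      refine (mul_le_mul ma btτ (norm_nonneg _) hM0).trans (le_of_eq ?_)
      ring
    have h2 : ‖-fderiv ℝ (sourcePair r) (τ, V (0, x, τ)) (0, fderiv ℝ V (0, x, τ) (1, 0, 0))‖ ≤
        K * Bt := by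
      rw [norm_neg]
      exact (norm_fderiv_sourcePair_le h.twiceLip_r h.lipschitz_r _ _).trans
        (mul_le_mul_of_nonneg_left bt hK)
    have h3 := hcs btx
    refine (norm_sub_le _ _).trans ((add_le_add_left (norm_sub_le _ _) _).trans ?_)
    simp only at h1 h2 h3 ⊢
    linarith
  refine ⟨?_, ?_, ?_, ?_, ?_, ?_⟩ <;> linarith

end InitialBounds

/-! ### Bounds uniform in the small parameter. -/

section UniformBounds

variable {c a₀ ε T A₁ : ℝ} {K : ℝ≥0} {a : ℝ → ℝ} {r : ℂ → ℂ} {α : ℝ → ℂ} {V : ℝ × ℝ × ℝ → ℂ}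

/-- The constant of the a priori estimate for transported derivatives. -/
def transportConst (T B A k : ℝ) : ℝ := 2 * (B + 2 * A * T) * Real.exp ((4 * k + 1) * T)

theorem transportConst_nonneg {T B A k : ℝ} (hT : 0 ≤ T) (hB : 0 ≤ B) (hA : 0 ≤ A) :
    0 ≤ transportConst T B A k := by
  unfold transportConst; positivity

theorem differentiable_sourcePair_comp (hr : TwiceLip r) (hV : Differentiable ℝ V) :
    Differentiable ℝ fun q : ℝ × ℝ × ℝ => sourcePair r (q.2.2, V q) :=
  (twiceLip_sourcePair hr).diff.comp
    ((differentiable_snd.comp differentiable_snd).prodMk hV)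

theorem fderiv_sourcePair_comp (hr : TwiceLip r) (hV : Differentiable ℝ V) (q : ℝ × ℝ × ℝ)
    (i j : ℝ) : fderiv ℝ (fun q : ℝ × ℝ × ℝ => sourcePair r (q.2.2, V q)) q (i, j, 0) =
      fderiv ℝ (sourcePair r) (q.2.2, V q) (0, fderiv ℝ V q (i, j, 0)) := by
  have h1 : HasFDerivAt (fun q : ℝ × ℝ × ℝ => (q.2.2, V q))
      (((ContinuousLinearMap.snd ℝ ℝ ℝ).comp (ContinuousLinearMap.snd ℝ ℝ (ℝ × ℝ))).prod
        (fderiv ℝ V q)) q :=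
    ((hasFDerivAt_snd.comp q hasFDerivAt_snd)).prodMk (hV q).hasFDerivAt
  have h2 := ((((twiceLip_sourcePair hr).diff (q.2.2, V q)).hasFDerivAt).comp q h1).fderiv
  change fderiv ℝ (fun q : ℝ × ℝ × ℝ => sourcePair r (q.2.2, V q)) q = _ at h2
  rw [h2]
  simp

theorem norm_fderiv_neg_apply (f : ℝ × ℝ × ℝ → ℂ) (q v : ℝ × ℝ × ℝ) :
    ‖fderiv ℝ (fun q => -f q) q v‖ = ‖fderiv ℝ f q v‖ := by
  rw [fderiv_fun_neg, neg_apply, norm_neg]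

theorem norm_fderiv_neg_sourcePair_le (h : Admissible c a₀ K a r α) (hV : Differentiable ℝ V)
    (q : ℝ × ℝ × ℝ) (i j : ℝ) :
    ‖fderiv ℝ (fun q : ℝ × ℝ × ℝ => -sourcePair r (q.2.2, V q)) q (i, j, 0)‖ ≤
      K * ‖fderiv ℝ V q (i, j, 0)‖ := by
  rw [norm_fderiv_neg_apply, fderiv_sourcePair_comp h.twiceLip_r hV]
  exact norm_fderiv_sourcePair_le h.twiceLip_r h.lipschitz_r _ _

namespace IsGlobalSolution

theorem differentiable_fderiv_apply (hV : IsGlobalSolution c ε a r α V) (v : ℝ × ℝ × ℝ) :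
    Differentiable ℝ fun q => fderiv ℝ V q v := fun q =>
  (hV.twiceLip.hasFDerivAt_fderiv_apply q v).differentiableAt

theorem exists_bound_fderiv_apply (hV : IsGlobalSolution c ε a r α V) (T : ℝ) (v : ℝ × ℝ × ℝ) :
    ∃ N, ∀ q : ℝ × ℝ × ℝ, q.1 ∈ Ico 0 T → ‖fderiv ℝ V q v‖ ≤ N := by
  obtain ⟨C, -, hC⟩ := hV.exists_bound T
  exact ⟨_, fun q hq => ContinuousLinearMap.le_of_opNorm_le _ (hC q hq).2.1 v⟩

theorem exists_bound_fderiv_fderiv_apply (hV : IsGlobalSolution c ε a r α V) (T : ℝ)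
    (v w : ℝ × ℝ × ℝ) : ∃ N, ∀ q : ℝ × ℝ × ℝ, q.1 ∈ Ico 0 T →
      ‖fderiv ℝ (fun y => fderiv ℝ V y v) q w‖ ≤ N := by
  obtain ⟨C, -, hC⟩ := hV.exists_bound T
  refine ⟨C * ‖w‖ * ‖v‖, fun q hq => ?_⟩
  rw [hV.twiceLip.fderiv_fderiv_apply]
  refine (ContinuousLinearMap.le_opNorm₂ _ _ _).trans ?_
  gcongr
  exact (hC q hq).2.2

/-- For a pure time shift the phase speed is unchanged, so the commutator term vanishes and only the
Lipschitz constant of the source remains. -/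
theorem norm_time_deriv_le (hV : IsGlobalSolution c ε a r α V) (h : Admissible c a₀ K a r α)
    (hε : 0 < ε) (hT : 0 ≤ T) (hA : ∀ x y, |a x - a y| ≤ A₁ * |x - y|) {B : ℝ}
    (hB : ∀ x τ, ‖fderiv ℝ V (0, x, τ) (1, 0, 0)‖ ≤ B) :
    ∀ q : ℝ × ℝ × ℝ, q.1 ∈ Ico 0 T → ‖fderiv ℝ V q (1, 0, 0)‖ ≤ transportConst T B 0 K := by
  have hd := hV.twiceLip.diff
  refine norm_fderiv_le_of_transport_of_bounded h.c_pos hε hT h.contDiff_a.continuous hA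
    zero_le_one le_rfl le_rfl le_rfl K.2 hd
    (differentiable_sourcePair_comp h.twiceLip_r hd).neg hV.eqn hB (fun q _ => ?_)
    (fun q _ => ?_) (hV.exists_bound_fderiv_apply T _)
  · rw [zero_add]
    exact norm_fderiv_neg_sourcePair_le h hd q 1 0
  · rw [zero_mul, zero_div, zero_mul]
    positivity

theorem norm_le (hV : IsGlobalSolution c ε a r α V) {B C : ℝ}
    (hB : ∀ x τ, ‖V (0, x, τ)‖ ≤ B)
    (hC : ∀ q : ℝ × ℝ × ℝ, q.1 ∈ Ico 0 T → ‖fderiv ℝ V q (1, 0, 0)‖ ≤ C) :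
    ∀ q : ℝ × ℝ × ℝ, q.1 ∈ Ico 0 T → ‖V q‖ ≤ B + C * T := by
  rintro ⟨t, x, τ⟩ ⟨ht0 : 0 ≤ t, htT : t < T⟩
  have h1 := (convex_Ico 0 T).norm_image_sub_le_of_norm_hasDerivWithin_le (x := 0) (y := t)
    (f := fun s => V (s, x, τ)) (C := C)
    (fun s _ => (hasDerivAt_line_fst hV.twiceLip.diff s x τ).hasDerivWithinAt)
    (fun s hs => hC (s, x, τ) hs) ⟨le_rfl, ht0.trans_lt htT⟩ ⟨ht0, htT⟩
  have hC0 : 0 ≤ C := (norm_nonneg _).trans (hC (t, x, τ) ⟨ht0, htT⟩)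
  have h2 : ‖V (t, x, τ)‖ ≤ ‖V (0, x, τ)‖ + ‖V (t, x, τ) - V (0, x, τ)‖ := by
    simpa using norm_add_le (V (0, x, τ)) (V (t, x, τ) - V (0, x, τ))
  refine h2.trans (add_le_add (hB x τ) (h1.trans ?_))
  rw [sub_zero, Real.norm_of_nonneg ht0]
  exact mul_le_mul_of_nonneg_left htT.le hC0

/-- Control of the commutator of `∂_x` with the transport operator. -/
theorem norm_commutator_le (h : Admissible c a₀ K a r α) (hε : 0 < ε) (hA₁ : 0 ≤ A₁)
    (L : ℝ × ℝ × ℝ →L[ℝ] ℂ) (q : ℝ × ℝ × ℝ) {s m A k : ℝ}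
    (hs : ‖L (transportDir c ε a q)‖ ≤ s) (hm : ‖L (1, 0, 0)‖ ≤ m)
    (hA : A₁ / a₀ * (s + m) ≤ A) (hk : A₁ / a₀ * c ≤ k) :
    1 * A₁ / ε * ‖L (0, 0, 1)‖ ≤ A + k * ‖L (0, 1, 0)‖ := by
  have h1 := norm_phase_deriv_le h hε L q
  have h2 : 1 * A₁ / ε * ‖L (0, 0, 1)‖ = A₁ * (‖L (0, 0, 1)‖ / ε) := by ring
  rw [h2]
  calc A₁ * (‖L (0, 0, 1)‖ / ε) ≤ A₁ * ((s + m + c * ‖L (0, 1, 0)‖) / a₀) := by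
        refine mul_le_mul_of_nonneg_left (h1.trans ?_) hA₁
        have := h.a₀_pos
        gcongr
    _ = A₁ / a₀ * (s + m) + A₁ / a₀ * c * ‖L (0, 1, 0)‖ := by ring
    _ ≤ A + k * ‖L (0, 1, 0)‖ := by gcongr

/-- The commutator is traded for the source, `∂_t V`, and a multiple of `∂_x V` itself; the last
goes into the Gronwall rate, which is why the time derivative must be bounded beforehand. -/
theorem norm_space_deriv_le (hV : IsGlobalSolution c ε a r α V) (h : Admissible c a₀ K a r α)
    (hε : 0 < ε) (hT : 0 ≤ T) (hA₁ : 0 ≤ A₁) (hA : ∀ x y, |a x - a y| ≤ A₁ * |x - y|)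
    {B F C₁ : ℝ} (hF0 : 0 ≤ F) (hC0 : 0 ≤ C₁)
    (hB : ∀ x τ, ‖fderiv ℝ V (0, x, τ) (0, 1, 0)‖ ≤ B)
    (hF : ∀ q : ℝ × ℝ × ℝ, q.1 ∈ Ico 0 T → ‖sourcePair r (q.2.2, V q)‖ ≤ F)
    (hC : ∀ q : ℝ × ℝ × ℝ, q.1 ∈ Ico 0 T → ‖fderiv ℝ V q (1, 0, 0)‖ ≤ C₁) :
    ∀ q : ℝ × ℝ × ℝ, q.1 ∈ Ico 0 T → ‖fderiv ℝ V q (0, 1, 0)‖ ≤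
      transportConst T B (A₁ / a₀ * (F + C₁)) (K + A₁ / a₀ * c) := by
  have hd := hV.twiceLip.diff
  have hc := h.c_pos
  have ha := h.a₀_pos
  have hK : (0 : ℝ) ≤ K := K.2
  refine norm_fderiv_le_of_transport_of_bounded h.c_pos hε hT h.contDiff_a.continuous hA
    le_rfl zero_le_one zero_le_one (by positivity) (by positivity) hd
    (differentiable_sourcePair_comp h.twiceLip_r hd).neg hV.eqn hB (fun q _ => ?_)
    (fun q hq => ?_) (hV.exists_bound_fderiv_apply T _)
  · refine (norm_fderiv_neg_sourcePair_le h hd q 0 1).trans ?_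
    refine (mul_le_mul_of_nonneg_right (le_add_of_nonneg_right (by positivity))
      (norm_nonneg _)).trans (le_add_of_nonneg_left (by positivity))
  · refine norm_commutator_le h hε hA₁ _ q ?_ (hC q hq) le_rfl (le_add_of_nonneg_left hK)
    rw [hV.eqn, norm_neg]
    exact hF q hq

theorem norm_phase_le (h : Admissible c a₀ K a r α) (hε : 0 < ε) (hε1 : ε ≤ 1)
    (hV : IsGlobalSolution c ε a r α V) {q : ℝ × ℝ × ℝ} {F C₁ C₂ : ℝ}
    (hF : ‖sourcePair r (q.2.2, V q)‖ ≤ F) (hC₁ : ‖fderiv ℝ V q (1, 0, 0)‖ ≤ C₁)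
    (hC₂ : ‖fderiv ℝ V q (0, 1, 0)‖ ≤ C₂) :
    ‖fderiv ℝ V q (0, 0, 1)‖ ≤ (F + C₁ + c * C₂) / a₀ := by
  have h1 := norm_phase_deriv_le h hε (fderiv ℝ V q) q
  rw [hV.eqn, norm_neg] at h1
  have hc := h.c_pos
  have ha := h.a₀_pos
  calc ‖fderiv ℝ V q (0, 0, 1)‖ ≤ ‖fderiv ℝ V q (0, 0, 1)‖ / ε :=
        le_div_self (norm_nonneg _) hε hε1
    _ ≤ _ := h1
    _ ≤ _ := by
        gcongr
        exact hF

theorem norm_time_time_deriv_le (hV : IsGlobalSolution c ε a r α V) (h : Admissible c a₀ K a r α)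
    (hε : 0 < ε) (hT : 0 ≤ T) (hA : ∀ x y, |a x - a y| ≤ A₁ * |x - y|)
    {B F C₁ : ℝ} (hF0 : 0 ≤ F) (hC0 : 0 ≤ C₁)
    (hB : ∀ x τ, ‖fderiv ℝ (fun q => fderiv ℝ V q (1, 0, 0)) (0, x, τ) (1, 0, 0)‖ ≤ B)
    (hF : ∀ q : ℝ × ℝ × ℝ, q.1 ∈ Ico 0 T → ‖fderiv ℝ (fderiv ℝ (sourcePair r)) (q.2.2, V q)‖ ≤ F)
    (hC : ∀ q : ℝ × ℝ × ℝ, q.1 ∈ Ico 0 T → ‖fderiv ℝ V q (1, 0, 0)‖ ≤ C₁) :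
    ∀ q : ℝ × ℝ × ℝ, q.1 ∈ Ico 0 T → ‖fderiv ℝ (fun q => fderiv ℝ V q (1, 0, 0)) q (1, 0, 0)‖ ≤
      transportConst T B (F * C₁ * C₁) K := by
  have hd := hV.twiceLip.diff
  have hd1 := hV.differentiable_fderiv_apply (1, 0, 0)
  refine norm_fderiv_le_of_transport_of_bounded h.c_pos hε hT h.contDiff_a.continuous hA
    zero_le_one le_rfl le_rfl (by positivity) K.2 hd1
    (hasFDerivAt_linearised h.twiceLip_r hd hd1).1.neg (hV.eqn_time h.twiceLip_r) hB
    (fun q hq => ?_) (fun q _ => ?_) (hV.exists_bound_fderiv_fderiv_apply T _ _)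
  · rw [Pi.neg_def, norm_fderiv_neg_apply]
    refine (norm_fderiv_linearised_le h.twiceLip_r h.lipschitz_r hd hd1 (hF q hq) 1 0).trans ?_
    have := hC q hq
    gcongr
  · rw [zero_mul, zero_div, zero_mul]
    have : (0 : ℝ) ≤ K := K.2
    positivity

/-- The same exchange applied to `∂_t V`: its commutator costs `∂_t² V`, so that derivative has to
come first. -/
theorem norm_time_space_deriv_le (hV : IsGlobalSolution c ε a r α V)
    (h : Admissible c a₀ K a r α)
    (hε : 0 < ε) (hT : 0 ≤ T) (hA₁ : 0 ≤ A₁) (hA : ∀ x y, |a x - a y| ≤ A₁ * |x - y|)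
    {B F C₁ C₂ C₄ : ℝ} (hF0 : 0 ≤ F) (hC₁0 : 0 ≤ C₁) (hC₂0 : 0 ≤ C₂) (hC₄0 : 0 ≤ C₄)
    (hB : ∀ x τ, ‖fderiv ℝ (fun q => fderiv ℝ V q (1, 0, 0)) (0, x, τ) (0, 1, 0)‖ ≤ B)
    (hF : ∀ q : ℝ × ℝ × ℝ, q.1 ∈ Ico 0 T → ‖fderiv ℝ (fderiv ℝ (sourcePair r)) (q.2.2, V q)‖ ≤ F)
    (hC₁ : ∀ q : ℝ × ℝ × ℝ, q.1 ∈ Ico 0 T → ‖fderiv ℝ V q (1, 0, 0)‖ ≤ C₁)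
    (hC₂ : ∀ q : ℝ × ℝ × ℝ, q.1 ∈ Ico 0 T → ‖fderiv ℝ V q (0, 1, 0)‖ ≤ C₂)
    (hC₄ : ∀ q : ℝ × ℝ × ℝ, q.1 ∈ Ico 0 T →
      ‖fderiv ℝ (fun q => fderiv ℝ V q (1, 0, 0)) q (1, 0, 0)‖ ≤ C₄) :
    ∀ q : ℝ × ℝ × ℝ, q.1 ∈ Ico 0 T → ‖fderiv ℝ (fun q => fderiv ℝ V q (1, 0, 0)) q (0, 1, 0)‖ ≤
      transportConst T B (F * C₂ * C₁ + A₁ / a₀ * (K * C₁ + C₄)) (K + A₁ / a₀ * c) := by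
  have hd := hV.twiceLip.diff
  have hd1 := hV.differentiable_fderiv_apply (1, 0, 0)
  have hc := h.c_pos
  have ha := h.a₀_pos
  have hK : (0 : ℝ) ≤ K := K.2
  refine norm_fderiv_le_of_transport_of_bounded h.c_pos hε hT h.contDiff_a.continuous hA
    le_rfl zero_le_one zero_le_one (by positivity) (by positivity) hd1
    (hasFDerivAt_linearised h.twiceLip_r hd hd1).1.neg (hV.eqn_time h.twiceLip_r) hB
    (fun q hq => ?_) (fun q hq => ?_) (hV.exists_bound_fderiv_fderiv_apply T _ _)
  · rw [Pi.neg_def, norm_fderiv_neg_apply]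
    refine (norm_fderiv_linearised_le h.twiceLip_r h.lipschitz_r hd hd1 (hF q hq) 0 1).trans ?_
    have h1 := hC₁ q hq
    have h2 := hC₂ q hq
    refine add_le_add ?_ (mul_le_mul_of_nonneg_right (le_add_of_nonneg_right (by positivity))
      (norm_nonneg _))
    refine le_trans ?_ (le_add_of_nonneg_right (by positivity))
    gcongr
  · refine norm_commutator_le h hε hA₁ _ q (s := K * C₁) ?_ (hC₄ q hq)
      (le_add_of_nonneg_left (by positivity)) (le_add_of_nonneg_left hK)
    rw [hV.eqn_time h.twiceLip_r, norm_neg]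
    exact (norm_fderiv_sourcePair_le h.twiceLip_r h.lipschitz_r _ _).trans
      (mul_le_mul_of_nonneg_left (hC₁ q hq) hK)

/-- The right-hand side of the transport equation for `∂_x V`. -/
def spaceSource (c : ℝ) (a : ℝ → ℝ) (r : ℂ → ℂ) (V : ℝ × ℝ × ℝ → ℂ) (q : ℝ × ℝ × ℝ) : ℂ :=
  -fderiv ℝ (sourcePair r) (q.2.2, V q) (0, fderiv ℝ V q (0, 1, 0))
    + (deriv a q.2.1 / a q.2.1) • (sourcePair r (q.2.2, V q) + fderiv ℝ V q (1, 0, 0)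
      + c • fderiv ℝ V q (0, 1, 0))

theorem differentiable_spaceSource (hV : IsGlobalSolution c ε a r α V)
    (h : Admissible c a₀ K a r α) : Differentiable ℝ (spaceSource c a r V) := by
  have hd := hV.twiceLip.diff
  have hd1 := hV.differentiable_fderiv_apply (1, 0, 0)
  have hd2 := hV.differentiable_fderiv_apply (0, 1, 0)
  have hm : Differentiable ℝ fun q : ℝ × ℝ × ℝ => deriv a q.2.1 / a q.2.1 :=
    (h.contDiff_logDeriv.differentiable (by norm_num)).comp
      (differentiable_fst.comp differentiable_snd)
  exact (hasFDerivAt_linearised h.twiceLip_r hd hd2).1.neg.add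
    (hm.smul (((differentiable_sourcePair_comp h.twiceLip_r hd).add hd1).add (hd2.const_smul c)))

theorem norm_spaceSource_le (h : Admissible c a₀ K a r α) {M F C₁ C₂ : ℝ} {q : ℝ × ℝ × ℝ}
    (hM0 : 0 ≤ M) (hM : |deriv a q.2.1 / a q.2.1| ≤ M) (hF : ‖sourcePair r (q.2.2, V q)‖ ≤ F)
    (hC₁ : ‖fderiv ℝ V q (1, 0, 0)‖ ≤ C₁) (hC₂ : ‖fderiv ℝ V q (0, 1, 0)‖ ≤ C₂) :
    ‖spaceSource c a r V q‖ ≤ K * C₂ + M * (F + C₁ + c * C₂) := by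
  have hc := h.c_pos
  refine (norm_add_le _ _).trans (add_le_add ?_ ?_)
  · rw [norm_neg]
    exact (norm_fderiv_sourcePair_le h.twiceLip_r h.lipschitz_r _ _).trans
      (mul_le_mul_of_nonneg_left hC₂ K.2)
  · rw [norm_smul, Real.norm_eq_abs]
    refine mul_le_mul hM ((norm_add₃_le).trans ?_) (norm_nonneg _) hM0
    rw [norm_smul, Real.norm_of_nonneg hc.le]
    gcongr

theorem norm_fderiv_spaceSource_le (hV : IsGlobalSolution c ε a r α V)
    (h : Admissible c a₀ K a r α) {M F C₁ C₂ C₅ : ℝ} {q : ℝ × ℝ × ℝ}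
    (hM0 : 0 ≤ M) (hM : |deriv a q.2.1 / a q.2.1| ≤ M)
    (hM' : |deriv (fun x => deriv a x / a x) q.2.1| ≤ M)
    (hF0 : 0 ≤ F) (hF : ‖sourcePair r (q.2.2, V q)‖ ≤ F)
    (hF2 : ‖fderiv ℝ (fderiv ℝ (sourcePair r)) (q.2.2, V q)‖ ≤ F)
    (hC₁ : ‖fderiv ℝ V q (1, 0, 0)‖ ≤ C₁) (hC₂ : ‖fderiv ℝ V q (0, 1, 0)‖ ≤ C₂)
    (hC₅ : ‖fderiv ℝ (fun q => fderiv ℝ V q (1, 0, 0)) q (0, 1, 0)‖ ≤ C₅) :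
    ‖fderiv ℝ (spaceSource c a r V) q (0, 1, 0)‖ ≤
      (F * C₂ * C₂ + M * (F + C₁ + c * C₂) + M * (K * C₂ + C₅))
        + (K + M * c) * ‖fderiv ℝ (fun q => fderiv ℝ V q (0, 1, 0)) q (0, 1, 0)‖ := by
  have hc := h.c_pos
  have hK : (0 : ℝ) ≤ K := K.2
  have hd := hV.twiceLip.diff
  have hd1 := hV.differentiable_fderiv_apply (1, 0, 0)
  have hd2 := hV.differentiable_fderiv_apply (0, 1, 0)
  have hlin := norm_fderiv_linearised_le h.twiceLip_r h.lipschitz_r hd hd2 hF2 0 1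
  obtain ⟨t, x, τ⟩ := q
  have hm : HasDerivAt (fun x => deriv a x / a x) _ x :=
    (h.contDiff_logDeriv.differentiable (by norm_num) x).hasDerivAt
  have e : fderiv ℝ (spaceSource c a r V) (t, x, τ) (0, 1, 0) = _ :=
    (hasDerivAt_line_snd (hV.differentiable_spaceSource h) t x τ).unique
    ((hasDerivAt_line_snd (hasFDerivAt_linearised h.twiceLip_r hd hd2).1 t x τ).neg.add
      (hm.smul (((hasDerivAt_sourcePair_comp h.twiceLip_r τ (hasDerivAt_line_snd hd t x τ)).add
        (hasDerivAt_line_snd hd1 t x τ)).add ((hasDerivAt_line_snd hd2 t x τ).const_smul c))))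
  rw [e]
  have hsum : ‖sourcePair r (τ, V (t, x, τ)) + fderiv ℝ V (t, x, τ) (1, 0, 0)
      + c • fderiv ℝ V (t, x, τ) (0, 1, 0)‖ ≤ F + C₁ + c * C₂ := by
    refine norm_add₃_le.trans ?_
    rw [norm_smul, Real.norm_of_nonneg hc.le]
    gcongr
  have hdsum : ‖fderiv ℝ (sourcePair r) (τ, V (t, x, τ)) (0, fderiv ℝ V (t, x, τ) (0, 1, 0))
      + fderiv ℝ (fun q => fderiv ℝ V q (1, 0, 0)) (t, x, τ) (0, 1, 0)
      + c • fderiv ℝ (fun q => fderiv ℝ V q (0, 1, 0)) (t, x, τ) (0, 1, 0)‖ ≤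
      K * C₂ + C₅ + c * ‖fderiv ℝ (fun q => fderiv ℝ V q (0, 1, 0)) (t, x, τ) (0, 1, 0)‖ := by
    refine norm_add₃_le.trans ?_
    rw [norm_smul, Real.norm_of_nonneg hc.le]
    exact add_le_add (add_le_add ((norm_fderiv_sourcePair_le h.twiceLip_r h.lipschitz_r _ _).trans
      (mul_le_mul_of_nonneg_left hC₂ hK)) hC₅) le_rfl
  have h1 : F * ‖fderiv ℝ V (t, x, τ) (0, 1, 0)‖ * ‖fderiv ℝ V (t, x, τ) (0, 1, 0)‖ ≤
      F * C₂ * C₂ := by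
    have := (norm_nonneg _).trans hC₂
    gcongr
  have h2 := mul_le_mul hM hdsum (norm_nonneg _) hM0
  have h3 := mul_le_mul hM' hsum (norm_nonneg _) hM0
  refine (norm_add_le _ _).trans ((add_le_add le_rfl (norm_add_le _ _)).trans ?_)
  rw [norm_neg, norm_smul, norm_smul, Real.norm_eq_abs, Real.norm_eq_abs]
  simp only at h2 h3 hlin ⊢
  linarith

/-- The exchange applied to `∂_x V`, with the source of `eqn_space`. The commutator and the
derivative of that source both cost the mixed derivative, so this estimate comes last. -/
theorem norm_space_space_deriv_le (hV : IsGlobalSolution c ε a r α V)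
    (h : Admissible c a₀ K a r α)
    (hε : 0 < ε) (hT : 0 ≤ T) (hA₁ : 0 ≤ A₁) (hA : ∀ x y, |a x - a y| ≤ A₁ * |x - y|)
    {B F M C₁ C₂ C₅ : ℝ} (hF0 : 0 ≤ F) (hM0 : 0 ≤ M) (hC₁0 : 0 ≤ C₁) (hC₂0 : 0 ≤ C₂)
    (hC₅0 : 0 ≤ C₅) (hM : ∀ x, |deriv a x / a x| ≤ M)
    (hM' : ∀ x, |deriv (fun x => deriv a x / a x) x| ≤ M)
    (hB : ∀ x τ, ‖fderiv ℝ (fun q => fderiv ℝ V q (0, 1, 0)) (0, x, τ) (0, 1, 0)‖ ≤ B)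
    (hF : ∀ q : ℝ × ℝ × ℝ, q.1 ∈ Ico 0 T → ‖sourcePair r (q.2.2, V q)‖ ≤ F)
    (hF2 : ∀ q : ℝ × ℝ × ℝ, q.1 ∈ Ico 0 T → ‖fderiv ℝ (fderiv ℝ (sourcePair r)) (q.2.2, V q)‖ ≤ F)
    (hC₁ : ∀ q : ℝ × ℝ × ℝ, q.1 ∈ Ico 0 T → ‖fderiv ℝ V q (1, 0, 0)‖ ≤ C₁)
    (hC₂ : ∀ q : ℝ × ℝ × ℝ, q.1 ∈ Ico 0 T → ‖fderiv ℝ V q (0, 1, 0)‖ ≤ C₂)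
    (hC₅ : ∀ q : ℝ × ℝ × ℝ, q.1 ∈ Ico 0 T →
      ‖fderiv ℝ (fun q => fderiv ℝ V q (1, 0, 0)) q (0, 1, 0)‖ ≤ C₅) :
    ∀ q : ℝ × ℝ × ℝ, q.1 ∈ Ico 0 T → ‖fderiv ℝ (fun q => fderiv ℝ V q (0, 1, 0)) q (0, 1, 0)‖ ≤
      transportConst T B ((F * C₂ * C₂ + M * (F + C₁ + c * C₂) + M * (K * C₂ + C₅))
        + A₁ / a₀ * (K * C₂ + M * (F + C₁ + c * C₂) + C₅)) (K + M * c + A₁ / a₀ * c) := by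
  have hc := h.c_pos
  have ha := h.a₀_pos
  have hK : (0 : ℝ) ≤ K := K.2
  refine norm_fderiv_le_of_transport_of_bounded h.c_pos hε hT h.contDiff_a.continuous hA
    le_rfl zero_le_one zero_le_one (by positivity) (by positivity)
    (hV.differentiable_fderiv_apply (0, 1, 0)) (hV.differentiable_spaceSource h)
    (hV.eqn_space h) hB
    (fun q hq => ?_) (fun q hq => ?_) (hV.exists_bound_fderiv_fderiv_apply T _ _)
  · refine (hV.norm_fderiv_spaceSource_le h hM0 (hM _) (hM' _) hF0 (hF q hq) (hF2 q hq) (hC₁ q hq)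
      (hC₂ q hq) (hC₅ q hq)).trans (add_le_add (le_add_of_nonneg_right (by positivity))
        (mul_le_mul_of_nonneg_right (le_add_of_nonneg_right (by positivity)) (norm_nonneg _)))
  · refine norm_commutator_le h hε hA₁ _ q (s := K * C₂ + M * (F + C₁ + c * C₂)) (m := C₅) ?_ ?_
      (le_add_of_nonneg_left (by positivity)) (le_add_of_nonneg_left (by positivity))
    · rw [hV.eqn_space h]
      exact norm_spaceSource_le h hM0 (hM _) (hF q hq) (hC₁ q hq) (hC₂ q hq)
    · rw [hV.twiceLip.fderiv_fderiv_apply, hV.twiceLip.symm, ← hV.twiceLip.fderiv_fderiv_apply]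
      exact hC₅ q hq

end IsGlobalSolution

/-- All derivatives in the theorem are bounded on `[0, T)`, uniformly in `ε`. -/
theorem Admissible.exists_uniform_bound (h : Admissible c a₀ K a r α) (hT : 0 ≤ T) :
    ∃ C, 0 ≤ C ∧ ∀ ε, 0 < ε → ε ≤ 1 → ∀ V, IsGlobalSolution c ε a r α V →
      ∀ q : ℝ × ℝ × ℝ, q.1 ∈ Ico 0 T →
      ‖V q‖ ≤ C ∧ ‖fderiv ℝ V q (1, 0, 0)‖ ≤ C ∧
      ‖fderiv ℝ V q (0, 1, 0)‖ ≤ C ∧ ‖fderiv ℝ V q (0, 0, 1)‖ ≤ C ∧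
      ‖fderiv ℝ (fun q => fderiv ℝ V q (1, 0, 0)) q (1, 0, 0)‖ ≤ C ∧
      ‖fderiv ℝ (fun q => fderiv ℝ V q (1, 0, 0)) q (0, 1, 0)‖ ≤ C ∧
      ‖fderiv ℝ (fun q => fderiv ℝ V q (0, 1, 0)) q (0, 1, 0)‖ ≤ C := by
  obtain ⟨M, hM0, hM⟩ := h.exists_coeff_bound
  obtain ⟨A₁, hA₁, hA⟩ := h.exists_lipschitz_a
  obtain ⟨B, hB0, hB⟩ := h.exists_initial_bound
  have hc := h.c_pos
  have ha := h.a₀_pos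
  have hK : (0 : ℝ) ≤ K := K.2
  obtain ⟨C₁, e₁⟩ : ∃ C₁, C₁ = transportConst T B 0 K := ⟨_, rfl⟩
  have p₁ : 0 ≤ C₁ := e₁ ▸ transportConst_nonneg hT hB0 le_rfl
  -- The amplitude `B + C₁ * T` of `V` is known once `C₁` is. Only now can bounds on the source and
  -- its second derivative be fixed, uniformly in `ε`.
  obtain ⟨F, hF0, hF⟩ := exists_bound_sourcePair h.twiceLip_r (B + C₁ * T)
  obtain ⟨C₂, e₂⟩ : ∃ C₂, C₂ = transportConst T B (A₁ / a₀ * (F + C₁)) (K + A₁ / a₀ * c) :=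
    ⟨_, rfl⟩
  have p₂ : 0 ≤ C₂ := e₂ ▸ transportConst_nonneg hT hB0 (by positivity)
  obtain ⟨C₄, e₄⟩ : ∃ C₄, C₄ = transportConst T B (F * C₁ * C₁) K := ⟨_, rfl⟩
  have p₄ : 0 ≤ C₄ := e₄ ▸ transportConst_nonneg hT hB0 (by positivity)
  obtain ⟨C₅, e₅⟩ : ∃ C₅, C₅ = transportConst T B (F * C₂ * C₁ + A₁ / a₀ * (K * C₁ + C₄))
    (K + A₁ / a₀ * c) := ⟨_, rfl⟩
  have p₅ : 0 ≤ C₅ := e₅ ▸ transportConst_nonneg hT hB0 (by positivity)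
  obtain ⟨C₆, e₆⟩ : ∃ C₆, C₆ = transportConst T B ((F * C₂ * C₂ + M * (F + C₁ + c * C₂)
    + M * (K * C₂ + C₅)) + A₁ / a₀ * (K * C₂ + M * (F + C₁ + c * C₂) + C₅))
      (K + M * c + A₁ / a₀ * c) := ⟨_, rfl⟩
  have p₆ : 0 ≤ C₆ := e₆ ▸ transportConst_nonneg hT hB0 (by positivity)
  have p₃ : 0 ≤ (F + C₁ + c * C₂) / a₀ := by positivity
  have p₀ : 0 ≤ B + C₁ * T := by positivity
  refine ⟨(B + C₁ * T) + C₁ + C₂ + (F + C₁ + c * C₂) / a₀ + C₄ + C₅ + C₆, by positivity,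
    fun ε hε hε1 V hV => ?_⟩
  have hi := hB ε hε hε1 V hV
  have b₁ := hV.norm_time_deriv_le h hε hT hA fun x τ => (hi x τ).2.1
  rw [← e₁] at b₁
  have b₀ := hV.norm_le (fun x τ => (hi x τ).1) b₁
  have hs : ∀ q : ℝ × ℝ × ℝ, q.1 ∈ Ico 0 T → ‖sourcePair r (q.2.2, V q)‖ ≤ F := fun q hq =>
    (hF (q.2.2, V q) (b₀ q hq)).1
  have hs2 : ∀ q : ℝ × ℝ × ℝ, q.1 ∈ Ico 0 T →
      ‖fderiv ℝ (fderiv ℝ (sourcePair r)) (q.2.2, V q)‖ ≤ F := fun q hq =>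
    (hF (q.2.2, V q) (b₀ q hq)).2.2
  have b₂ := hV.norm_space_deriv_le h hε hT hA₁ hA hF0 p₁ (fun x τ => (hi x τ).2.2.1) hs b₁
  rw [← e₂] at b₂
  have b₄ := hV.norm_time_time_deriv_le h hε hT hA hF0 p₁ (fun x τ => (hi x τ).2.2.2.1) hs2 b₁
  rw [← e₄] at b₄
  have b₅ := hV.norm_time_space_deriv_le h hε hT hA₁ hA hF0 p₁ p₂ p₄
    (fun x τ => (hi x τ).2.2.2.2.1) hs2 b₁ b₂ b₄
  rw [← e₅] at b₅
  have b₆ := hV.norm_space_space_deriv_le h hε hT hA₁ hA hF0 hM0 p₁ p₂ p₅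
    (fun x => (hM x).2.2.1) (fun x => (hM x).2.2.2.1) (fun x τ => (hi x τ).2.2.2.2.2)
    hs hs2 b₁ b₂ b₅
  rw [← e₆] at b₆
  intro q hq
  have b₃ := hV.norm_phase_le h hε hε1 (hs q hq) (b₁ q hq) (b₂ q hq)
  have c₀ := b₀ q hq
  have c₁ := b₁ q hq
  have c₂ := b₂ q hq
  have c₄ := b₄ q hq
  have c₅ := b₅ q hq
  have c₆ := b₆ q hq
  refine ⟨?_, ?_, ?_, ?_, ?_, ?_, ?_⟩ <;> linarith

end UniformBounds

/-! ### Classical solutions: uniqueness and transfer of the bounds. -/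

section ClassicalSolutions

variable {c a₀ ε T : ℝ} {K : ℝ≥0} {a : ℝ → ℝ} {r : ℂ → ℂ} {α : ℝ → ℂ}

theorem Admissible.exists_globalSolution (h : Admissible c a₀ K a r α) (hε : 0 < ε) :
    ∃ V, IsGlobalSolution c ε a r α V := by
  obtain ⟨V, h1, h2, h3, h4, h5⟩ := exists_global_solution h.c_pos hε h.contDiff_a h.periodic_a
    (fun x => (h.pos_a x).ne') h.twiceLip_r h.lipschitz_r h.contDiff_α h.periodic_α
  exact ⟨V, h1, h2, h3, h4, h5⟩

theorem IsGlobalSolution.isSolution {V : ℝ × ℝ × ℝ → ℂ} (hV : IsGlobalSolution c ε a r α V)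
    (hT : 0 < T) : IsSolution c T ε a r α fun t x τ => V (t, x, τ) where
  contDiffOn := hV.twiceLip.contDiff.contDiffOn
  periodic_x := fun t _ => hV.periodic_x t
  periodic_phase := fun t _ => hV.periodic_phase t
  init := hV.init
  eqn := fun t ht x τ => by
    have hd := hV.twiceLip.diff
    have h1 := hV.eqn (t, x, τ)
    rw [apply_transportDir] at h1
    rw [(hasDerivAt_line_fst hd t x τ).hasDerivWithinAt.derivWithin (uniqueDiffOn_Icc hT t ht),
      (hasDerivAt_line_snd hd t x τ).deriv, (hasDerivAt_line_thd hd t x τ).deriv]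
    simp only [Complex.real_smul] at h1
    linear_combination h1

namespace IsSolution

variable {V V' : ℝ → ℝ → ℝ → ℂ}

/-- Along a characteristic, a classical solution solves an ordinary differential equation. -/
theorem hasDerivWithinAt_characteristic (hV : IsSolution c T ε a r α V) (hT : 0 < T)
    {γ : ℝ → ℝ × ℝ × ℝ} (hγ : ∀ s, (γ s).1 = s)
    (hγ' : ∀ s, HasDerivAt γ (transportDir c ε a (γ s)) s) {s : ℝ} (hs : s ∈ Icc 0 T) :
    HasDerivWithinAt (fun s => V (γ s).1 (γ s).2.1 (γ s).2.2)
      (-filteredSource r (γ s).2.2 (V (γ s).1 (γ s).2.1 (γ s).2.2)) (Icc 0 T) s := by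
  have hmem : ∀ s ∈ Icc 0 T, γ s ∈ Icc 0 T ×ˢ (univ : Set (ℝ × ℝ)) := fun s hs =>
    ⟨by rw [hγ]; exact hs, mem_univ _⟩
  obtain ⟨L, hL⟩ : ∃ L, HasFDerivWithinAt (fun p : ℝ × ℝ × ℝ => V p.1 p.2.1 p.2.2) L
    (Icc 0 T ×ˢ univ) (γ s) :=
    ⟨_, (hV.contDiffOn.differentiableOn (by norm_num) _ (hmem s hs)).hasFDerivWithinAt⟩
  have h1 : HasDerivWithinAt (fun s => V (γ s).1 (γ s).2.1 (γ s).2.2)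
      (L (transportDir c ε a (γ s))) (Icc 0 T) s :=
    hL.comp_hasDerivWithinAt s (hγ' s).hasDerivWithinAt hmem
  refine h1.congr_deriv ?_
  clear h1
  have ht := hmem s hs
  generalize γ s = q at hL ht
  obtain ⟨t, x, τ⟩ := q
  replace ht : t ∈ Icc 0 T := ht.1
  have mt : MapsTo (fun s => (s, x, τ)) (Icc 0 T) (Icc 0 T ×ˢ (univ : Set (ℝ × ℝ))) :=
    fun s hs => ⟨hs, mem_univ _⟩
  have mx : MapsTo (fun y => (t, y, τ)) univ (Icc 0 T ×ˢ (univ : Set (ℝ × ℝ))) :=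
    fun y _ => ⟨ht, mem_univ _⟩
  have mτ : MapsTo (fun σ => (t, x, σ)) univ (Icc 0 T ×ˢ (univ : Set (ℝ × ℝ))) :=
    fun y _ => ⟨ht, mem_univ _⟩
  have dt : HasDerivWithinAt (fun s => (s, x, τ)) (1, 0, 0) (Icc 0 T) t :=
    ((hasDerivAt_id t).prodMk ((hasDerivAt_const t x).prodMk
      (hasDerivAt_const t τ))).hasDerivWithinAt
  have dx : HasDerivWithinAt (fun y => (t, y, τ)) (0, 1, 0) univ x :=
    ((hasDerivAt_const x t).prodMk ((hasDerivAt_id x).prodMk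
      (hasDerivAt_const x τ))).hasDerivWithinAt
  have dτ : HasDerivWithinAt (fun σ => (t, x, σ)) (0, 0, 1) univ τ :=
    ((hasDerivAt_const τ t).prodMk ((hasDerivAt_const τ x).prodMk
      (hasDerivAt_id τ))).hasDerivWithinAt
  have ht' : HasDerivWithinAt (fun s => V s x τ) (L (1, 0, 0)) (Icc 0 T) t :=
    HasFDerivWithinAt.comp_hasDerivWithinAt (f := fun s => (s, x, τ)) t hL dt mt
  have hx' : HasDerivAt (fun y => V t y τ) (L (0, 1, 0)) x := hasDerivWithinAt_univ.1
    (HasFDerivWithinAt.comp_hasDerivWithinAt (f := fun y => (t, y, τ)) x hL dx mx)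
  have hτ' : HasDerivAt (fun σ => V t x σ) (L (0, 0, 1)) τ := hasDerivWithinAt_univ.1
    (HasFDerivWithinAt.comp_hasDerivWithinAt (f := fun σ => (t, x, σ)) τ hL dτ mτ)
  have h2 := hV.eqn t ht x τ
  rw [ht'.derivWithin (uniqueDiffOn_Icc hT t ht), hx'.deriv, hτ'.deriv] at h2
  rw [apply_transportDir]
  simp only [Complex.real_smul]
  linear_combination h2

/-- Along the characteristic through a given point both solutions satisfy the same Lipschitz ODE
with the same initial value; ODE uniqueness on `[0, T]` gives equality at that point. -/
theorem eqOn (hV : IsSolution c T ε a r α V) (hV' : IsSolution c T ε a r α V')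
    (hT : 0 < T) (hc : 0 < c) (ha : Continuous a) (hr : LipschitzWith K r) :
    ∀ t ∈ Icc 0 T, ∀ x τ, V t x τ = V' t x τ := by
  intro t ht x τ
  obtain ⟨γ, hγq, hγ, hγ'⟩ := exists_characteristic (ε := ε) hc ha (t, x, τ)
  have h1 := fun s (hs : s ∈ Icc 0 T) => hV.hasDerivWithinAt_characteristic hT hγ hγ' hs
  have h2 := fun s (hs : s ∈ Icc 0 T) => hV'.hasDerivWithinAt_characteristic hT hγ hγ' hs
  have key := ODE_solution_unique_of_mem_Icc_right (s := fun _ => univ) (K := K)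
    (v := fun s z => -filteredSource r (γ s).2.2 z)
    (fun s _ => ((filteredSource_lipschitz hr _).neg).lipschitzOnWith)
    (fun s hs => (h1 s hs).continuousWithinAt)
    (fun s hs => (h1 s (Ico_subset_Icc_self hs)).mono_of_mem_nhdsWithin (Icc_mem_nhdsGE_of_mem hs))
    (fun _ _ => mem_univ _)
    (fun s hs => (h2 s hs).continuousWithinAt)
    (fun s hs => (h2 s (Ico_subset_Icc_self hs)).mono_of_mem_nhdsWithin (Icc_mem_nhdsGE_of_mem hs))
    (fun _ _ => mem_univ _)
    (by
      have h0 : (γ 0).1 = 0 := hγ 0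
      simp only [h0]
      rw [hV.init, hV'.init])
  have := key ht
  simp only at hγq this
  rwa [hγq] at this

/-- A classical solution inherits the derivative bounds of a global solution. -/
theorem derivativesBoundedBy (hV : IsSolution c T ε a r α V) {W : ℝ × ℝ × ℝ → ℂ}
    (hW : IsGlobalSolution c ε a r α W) (h : Admissible c a₀ K a r α) (hT : 0 < T) {C : ℝ}
    (hC : ∀ q : ℝ × ℝ × ℝ, q.1 ∈ Icc 0 T →
      ‖W q‖ ≤ C ∧ ‖fderiv ℝ W q (1, 0, 0)‖ ≤ C ∧
      ‖fderiv ℝ W q (0, 1, 0)‖ ≤ C ∧ ‖fderiv ℝ W q (0, 0, 1)‖ ≤ C ∧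
      ‖fderiv ℝ (fun q => fderiv ℝ W q (1, 0, 0)) q (1, 0, 0)‖ ≤ C ∧
      ‖fderiv ℝ (fun q => fderiv ℝ W q (1, 0, 0)) q (0, 1, 0)‖ ≤ C ∧
      ‖fderiv ℝ (fun q => fderiv ℝ W q (0, 1, 0)) q (0, 1, 0)‖ ≤ C) :
    DerivativesBoundedBy T C V := by
  have hd := hW.twiceLip.diff
  have hd1 := hW.differentiable_fderiv_apply (1, 0, 0)
  have hd2 := hW.differentiable_fderiv_apply (0, 1, 0)
  have heq : ∀ t ∈ Icc 0 T, ∀ x τ, V t x τ = W (t, x, τ) :=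
    hV.eqOn (hW.isSolution hT) hT h.c_pos h.contDiff_a.continuous h.lipschitz_r
  refine ⟨fun t x τ => fderiv ℝ W (t, x, τ) (1, 0, 0), fun t x τ => fderiv ℝ W (t, x, τ) (0, 1, 0),
    fun t x τ => fderiv ℝ W (t, x, τ) (0, 0, 1),
    fun t x τ => fderiv ℝ (fun q => fderiv ℝ W q (1, 0, 0)) (t, x, τ) (1, 0, 0),
    fun t x τ => fderiv ℝ (fun q => fderiv ℝ W q (0, 1, 0)) (t, x, τ) (0, 1, 0),
    fun t x τ => fderiv ℝ (fun q => fderiv ℝ W q (1, 0, 0)) (t, x, τ) (0, 1, 0),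
    fun t ht x τ => ?_⟩
  obtain ⟨b₀, bt, bx, bτ, btt, btx, bxx⟩ := hC (t, x, τ) ht
  refine ⟨?_, (hasDerivAt_line_fst hd1 t x τ).hasDerivWithinAt, ?_, hasDerivAt_line_snd hd2 t x τ,
    hasDerivAt_line_snd hd1 t x τ, ?_, ?_, ?_, bt, btt, bx, bxx, btx, bτ⟩
  · exact (hasDerivAt_line_fst hd t x τ).hasDerivWithinAt.congr (fun s hs => heq s hs x τ)
      (heq t ht x τ)
  · simpa only [heq t ht] using hasDerivAt_line_snd hd t x τ
  · refine (hasDerivAt_line_fst hd2 t x τ).hasDerivWithinAt.congr_deriv ?_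
    rw [hW.twiceLip.fderiv_fderiv_apply, hW.twiceLip.symm, ← hW.twiceLip.fderiv_fderiv_apply]
  · simpa only [heq t ht] using hasDerivAt_line_thd hd t x τ
  · rw [heq t ht]
    exact b₀

end IsSolution
end ClassicalSolutions
end NGO
end

theorem theorem2p1 (c T a₀ K : ℝ) (hc : 0 < c) (hT : 0 < T) (ha₀ : 0 < a₀)
    (a : ℝ → ℝ) (ha : ContDiff ℝ 2 a) (ha_per : Function.Periodic a 1) (ha_pos : ∀ x, a₀ ≤ a x)
    (r : ℂ → ℂ) (hr : Differentiable ℝ r) (hr' : Differentiable ℝ (fderiv ℝ r))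
    (hr_bd : ∀ z, ‖fderiv ℝ r z‖ ≤ K) (hr_bd' : ∀ z, ‖fderiv ℝ (fderiv ℝ r) z‖ ≤ K)
    (α : ℝ → ℂ) (hα : ContDiff ℝ 2 α) (hα_per : Function.Periodic α 1) :
    ∃ C : ℝ, 0 < C ∧ ∀ ε : ℝ, 0 < ε → ε ≤ 1 →
      (∃ V, NGO.IsSolution c T ε a r α V) ∧
      (∀ V V', NGO.IsSolution c T ε a r α V → NGO.IsSolution c T ε a r α V' →
        ∀ t ∈ Set.Icc 0 T, ∀ x τ : ℝ, V t x τ = V' t x τ) ∧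
      (∀ V, NGO.IsSolution c T ε a r α V → NGO.DerivativesBoundedBy T C V) := by
  have hK : 0 ≤ K := (norm_nonneg _).trans (hr_bd 0)
  lift K to NNReal using hK
  have h : NGO.Admissible c a₀ K a r α := ⟨hc, ha₀, ha, ha_per, ha_pos,
    NGO.twiceLip_of_bounded_fderiv₂ hr hr' hr_bd', lipschitzWith_of_nnnorm_fderiv_le hr hr_bd,
    hα, hα_per⟩
  -- The a priori bounds hold on a half-open interval; since the constructed solution is global, `T
  -- + 1` brings the endpoint `T` inside.
  obtain ⟨C, hC0, hC⟩ := h.exists_uniform_bound (T := T + 1) (by positivity)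
  refine ⟨C + 1, by positivity, fun ε hε hε1 => ?_⟩
  obtain ⟨W, hW⟩ := h.exists_globalSolution hε
  refine ⟨⟨_, hW.isSolution hT⟩, fun V V' hV hV' =>
    hV.eqOn hV' hT hc ha.continuous h.lipschitz_r, fun V hV =>
    hV.derivativesBoundedBy hW h hT fun q hq => ?_⟩
  obtain ⟨b₀, bt, bx, bτ, btt, btx, bxx⟩ := hC ε hε hε1 W hW q
    ⟨hq.1, hq.2.trans_lt (lt_add_one T)⟩
  have hle := (lt_add_one C).le
  exact ⟨b₀.trans hle, bt.trans hle, bx.trans hle, bτ.trans hle, btt.trans hle, btx.trans hle,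
    bxx.trans hle⟩
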